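/- Consider irregular repetition slotted ALOHA (IRSA) with $N_s$ slots and a population of $K$ users. Each user is independently active with probability $\pi\in(0,1]$; an active user draws a repetition degree $D\in\{1,\dots,d_{\max}\}$ with $\mathbb P(D=d)=\Lambda_d$ and sends a replica of its packet in $D$ distinct slots chosen uniformly at random. Put $\Lambda(x)=\sum_d\Lambda_d x^d$, $\bar d=\Lambda'(1)$ (so the efficiency is $\eta=1/\bar d$). The frame is the bipartite graph whose edges join users to the slots they use. The receiver performs iterative successive interference cancellation (SIC) with $T$-packet reception ($T\ge1$) and SIC efficiency $\gamma\in[0,1]$: the decoding of a slot with $h$ colliding packets, $h-t$ of which have been cancelled, succeeds with probability $(1-P_{\mathrm E|t})\gamma^{h-t}$ if $1\le t\le T$, where $P_{\mathrm E|t}\in[0,1]$, and never if $t>T$; the decoding randomness is independent between slots and of the frame (each slot carries one uniform variable on $[0,1]$, and decoding succeeds when $t\le T$ and this variable is below the success probability). SIC is run as message passing on the graph. At iteration $\ell$, along an edge joining user $u$ to slot $s$, the slot is *not yet resolved* if its decoding fails when the replica of $u$ and those of the other users of $s$ not yet detected (along their edges to $s$) remain and all other replicas in $s$ are cancelled; the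 user is *not yet detected* at iteration $\ell\ge1$ if none of the other slots containing its replicas was resolved at iteration $\ell-1$ (along its edge to that slot); at iteration $0$ no user is detected. Let $p_\ell$ (resp. $q_\ell$) be the limit, as $N_s\to\infty$ and $\mathbb E[K_a]=\pi K\to\infty$ with $\mathbb E[K_a]/N_s\to \mathsf G>0$ (in particular, with this ratio constant), of the probability that a uniformly random edge of the random frame is, at iteration $\ell$, connected to a slot not yet resolved (resp. to a user not yet detected). Then these limits exist for every $\ell\ge 0$, and for every $\ell\ge1$ $$p_\ell=1-e^{-\mathsf G\bar d(1-\gamma+\gamma q_\ell)}\sum_{t=1}^{T}(1-P_{\mathrm E|t})\frac{(\mathsf G\bar d\,q_\ell)^{t-1}}{(t-1)!}=:f_s(q_\ell),$$ $$q_\ell=\frac1{\bar d}\sum_d\Lambda_d\,d\,p_{\ell-1}^{d-1}=\frac{\Lambda'(p_{\ell-1})}{\bar d}=:f_b(p_{\ell-1}),$$ with starting point $$p_0=1-e^{-\mathsf G\bar d}\sum_{t=1}^{T}(1-P_{\mathrm E|t})\frac{(\mathsf G\bar d)^{t-1}}{(t-1)!}.$$ Moreover $f_s(0)=P_{\mathrm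 E|1}$ when $\gamma=1$, and for general $\gamma\in[0,1]$ $$f_s(0)=P_{\mathrm E|1}+(1-P_{\mathrm E|1})\bigl(1-e^{-\mathsf G\bar d(1-\gamma)}\bigr),$$ i.e. $f_s(0)$ rises by $(1-P_{\mathrm E|1})(1-e^{-\mathsf G\bar d(1-\gamma)})$ compared with $\gamma=1$. -/

import Mathlib

open MeasureTheory Filter Topology
open scoped unitInterval NNReal ENNReal

noncomputable section

namespace IRSA

/-! ### Random frame

A frame with `N` slots and a population of `K` users is described by the sets `A u` of slots in
which user `u` transmits a replica (`A u = ∅` for idle users). Edges of the bipartite graph are the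
pairs `(u, s)` with `s ∈ A u`. -/

/-- Uniform choice of `d` distinct slots out of `N`. (If `d > N` no such choice exists and the empty
set is returned; this is irrelevant as soon as `N` is at least the maximum repetition degree.) -/
def slotChoice (N d : ℕ) : PMF (Finset (Fin N)) :=
  if h : (Finset.powersetCard d (Finset.univ : Finset (Fin N))).Nonempty then
    PMF.uniformOfFinset _ h
  else PMF.pure ∅

/-- The activity of a user: `true` with probability `π`, `false` with probability `1 - π`. -/
def activity (π : ℝ≥0) (hπ : π ≤ 1) : PMF Bool :=
  PMF.ofFintype (fun b => cond b (π : ℝ≥0∞) ((1 - π : ℝ≥0) : ℝ≥0∞)) (by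
    rw [Fintype.sum_bool]
    simp only [cond_true, cond_false]
    rw [← ENNReal.coe_add, add_tsub_cancel_of_le hπ, ENNReal.coe_one])

/-- Behaviour of one user: active with probability `π`; if active, it samples a degree `D` from `Λ`
and then `D` distinct slots uniformly at random; if idle, it uses no slot. -/
def userLaw (π : ℝ≥0) (hπ : π ≤ 1) (Λ : PMF ℕ) (N : ℕ) : PMF (Finset (Fin N)) :=
  (activity π hπ).bind fun active =>
    if active then Λ.bind fun d => slotChoice N d else PMF.pure ∅

/-- Law of a frame: users behave independently; independently of them, each slot `s` carries its own
independent uniform variable `U s ∈ [0,1]`, the randomness (noise and imperfect cancellation) that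
decides on the success of the slot decoder in that slot. -/
def frameLaw (π : ℝ≥0) (hπ : π ≤ 1) (Λ : PMF ℕ) (K N : ℕ) :
    Measure ((Fin K → Finset (Fin N)) × (Fin N → I)) :=
  (Measure.pi fun _ : Fin K => (userLaw π hπ Λ N).toMeasure).prod
    (Measure.pi fun _ : Fin N => (volume : Measure I))

/-! ### Slot decoder with imperfect interference cancellation -/

/-- The slot decoder on a slot with `h` colliding packets, `h - t` of which have been cancelled:
it fails if `t > T`, and for `1 ≤ t ≤ T` it succeeds with probability `(1 - P_{E|t}) γ ^ (h - t)`. -/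
def SlotDecoded (T : ℕ) (PE : ℕ → ℝ) (γ : ℝ) (h t : ℕ) (x : I) : Prop :=
  t ≤ T ∧ (x : ℝ) < (1 - PE t) * γ ^ (h - t)

/-! ### Successive interference cancellation as message passing on the graph -/

section SIC

variable {K N : ℕ}

open Classical in
/-- The users transmitting in slot `s`. -/
def slotUsers (A : Fin K → Finset (Fin N)) (s : Fin N) : Finset (Fin K) :=
  Finset.univ.filter fun u => s ∈ A u

open Classical in
/-- Slot-node processing on the edge `(u, s)`, given which edges `m` carry a packet not yet detected
elsewhere: the replica of `u` remains in the slot together with those of the undetected other users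
of the slot, the replicas of the other users being cancelled. The outgoing message says that the slot
is *not* resolved. -/
def slotStep (T : ℕ) (PE : ℕ → ℝ) (γ : ℝ) (A : Fin K → Finset (Fin N)) (U : Fin N → I)
    (m : Fin K → Fin N → Prop) (u : Fin K) (s : Fin N) : Prop :=
  ¬ SlotDecoded T PE γ (slotUsers A s).card
      (1 + (((slotUsers A s).erase u).filter fun v => m v s).card) (U s)

/-- User-node processing on the edge `(u, s)`: the user is *not* detected iff none of the other slots
holding its replicas is resolved. -/
def userStep (A : Fin K → Finset (Fin N)) (m : Fin K → Fin N → Prop) (u : Fin K) (s : Fin N) :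
    Prop :=
  ∀ s' ∈ A u, s' ≠ s → m u s'

/-- `userUnknown … ℓ u s`: at iteration `ℓ` the user node `u` is not yet detected, as seen along the
edge `(u, s)`. At iteration `0` no user has been detected. -/
def userUnknown (T : ℕ) (PE : ℕ → ℝ) (γ : ℝ) (A : Fin K → Finset (Fin N)) (U : Fin N → I) :
    ℕ → Fin K → Fin N → Prop
  | 0 => fun _ _ => True
  | ℓ + 1 => userStep A (slotStep T PE γ A U (userUnknown T PE γ A U ℓ))

/-- `slotUnknown … ℓ u s`: at iteration `ℓ` the slot node `s` is not resolved, as seen along the edge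
`(u, s)`. -/
def slotUnknown (T : ℕ) (PE : ℕ → ℝ) (γ : ℝ) (A : Fin K → Finset (Fin N)) (U : Fin N → I)
    (ℓ : ℕ) : Fin K → Fin N → Prop :=
  slotStep T PE γ A U (userUnknown T PE γ A U ℓ)

/-- The edges of the graph. -/
def edges (A : Fin K → Finset (Fin N)) : Finset ((_ : Fin K) × Fin N) :=
  Finset.univ.sigma A

open Classical in
/-- Probability that an edge of the frame drawn uniformly at random satisfies `m`
(`0` for a frame without edges). -/
def edgeFraction (A : Fin K → Finset (Fin N)) (m : Fin K → Fin N → Prop) : ℝ :=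
  (((edges A).filter fun e => m e.1 e.2).card : ℝ) / ((edges A).card : ℝ)

end SIC

/-- Probability, over the frame and a uniformly random edge of it, that at iteration `ℓ` the edge is
connected to a slot node not yet resolved. -/
def slotUnknownProb (T : ℕ) (PE : ℕ → ℝ) (γ : ℝ) (π : ℝ≥0) (hπ : π ≤ 1) (Λ : PMF ℕ)
    (K N ℓ : ℕ) : ℝ :=
  ∫ ω, edgeFraction ω.1 (slotUnknown T PE γ ω.1 ω.2 ℓ) ∂(frameLaw π hπ Λ K N)

/-- Probability, over the frame and a uniformly random edge of it, that at iteration `ℓ` the edge is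
connected to a user node not yet detected. -/
def userUnknownProb (T : ℕ) (PE : ℕ → ℝ) (γ : ℝ) (π : ℝ≥0) (hπ : π ≤ 1) (Λ : PMF ℕ)
    (K N ℓ : ℕ) : ℝ :=
  ∫ ω, edgeFraction ω.1 (userUnknown T PE γ ω.1 ω.2 ℓ) ∂(frameLaw π hπ Λ K N)

/-! ### Density evolution functions -/

/-- The generating function `Λ(x) = ∑_d Λ_d x^d`. -/
def pgf (Λ : PMF ℕ) (dmax : ℕ) (x : ℝ) : ℝ :=
  ∑ d ∈ Finset.Icc 1 dmax, (Λ d).toReal * x ^ d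

/-- The average repetition degree `d̄ = ∑_d d Λ_d`. -/
def meanDegree (Λ : PMF ℕ) (dmax : ℕ) : ℝ :=
  ∑ d ∈ Finset.Icc 1 dmax, (d : ℝ) * (Λ d).toReal

/-- The slot-node function `f_s`, with `a = G d̄`. -/
def slotNodeFun (T : ℕ) (PE : ℕ → ℝ) (γ a q : ℝ) : ℝ :=
  1 - Real.exp (-(a * (1 - γ + γ * q))) *
    ∑ t ∈ Finset.Icc 1 T, (1 - PE t) * ((a * q) ^ (t - 1) / ((t - 1).factorial : ℝ))

/-- The user-node function `f_b`. -/
def userNodeFun (Λ : PMF ℕ) (dmax : ℕ) (p : ℝ) : ℝ :=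
  (1 / meanDegree Λ dmax) * ∑ d ∈ Finset.Icc 1 dmax, (Λ d).toReal * d * p ^ (d - 1)

end IRSA

end

namespace IRSA

noncomputable section

/-! ### Indicators of propositions -/

/-! The theorem is density evolution: the frame looks locally like a tree, and on a tree the
messages arriving at a node come from disjoint branches. If each slot is unresolved with limiting
probability `p`, a user of degree `d` is undetected along an edge with probability `p ^ (d - 1)`;
weighting degrees by edges gives `f_b`. In a slot, the numbers of undetected and of cancelled other
users are asymptotically independent Poisson variables. Each cancelled user contributes a factor
`γ`, which turns its share of the Poisson law into an exponential and gives `f_s`.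

The work lies in making "disjoint branches are independent" precise in a finite frame, where
exploring a slot uses up users and conditions the others. Message passing is replaced by the cavity
messages `cav`, in which every explored user is deleted; the two agree unless the surroundings of
the edge contain a short cycle (`slotMsg_iff_cav`), and such edges are rare by a union bound
(`exists_pr_hasCycle_le`, `exists_sum_pr_edgeCyclic_le`). After the exploration of a slot `s`, the
remaining users are again independent, conditioned to avoid `s` (`pexp_live_explore`). The states
met on the way are therefore the laws `live m L S`, with user set `L` and slot set `S`.

The statement that survives induction is `MomentsConverge`: joint moments of cavity messages over a
fixed number of slots, at two consecutive levels, converge to products, uniformly over states with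
boundedly many users and slots removed. Exploring one slot of the higher level replaces it by
further slots of the lower level, up to errors from cycles, from crowded slots and from the lower
moments (`abs_cavMoment_insert_sub_le`). The probability that this slot is decoded is an explicit
binomial sum (`pexp_decodeProb`), whose Poisson limit is `Ensemble.step`.

Finally, the total number of edges concentrates around its mean, so the edge fraction follows from
the expected number of marked edges of one user (`tendsto_expect_edgeFraction`). The uniform
variables enter only through finitely many decoder outcomes, so every expectation is a finite sum
(`integral_frameLaw`). -/

open Classical in
/-- The real-valued indicator of a proposition. -/
def ind (P : Prop) : ℝ := if P then 1 else 0

lemma ind_true {P : Prop} (h : P) : ind P = 1 := if_pos h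

lemma ind_false {P : Prop} (h : ¬ P) : ind P = 0 := if_neg h

lemma ind_nonneg (P : Prop) : 0 ≤ ind P := by
  unfold ind; split_ifs <;> norm_num

lemma ind_le_one (P : Prop) : ind P ≤ 1 := by
  unfold ind; split_ifs <;> norm_num

lemma ind_mono {P Q : Prop} (h : P → Q) : ind P ≤ ind Q := by
  by_cases hP : P
  · rw [ind_true hP, ind_true (h hP)]
  · rw [ind_false hP]; exact ind_nonneg _

lemma ind_congr {P Q : Prop} (h : P ↔ Q) : ind P = ind Q := by rw [propext h]

lemma ind_and (P Q : Prop) : ind (P ∧ Q) = ind P * ind Q := by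
  by_cases hP : P <;> by_cases hQ : Q <;> simp [ind, hP, hQ]

lemma ind_not (P : Prop) : ind (¬ P) = 1 - ind P := by
  by_cases hP : P <;> simp [ind, hP]

lemma ind_or_le (P Q : Prop) : ind (P ∨ Q) ≤ ind P + ind Q := by
  by_cases hP : P <;> by_cases hQ : Q <;> simp [ind, hP, hQ]

lemma ind_exists_le {α : Type*} [Fintype α] (P : α → Prop) :
    ind (∃ a, P a) ≤ ∑ a, ind (P a) := by
  by_cases h : ∃ a, P a
  · obtain ⟨a, ha⟩ := h
    calc ind (∃ a, P a) ≤ 1 := ind_le_one _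
      _ = ind (P a) := (ind_true ha).symm
      _ ≤ _ := Finset.single_le_sum (fun i _ => ind_nonneg (P i)) (Finset.mem_univ a)
  · rw [ind_false h]
    exact Finset.sum_nonneg fun i _ => ind_nonneg _

lemma ind_forall_mem {α : Type*} (s : Finset α) (P : α → Prop) :
    ind (∀ a ∈ s, P a) = ∏ a ∈ s, ind (P a) := by
  by_cases h : ∀ a ∈ s, P a
  · rw [ind_true h, Finset.prod_eq_one fun a ha => ind_true (h a ha)]
  · rw [ind_false h]
    push Not at h
    obtain ⟨a, ha, hP⟩ := h
    exact (Finset.prod_eq_zero ha (ind_false hP)).symm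

lemma prod_ind_nonneg {α : Type*} (s : Finset α) (P : α → Prop) :
    0 ≤ ∏ a ∈ s, ind (P a) := Finset.prod_nonneg fun _ _ => ind_nonneg _

lemma prod_ind_le_one {α : Type*} (s : Finset α) (P : α → Prop) :
    ∏ a ∈ s, ind (P a) ≤ 1 :=
  Finset.prod_le_one (fun _ _ => ind_nonneg _) fun _ _ => ind_le_one _

/-! ### Expectations under finite product laws -/

/-- A family of probability weights. -/
structure IsLaw {ι Ω : Type*} [Fintype Ω] (μ : ι → Ω → ℝ) : Prop where
  nonneg : ∀ v a, 0 ≤ μ v a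
  sum_one : ∀ v, ∑ a, μ v a = 1

/-- Expectation under the product of the weights `μ v`. -/
def pexp {ι Ω : Type*} [Fintype ι] [DecidableEq ι] [Fintype Ω] (μ : ι → Ω → ℝ)
    (F : (ι → Ω) → ℝ) : ℝ :=
  ∑ A : ι → Ω, (∏ v, μ v (A v)) * F A

lemma IsLaw.prod_nonneg {ι Ω : Type*} [Fintype ι] [Fintype Ω] {μ : ι → Ω → ℝ} (h : IsLaw μ)
    (A : ι → Ω) : 0 ≤ ∏ v, μ v (A v) :=
  Finset.prod_nonneg fun v _ => h.nonneg v _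

section pexp

variable {ι Ω Ω' : Type*} [Fintype ι] [DecidableEq ι] [Fintype Ω] [Fintype Ω']
  {μ : ι → Ω → ℝ}

lemma pexp_add (μ : ι → Ω → ℝ) (F G : (ι → Ω) → ℝ) :
    pexp μ (fun A => F A + G A) = pexp μ F + pexp μ G := by
  simp only [pexp, mul_add, Finset.sum_add_distrib]

lemma pexp_sub (μ : ι → Ω → ℝ) (F G : (ι → Ω) → ℝ) :
    pexp μ (fun A => F A - G A) = pexp μ F - pexp μ G := by
  simp only [pexp, mul_sub, Finset.sum_sub_distrib]

lemma pexp_const_mul (μ : ι → Ω → ℝ) (c : ℝ) (F : (ι → Ω) → ℝ) :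
    pexp μ (fun A => c * F A) = c * pexp μ F := by
  simp only [pexp, Finset.mul_sum]
  exact Finset.sum_congr rfl fun A _ => by ring

lemma pexp_mul_const (μ : ι → Ω → ℝ) (c : ℝ) (F : (ι → Ω) → ℝ) :
    pexp μ (fun A => F A * c) = pexp μ F * c := by
  simp only [pexp, Finset.sum_mul, mul_assoc]

lemma pexp_sum {α : Type*} (μ : ι → Ω → ℝ) (s : Finset α) (F : α → (ι → Ω) → ℝ) :
    pexp μ (fun A => ∑ i ∈ s, F i A) = ∑ i ∈ s, pexp μ (F i) := by
  simp only [pexp, Finset.mul_sum]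
  exact Finset.sum_comm

lemma pexp_prod (μ : ι → Ω → ℝ) (f : ι → Ω → ℝ) :
    pexp μ (fun A => ∏ v, f v (A v)) = ∏ v, ∑ a, μ v a * f v a := by
  rw [Finset.prod_univ_sum, Fintype.piFinset_univ]
  simp only [pexp, Finset.prod_mul_distrib]

lemma IsLaw.pexp_one (h : IsLaw μ) : pexp μ (fun _ => 1) = 1 := by
  have := pexp_prod μ (fun _ _ => 1)
  simpa [h.sum_one] using this

lemma IsLaw.pexp_const (h : IsLaw μ) (c : ℝ) : pexp μ (fun _ => c) = c := by
  have := pexp_const_mul μ c (fun _ => 1)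
  simpa [h.pexp_one] using this

lemma IsLaw.pexp_mono (h : IsLaw μ) {F G : (ι → Ω) → ℝ} (hFG : ∀ A, F A ≤ G A) :
    pexp μ F ≤ pexp μ G :=
  Finset.sum_le_sum fun A _ => mul_le_mul_of_nonneg_left (hFG A) (h.prod_nonneg A)

lemma IsLaw.pexp_le_const (h : IsLaw μ) {F : (ι → Ω) → ℝ} {c : ℝ} (hF : ∀ A, F A ≤ c) :
    pexp μ F ≤ c := (h.pexp_mono hF).trans_eq (h.pexp_const c)

lemma IsLaw.pexp_nonneg (h : IsLaw μ) {F : (ι → Ω) → ℝ} (hF : ∀ A, 0 ≤ F A) :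
    0 ≤ pexp μ F := (h.pexp_const 0).symm.trans_le (h.pexp_mono hF)

lemma IsLaw.abs_pexp_le (h : IsLaw μ) (F : (ι → Ω) → ℝ) :
    |pexp μ F| ≤ pexp μ (fun A => |F A|) := by
  refine (Finset.abs_sum_le_sum_abs _ _).trans (Finset.sum_le_sum fun A _ => ?_)
  rw [abs_mul, abs_of_nonneg (h.prod_nonneg A)]

/-- Functions that agree wherever the weights do not vanish have the same expectation. -/
lemma pexp_congr {F G : (ι → Ω) → ℝ} (hFG : ∀ A, (∀ v, μ v (A v) ≠ 0) → F A = G A) :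
    pexp μ F = pexp μ G := by
  refine Finset.sum_congr rfl fun A _ => ?_
  by_cases hA : ∀ v, μ v (A v) ≠ 0
  · rw [hFG A hA]
  · push Not at hA
    obtain ⟨v, hv⟩ := hA
    rw [Finset.prod_eq_zero (Finset.mem_univ v) hv, zero_mul, zero_mul]

lemma IsLaw.pexp_mono_support (h : IsLaw μ) {F G : (ι → Ω) → ℝ}
    (hFG : ∀ A, (∀ v, μ v (A v) ≠ 0) → F A ≤ G A) : pexp μ F ≤ pexp μ G := by
  refine Finset.sum_le_sum fun A _ => ?_
  by_cases hA : ∀ v, μ v (A v) ≠ 0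
  · exact mul_le_mul_of_nonneg_left (hFG A hA) (h.prod_nonneg A)
  · push Not at hA
    obtain ⟨v, hv⟩ := hA
    rw [Finset.prod_eq_zero (Finset.mem_univ v) hv, zero_mul, zero_mul]

/-- The expectation of a function of one coordinate. -/
lemma IsLaw.pexp_coord (h : IsLaw μ) (w : ι) (f : Ω → ℝ) :
    pexp μ (fun A => f (A w)) = ∑ a, μ w a * f a := by
  have := pexp_prod μ (fun v a => if v = w then f a else 1)
  simp only [Finset.prod_ite_eq', Finset.mem_univ, if_true] at this
  rw [this, Finset.prod_eq_single w]
  · simp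
  · intro v _ hv; simp [hv, h.sum_one]
  · simp

/-- Change of variables, coordinate by coordinate. -/
lemma pexp_comp (μ : ι → Ω → ℝ) (g : ι → Ω → Ω') (F : (ι → Ω') → ℝ) :
    pexp μ (fun A => F fun v => g v (A v)) =
      pexp (fun v b => ∑ a, μ v a * ind (g v a = b)) F := by
  have key : ∀ A : ι → Ω, (∏ v, μ v (A v)) * F (fun v => g v (A v)) =
      ∑ B : ι → Ω', (∏ v, μ v (A v) * ind (g v (A v) = B v)) * F B := by
    intro A
    rw [Finset.sum_eq_single (fun v => g v (A v))]
    · congr 1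
      exact Finset.prod_congr rfl fun v _ => by rw [ind_true rfl, mul_one]
    · intro B _ hB
      obtain ⟨v, hv⟩ := Function.ne_iff.mp hB
      rw [Finset.prod_eq_zero (Finset.mem_univ v), zero_mul]
      rw [ind_false (Ne.symm hv), mul_zero]
    · simp
  simp only [pexp, key]
  rw [Finset.sum_comm]
  refine Finset.sum_congr rfl fun B _ => ?_
  rw [← Finset.sum_mul, Finset.prod_univ_sum, Fintype.piFinset_univ]

/-- Two independent families form one family of independent pairs, so resampling becomes a
coordinatewise change of variables. -/
lemma pexp_pexp (μ : ι → Ω → ℝ) (μ' : ι → Ω' → ℝ) (F : (ι → Ω) → (ι → Ω') → ℝ) :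
    pexp μ (fun A => pexp μ' fun A' => F A A') =
      pexp (fun v (x : Ω × Ω') => μ v x.1 * μ' v x.2)
        (fun B => F (fun v => (B v).1) (fun v => (B v).2)) := by
  simp only [pexp]
  rw [← (Equiv.arrowProdEquivProdArrow ι (fun _ => Ω) (fun _ => Ω')).symm.sum_comp,
    Fintype.sum_prod_type]
  refine Finset.sum_congr rfl fun A _ => ?_
  rw [Finset.mul_sum]
  refine Finset.sum_congr rfl fun A' _ => ?_
  simp only [Equiv.arrowProdEquivProdArrow, Equiv.coe_fn_symm_mk, Finset.prod_mul_distrib]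
  ring

/-- Mixing two independent samples coordinate by coordinate. -/
lemma pexp_resample (μ μ' κ : ι → Ω → ℝ) (g : ι → Ω → Ω → Ω)
    (hκ : ∀ v b, ∑ a, ∑ a', μ v a * μ' v a' * ind (g v a a' = b) = κ v b)
    (F : (ι → Ω) → ℝ) :
    pexp μ (fun A => pexp μ' fun A' => F fun v => g v (A v) (A' v)) = pexp κ F := by
  rw [pexp_pexp, pexp_comp (fun v (x : Ω × Ω) => μ v x.1 * μ' v x.2)
    (fun v x => g v x.1 x.2) F]
  congr 1
  ext v b
  rw [← hκ, Fintype.sum_prod_type]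

/-- Independence of one coordinate from a function of the others. -/
lemma IsLaw.pexp_indep (h : IsLaw μ) (w : ι) (f : Ω → ℝ) (F : (ι → Ω) → ℝ)
    (hF : ∀ A a, F (Function.update A w a) = F A) :
    pexp μ (fun A => f (A w) * F A) = (∑ a, μ w a * f a) * pexp μ F := by
  -- Replacing coordinate `w` by an independent copy preserves the law, and afterwards `f` and `F`
  -- depend on different samples.
  have hr := pexp_resample μ μ μ (fun v a a' => if v = w then a' else a) (by
    intro v b
    by_cases hv : v = w
    · simp only [hv, if_true]
      simp only [mul_assoc, ← Finset.mul_sum]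
      rw [← Finset.sum_mul, h.sum_one, one_mul, Finset.sum_eq_single b]
      · rw [ind_true rfl, mul_one]
      · intro a _ hab; rw [ind_false hab, mul_zero]
      · simp
    · simp only [hv, if_false]
      rw [Finset.sum_eq_single b]
      · simp only [ind_true, mul_one, ← Finset.mul_sum, h.sum_one]
      · intro a _ hab; simp [ind_false hab]
      · simp) (fun A => f (A w) * F A)
  rw [← hr]
  have : ∀ A A' : ι → Ω, F (fun v => if v = w then A' v else A v) = F A := by
    intro A A'
    rw [← hF A (A' w)]
    congr 1
    ext v
    by_cases hv : v = w
    · subst hv; simp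
    · simp [hv]
  simp only [if_true, this]
  rw [← h.pexp_coord w f]
  simp_rw [pexp_mul_const, pexp_const_mul]

/-- Independent centred summands: the second moment of the sum is the sum of second moments. -/
lemma IsLaw.pexp_sum_sq_le (h : IsLaw μ) (f : Ω → ℝ) (m B : ℝ)
    (hm : ∀ v, ∑ a, μ v a * f a = m) (hB : ∀ v a, μ v a ≠ 0 → (f a - m) ^ 2 ≤ B) :
    pexp μ (fun A => (∑ v, f (A v) - Fintype.card ι * m) ^ 2) ≤ Fintype.card ι * B := by
  have hc : ∀ v, ∑ a, μ v a * (f a - m) = 0 := by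
    intro v
    simp only [mul_sub, Finset.sum_sub_distrib, hm, ← Finset.sum_mul, h.sum_one, one_mul, sub_self]
  have hsq : ∀ A : ι → Ω, (∑ v, f (A v) - Fintype.card ι * m) ^ 2 =
      ∑ v, ∑ w, (f (A v) - m) * (f (A w) - m) := by
    intro A
    rw [← Finset.sum_mul_sum, Finset.sum_sub_distrib, Finset.sum_const, Finset.card_univ,
      nsmul_eq_mul, sq]
  simp_rw [hsq, pexp_sum]
  have hv : ∀ v, ∑ w, pexp μ (fun A => (f (A v) - m) * (f (A w) - m)) ≤ B := by
    intro v
    rw [Finset.sum_eq_single v]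
    · calc _ ≤ pexp μ (fun _ => B) := h.pexp_mono_support fun A hA => by
            rw [← sq]; exact hB v _ (hA v)
        _ = B := h.pexp_const B
    · intro w _ hw
      rw [h.pexp_indep v (fun a => f a - m) (fun A => f (A w) - m), hc, zero_mul]
      intro A a
      simp [hw]
    · simp
  calc _ ≤ ∑ _v : ι, B := Finset.sum_le_sum fun v _ => hv v
    _ = _ := by rw [Finset.sum_const, Finset.card_univ, nsmul_eq_mul]

/-- Jensen's inequality for the square. -/
lemma IsLaw.sq_pexp_abs_le (h : IsLaw μ) (F : (ι → Ω) → ℝ) :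
    (pexp μ fun A => |F A|) ^ 2 ≤ pexp μ fun A => F A ^ 2 := by
  set m := pexp μ fun A => |F A| with hm
  -- The integrand is `(|F A| - m) ^ 2` expanded.
  have : 0 ≤ pexp μ fun A => (F A ^ 2 - 2 * m * |F A|) + m ^ 2 :=
    h.pexp_nonneg fun A => by nlinarith [sq_nonneg (|F A| - m), sq_abs (F A)]
  rw [pexp_add, pexp_sub, pexp_const_mul, h.pexp_const, ← hm] at this
  nlinarith

end pexp

section Graph

variable {K N : ℕ}

/-! ### Deleting users, connections and short cycles -/

/-- The frame obtained by emptying the choices of the users in `V`. -/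
def del (A : Fin K → Finset (Fin N)) (V : Finset (Fin K)) : Fin K → Finset (Fin N) :=
  fun v => if v ∈ V then ∅ else A v

lemma mem_slotUsers {A : Fin K → Finset (Fin N)} {s : Fin N} {v : Fin K} :
    v ∈ slotUsers A s ↔ s ∈ A v := by
  simp [slotUsers]

lemma mem_del {A : Fin K → Finset (Fin N)} {V : Finset (Fin K)} {v : Fin K} {s : Fin N} :
    s ∈ del A V v ↔ v ∉ V ∧ s ∈ A v := by
  by_cases h : v ∈ V <;> simp [del, h]

lemma del_apply_of_notMem {A : Fin K → Finset (Fin N)} {V : Finset (Fin K)} {v : Fin K}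
    (h : v ∉ V) : del A V v = A v := by simp [del, h]

lemma del_del (A : Fin K → Finset (Fin N)) (V W : Finset (Fin K)) :
    del (del A V) W = del A (V ∪ W) := by
  ext v s
  simp only [mem_del, Finset.mem_union]
  tauto

lemma del_mono {A B : Fin K → Finset (Fin N)} (h : A ≤ B) (V : Finset (Fin K)) :
    del A V ≤ del B V := by
  intro v s hs
  rw [mem_del] at hs ⊢
  exact ⟨hs.1, h v hs.2⟩

lemma del_le_del (A : Fin K → Finset (Fin N)) {V W : Finset (Fin K)} (h : V ⊆ W) :
    del A W ≤ del A V := by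
  intro v s hs
  rw [mem_del] at hs ⊢
  exact ⟨fun hv => hs.1 (h hv), hs.2⟩

/-- The slots `x` and `y` are joined by a path with at most `j` users, each used once. -/
def Conn : ℕ → (Fin K → Finset (Fin N)) → Fin N → Fin N → Prop
  | 0, _, x, y => x = y
  | j + 1, A, x, y => x = y ∨ ∃ w, x ∈ A w ∧ ∃ z ∈ A w, z ≠ x ∧ Conn j (del A {w}) z y

lemma Conn.refl (j : ℕ) (A : Fin K → Finset (Fin N)) (x : Fin N) : Conn j A x x := by
  cases j <;> simp [Conn]

lemma Conn.mono {j : ℕ} : ∀ {A B : Fin K → Finset (Fin N)} {x y : Fin N}, A ≤ B →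
    Conn j A x y → Conn j B x y := by
  induction j with
  | zero => exact fun _ h => h
  | succ j ih =>
    rintro A B x y hAB (h | ⟨w, hx, z, hz, hzx, h⟩)
    · exact Or.inl h
    · exact Or.inr ⟨w, hAB w hx, z, hAB w hz, hzx, ih (del_mono hAB _) h⟩

/-- Explorations delete whole sets `V` of users at once, whereas a path deletes one user at a time;
deleting more only removes connections. -/
lemma Conn.step {j : ℕ} {A : Fin K → Finset (Fin N)} {V : Finset (Fin K)} {x y z : Fin N}
    {w : Fin K} (hw : w ∈ V) (hx : x ∈ A w) (hz : z ∈ A w) (hzx : z ≠ x)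
    (h : Conn j (del A V) z y) : Conn (j + 1) A x y :=
  Or.inr ⟨w, hx, z, hz, hzx,
    h.mono (del_le_del A (Finset.singleton_subset_iff.mpr hw))⟩

/-- The last user of a nontrivial path would have to use `y`. -/
lemma Conn.eq_of_isolated {j : ℕ} {A : Fin K → Finset (Fin N)} {x y : Fin N}
    (hy : ∀ v, y ∉ A v) (h : Conn j A x y) : x = y := by
  induction j generalizing A x with
  | zero => exact h
  | succ j ih =>
    rcases h with h | ⟨w, hx, z, hz, hzx, h⟩
    · exact h
    · have := ih (fun v hv => hy v (mem_del.mp hv).2) h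
      exact absurd (this ▸ hz) (hy w)

/-- The ball of radius `ℓ` around the slot `s` contains a cycle. -/
def HasCycle : ℕ → (Fin K → Finset (Fin N)) → Fin N → Prop
  | 0, _, _ => False
  | ℓ + 1, A, s => ∃ w, s ∈ A w ∧ ∃ y ∈ A w, y ≠ s ∧
      (HasCycle ℓ (del A {w}) y ∨
        (∃ y' ∈ A w, y' ≠ s ∧ y' ≠ y ∧ Conn ℓ (del A {w}) y y') ∨
        ∃ w', s ∈ del A {w} w' ∧ ∃ y' ∈ del A {w} w', y' ≠ s ∧
          Conn ℓ (del (del A {w}) {w'}) y y')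

lemma HasCycle.mono {ℓ : ℕ} : ∀ {A B : Fin K → Finset (Fin N)} {s : Fin N}, A ≤ B →
    HasCycle ℓ A s → HasCycle ℓ B s := by
  induction ℓ with
  | zero => exact fun _ h => h
  | succ ℓ ih =>
    rintro A B s hAB ⟨w, hs, y, hy, hys, h⟩
    have hd := del_mono hAB {w}
    refine ⟨w, hAB w hs, y, hAB w hy, hys, ?_⟩
    rcases h with h | ⟨y', hy', hys', hyy', h⟩ | ⟨w', hs', y', hy', hys', h⟩
    · exact Or.inl (ih hd h)
    · exact Or.inr (Or.inl ⟨y', hAB w hy', hys', hyy', h.mono hd⟩)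
    · exact Or.inr (Or.inr ⟨w', hd w' hs', y', hd w' hy', hys', h.mono (del_mono hd _)⟩)

/-! ### Message passing with an abstract slot decoder -/

/-- Slot-node processing with a general slot decoder. -/
def slotStepWith (dec : Fin N → ℕ → ℕ → Prop) (A : Fin K → Finset (Fin N))
    (m : Fin K → Fin N → Prop) (u : Fin K) (s : Fin N) : Prop :=
  open Classical in
  ¬ dec s (slotUsers A s).card (1 + (((slotUsers A s).erase u).filter fun v => m v s).card)

/-- The user-to-slot messages for a general slot decoder. -/
def userMsg (dec : Fin N → ℕ → ℕ → Prop) (A : Fin K → Finset (Fin N)) :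
    ℕ → Fin K → Fin N → Prop
  | 0 => fun _ _ => True
  | ℓ + 1 => userStep A (slotStepWith dec A (userMsg dec A ℓ))

/-- The slot-to-user messages for a general slot decoder. -/
def slotMsg (dec : Fin N → ℕ → ℕ → Prop) (A : Fin K → Finset (Fin N)) (ℓ : ℕ) :
    Fin K → Fin N → Prop :=
  slotStepWith dec A (userMsg dec A ℓ)

lemma userUnknown_eq_userMsg (T : ℕ) (PE : ℕ → ℝ) (γ : ℝ) (A : Fin K → Finset (Fin N))
    (U : Fin N → I) (ℓ : ℕ) :
    userUnknown T PE γ A U ℓ = userMsg (fun s h t => SlotDecoded T PE γ h t (U s)) A ℓ := by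
  induction ℓ with
  | zero => rfl
  | succ ℓ ih => simp only [userUnknown, userMsg, ih]; rfl

lemma slotUnknown_eq_slotMsg (T : ℕ) (PE : ℕ → ℝ) (γ : ℝ) (A : Fin K → Finset (Fin N))
    (U : Fin N → I) (ℓ : ℕ) :
    slotUnknown T PE γ A U ℓ = slotMsg (fun s h t => SlotDecoded T PE γ h t (U s)) A ℓ := by
  rw [slotUnknown, userUnknown_eq_userMsg]; rfl

/-- A slot has at most `K` users, so the decoder is never consulted at arguments beyond `K + 1`.
Hence a finite table of outcomes can replace the uniform variable of the slot. -/
lemma slotStepWith_congr {dec dec' : Fin N → ℕ → ℕ → Prop}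
    (h : ∀ s a b, a < K + 2 → b < K + 2 → (dec s a b ↔ dec' s a b))
    (A : Fin K → Finset (Fin N)) (m : Fin K → Fin N → Prop) :
    slotStepWith dec A m = slotStepWith dec' A m := by
  ext u s
  have hc : ∀ V : Finset (Fin K), V.card ≤ K := fun V => by
    simpa using Finset.card_le_univ V
  classical
  refine not_congr (h s _ _ ?_ ?_)
  · have := hc (slotUsers A s); omega
  · have := hc (((slotUsers A s).erase u).filter fun v => m v s)
    convert Nat.lt_of_le_of_lt (Nat.add_le_add_left this 1) (by omega : 1 + K < K + 2) using 3

lemma userMsg_congr {dec dec' : Fin N → ℕ → ℕ → Prop}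
    (h : ∀ s a b, a < K + 2 → b < K + 2 → (dec s a b ↔ dec' s a b))
    (A : Fin K → Finset (Fin N)) (ℓ : ℕ) : userMsg dec A ℓ = userMsg dec' A ℓ := by
  induction ℓ with
  | zero => rfl
  | succ ℓ ih => simp only [userMsg, ih, slotStepWith_congr h]

lemma slotMsg_congr {dec dec' : Fin N → ℕ → ℕ → Prop}
    (h : ∀ s a b, a < K + 2 → b < K + 2 → (dec s a b ↔ dec' s a b))
    (A : Fin K → Finset (Fin N)) (ℓ : ℕ) : slotMsg dec A ℓ = slotMsg dec' A ℓ := by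
  simp only [slotMsg, userMsg_congr h, slotStepWith_congr h]

/-! ### Cavity messages -/

lemma card_filter_congr_iff {α : Type*} {V : Finset α} {P Q : α → Prop} [DecidablePred P]
    [DecidablePred Q] (h : ∀ v ∈ V, (P v ↔ Q v)) : (V.filter P).card = (V.filter Q).card :=
  congrArg Finset.card (by
    ext v
    simp only [Finset.mem_filter]
    exact and_congr_right fun hv => h v hv)

open Classical in
/-- The message of the slot `s` towards an additional virtual user, computed by successively
deleting the explored users. -/
def cav (dec : Fin N → ℕ → ℕ → Prop) : ℕ → (Fin K → Finset (Fin N)) → Fin N → Prop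
  | 0, _, _ => True
  | ℓ + 1, A, s => ¬ dec s ((slotUsers A s).card + 1)
      (1 + ((slotUsers A s).filter fun v =>
        ∀ y ∈ A v, y ≠ s → cav dec ℓ (del A (slotUsers A s)) y).card)

/-- A cavity message only depends on the decoder in the slot itself and in occupied slots. -/
lemma cav_congr_dec {dec dec' : Fin N → ℕ → ℕ → Prop} {ℓ : ℕ} :
    ∀ {A : Fin K → Finset (Fin N)} {s : Fin N}, dec s = dec' s →
      (∀ v, ∀ x ∈ A v, dec x = dec' x) → (cav dec ℓ A s ↔ cav dec' ℓ A s) := by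
  induction ℓ with
  | zero => intros; exact Iff.rfl
  | succ ℓ ih =>
    intro A s hs hA
    have : ∀ v, (∀ y ∈ A v, y ≠ s → cav dec ℓ (del A (slotUsers A s)) y) ↔
        (∀ y ∈ A v, y ≠ s → cav dec' ℓ (del A (slotUsers A s)) y) := fun v =>
      forall₂_congr fun y hy => imp_congr_right fun _ =>
        ih (hA v y hy) fun v x hx => hA v x (mem_del.mp hx).2
    simp only [cav, hs]
    classical
    rw [card_filter_congr_iff fun v _ => this v]

/-- Deleting users that are not connected to the slot `t` does not change its cavity message. -/
lemma cav_del {dec : Fin N → ℕ → ℕ → Prop} {ℓ : ℕ} :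
    ∀ {A : Fin K → Finset (Fin N)} {V : Finset (Fin K)} {t : Fin N},
      (∀ v ∈ V, ∀ c ∈ A v, ¬ Conn ℓ (del A V) t c) →
      (cav dec ℓ A t ↔ cav dec ℓ (del A V) t) := by
  induction ℓ with
  | zero => intros; exact Iff.rfl
  | succ ℓ ih =>
    intro A V t hV
    have hU : slotUsers (del A V) t = slotUsers A t := by
      ext w
      rw [mem_slotUsers, mem_slotUsers, mem_del]
      refine ⟨fun h => h.2, fun h => ⟨fun hw => hV w hw t h (Conn.refl _ _ _), h⟩⟩
    have hnot : ∀ w ∈ slotUsers A t, w ∉ V := fun w hw hwV =>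
      hV w hwV t (mem_slotUsers.mp hw) (Conn.refl _ _ _)
    have key : ∀ w ∈ slotUsers A t,
        ((∀ y ∈ A w, y ≠ t → cav dec ℓ (del A (slotUsers A t)) y) ↔
        (∀ y ∈ del A V w, y ≠ t → cav dec ℓ (del (del A V) (slotUsers A t)) y)) := by
      intro w hw
      rw [del_apply_of_notMem (hnot w hw), del_del, Finset.union_comm, ← del_del]
      refine forall₂_congr fun y hy => imp_congr_right fun hyt => ih ?_
      intro v hv c hc hconn
      refine hV v hv c (mem_del.mp hc).2 ?_
      refine Conn.step (V := slotUsers A t) hw (mem_del.mpr ⟨hnot w hw, mem_slotUsers.mp hw⟩)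
        (mem_del.mpr ⟨hnot w hw, hy⟩) hyt ?_
      rwa [del_del, Finset.union_comm, ← del_del]
    classical
    rw [cav, cav, hU, card_filter_congr_iff key]

/-- In the absence of short cycles the messages of the decoder are cavity messages. -/
lemma slotMsg_iff_cav {dec : Fin N → ℕ → ℕ → Prop} {A : Fin K → Finset (Fin N)} {ℓ : ℕ} :
    ∀ {F : Finset (Fin K)} {u : Fin K} {s : Fin N}, u ∈ F → s ∈ A u →
      ¬ HasCycle ℓ (del A F) s →
      (∀ f ∈ F, ∀ z ∈ A f, (f, z) ≠ (u, s) → ¬ Conn ℓ (del A F) s z) →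
      (slotMsg dec A ℓ u s ↔ cav dec (ℓ + 1) (del A F) s) := by
  induction ℓ with
  | zero =>
    intro F u s hu hs _ hF
    have hU : slotUsers (del A F) s = (slotUsers A s).erase u := by
      ext w
      rw [Finset.mem_erase, mem_slotUsers, mem_slotUsers, mem_del]
      refine ⟨fun h => ⟨fun hw => h.1 (hw ▸ hu), h.2⟩, fun h => ⟨fun hw => ?_, h.2⟩⟩
      exact hF w hw s h.2 (by simp [h.1]) (Conn.refl _ _ _)
    classical
    rw [slotMsg, slotStepWith, cav, hU, Finset.card_erase_add_one (mem_slotUsers.mpr hs),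
      card_filter_congr_iff (V := (slotUsers A s).erase u) (P := fun v => userMsg dec A 0 v s)
        (Q := fun v => ∀ y ∈ del A F v, y ≠ s → cav dec 0
          (del (del A F) ((slotUsers A s).erase u)) y) fun v _ => by simp [userMsg, cav]]
  -- The set `F` has to be arbitrary: the cavity recursion deletes all users `V` of `s` together,
  -- and the next call concerns an edge of some `w ∈ V` with `F ∪ V` deleted.
  | succ ℓ ih =>
    intro F u s hu hs hcyc hF
    have hU : slotUsers (del A F) s = (slotUsers A s).erase u := by
      ext w
      rw [Finset.mem_erase, mem_slotUsers, mem_slotUsers, mem_del]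
      refine ⟨fun h => ⟨fun hw => h.1 (hw ▸ hu), h.2⟩, fun h => ⟨fun hw => ?_, h.2⟩⟩
      exact hF w hw s h.2 (by simp [h.1]) (Conn.refl _ _ _)
    set V := slotUsers (del A F) s with hV
    have hVF : ∀ w ∈ V, w ∉ F := fun w hw => (mem_del.mp (mem_slotUsers.mp hw)).1
    have hVs : ∀ w ∈ V, s ∈ A w := fun w hw => (mem_del.mp (mem_slotUsers.mp hw)).2
    have hmem : ∀ w ∈ V, ∀ {y}, y ∈ A w → y ∈ del A F w := fun w hw y hy =>
      mem_del.mpr ⟨hVF w hw, hy⟩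
    have hiso : ∀ v, s ∉ del (del A F) V v := fun v hv =>
      (mem_del.mp hv).1 (mem_slotUsers.mpr (mem_del.mp hv).2)
    have key : ∀ w ∈ V, (userMsg dec A (ℓ + 1) w s ↔
        ∀ y ∈ del A F w, y ≠ s → cav dec (ℓ + 1) (del (del A F) V) y) := by
      intro w hw
      rw [del_apply_of_notMem (hVF w hw), del_del]
      refine forall₂_congr fun y hy => imp_congr_right fun hys =>
        ih (Finset.mem_union_right _ hw) hy ?_ ?_
      -- A cycle further out is the first alternative of `HasCycle`.
      · intro h
        rw [← del_del] at h
        exact hcyc ⟨w, hmem w hw (hVs w hw), y, hmem w hw hy, hys, Or.inl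
          (h.mono (del_le_del _ (Finset.singleton_subset_iff.mpr hw)))⟩
      · intro f hf z hz hne hconn
        rw [← del_del] at hconn
        by_cases hzs : z = s
        · subst hzs
          exact hys (hconn.eq_of_isolated hiso)
        rcases Finset.mem_union.mp hf with hfF | hfV
        -- A connection from `y` to a slot of an earlier deleted user extends through `w` to a
        -- connection from `s`.
        · refine hF f hfF z hz (by simp [hzs]) ?_
          exact Conn.step hw (hmem w hw (hVs w hw)) (hmem w hw hy) hys hconn
        -- Here `y` is connected to a slot of another edge of a user of `s`. If that user is `w`,
        -- two slots of `w` close a cycle; otherwise the cycle passes through `s` by two distinct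
        -- users. These are the last two alternatives of `HasCycle`.
        · refine hcyc ⟨w, hmem w hw (hVs w hw), y, hmem w hw hy, hys, Or.inr ?_⟩
          by_cases hfw : f = w
          · subst hfw
            refine Or.inl ⟨z, hmem f hw hz, hzs, ?_, hconn.mono
              (del_le_del _ (Finset.singleton_subset_iff.mpr hw))⟩
            rintro rfl
            exact hne rfl
          · have hfd : ∀ {x}, x ∈ A f → x ∈ del (del A F) {w} f := fun hx =>
              mem_del.mpr ⟨by simpa using hfw, hmem f hfV hx⟩
            refine Or.inr ⟨f, hfd (hVs f hfV), z, hfd hz, hzs, hconn.mono ?_⟩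
            rw [del_del (del A F)]
            refine del_le_del _ ?_
            simp [Finset.insert_subset_iff, hw, hfV]
    classical
    rw [slotMsg, slotStepWith, ← hU, cav, ← Finset.card_erase_add_one (mem_slotUsers.mpr hs), ← hU,
      ← hV, card_filter_congr_iff key]

end Graph

/-! ### Sparse product laws and the rarity of short connections and cycles. -/

section Sparse

variable {K N : ℕ}

/-- The probability of an event under a finite product law. -/
def pr (μ : Fin K → Finset (Fin N) → ℝ) (P : (Fin K → Finset (Fin N)) → Prop) : ℝ :=
  pexp μ fun A => ind (P A)

/-- The law obtained by emptying the choices of the users in `V`. -/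
def delLaw (μ : Fin K → Finset (Fin N) → ℝ) (V : Finset (Fin K)) :
    Fin K → Finset (Fin N) → ℝ :=
  fun v => if v ∈ V then fun a => ind (a = ∅) else μ v

lemma sum_ind_eq_mul {Ω : Type*} [Fintype Ω] (b : Ω) (f : Ω → ℝ) :
    ∑ a, ind (a = b) * f a = f b := by
  rw [Finset.sum_eq_single b]
  · rw [ind_true rfl, one_mul]
  · intro a _ hab; rw [ind_false hab, zero_mul]
  · simp

lemma sum_mul_ind_eq {Ω : Type*} [Fintype Ω] (b : Ω) (f : Ω → ℝ) :
    ∑ a, f a * ind (a = b) = f b := by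
  simpa [mul_comm] using sum_ind_eq_mul b f

lemma pexp_del (μ : Fin K → Finset (Fin N) → ℝ) (hμ : IsLaw μ) (V : Finset (Fin K))
    (F : (Fin K → Finset (Fin N)) → ℝ) :
    pexp μ (fun A => F (del A V)) = pexp (delLaw μ V) F := by
  have := pexp_comp μ (fun v a => if v ∈ V then ∅ else a) F
  rw [show (fun A => F (del A V)) = fun A => F fun v => if v ∈ V then ∅ else A v from rfl, this]
  congr 1
  ext v b
  by_cases hv : v ∈ V
  · simp only [hv, if_true, delLaw, ← Finset.sum_mul, hμ.sum_one, one_mul]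
    exact ind_congr eq_comm
  · simp only [hv, if_false, delLaw, sum_mul_ind_eq]

lemma IsLaw.delLaw {μ : Fin K → Finset (Fin N) → ℝ} (hμ : IsLaw μ) (V : Finset (Fin K)) :
    IsLaw (delLaw μ V) where
  nonneg v a := by
    unfold IRSA.delLaw; split_ifs
    · exact ind_nonneg _
    · exact hμ.nonneg v a
  sum_one v := by
    unfold IRSA.delLaw; split_ifs
    · simpa using sum_ind_eq_mul (∅ : Finset (Fin N)) fun _ => 1
    · exact hμ.sum_one v

/-- Revealing the choice of one user. -/
lemma IsLaw.pexp_reveal {μ : Fin K → Finset (Fin N) → ℝ} (hμ : IsLaw μ) (w : Fin K)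
    (f : Finset (Fin N) → ℝ) (H : (Fin K → Finset (Fin N)) → ℝ) :
    pexp μ (fun A => f (A w) * H (del A {w})) =
      (∑ a, μ w a * f a) * pexp (IRSA.delLaw μ {w}) H := by
  rw [hμ.pexp_indep w f (fun A => H (del A {w})), pexp_del μ hμ]
  intro A a
  congr 1
  ext v : 1
  by_cases hv : v = w <;> simp [del, hv]

/-- Laws under which each user uses given slots with probability at most that of independent
choices with density `c / N`. -/
structure Sparse (c : ℝ) (μ : Fin K → Finset (Fin N) → ℝ) : Prop extends IsLaw μ where
  bound : ∀ v (X : Finset (Fin N)), X.card ≤ 3 → ∑ a, μ v a * ind (X ⊆ a) ≤ (c / N) ^ X.card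

variable {c κ : ℝ} {μ : Fin K → Finset (Fin N) → ℝ}

/-- Deleting users keeps the same constant `c`, so a path or cycle bound can be applied again after
each revealed user. -/
lemma Sparse.delLaw (hc : 0 ≤ c) (hμ : Sparse c μ) (V : Finset (Fin K)) :
    Sparse c (delLaw μ V) where
  toIsLaw := hμ.toIsLaw.delLaw V
  bound v X hX := by
    unfold IRSA.delLaw; split_ifs
    · rw [sum_ind_eq_mul]
      by_cases h : X = ∅
      · subst h; simp [ind]
      · rw [ind_false (by simpa using h)]; positivity
    · exact hμ.bound v X hX

lemma pr_mono (hμ : IsLaw μ) {P Q : (Fin K → Finset (Fin N)) → Prop} (h : ∀ A, P A → Q A) :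
    pr μ P ≤ pr μ Q := hμ.pexp_mono fun A => ind_mono (h A)

lemma pr_or_le (hμ : IsLaw μ) (P Q : (Fin K → Finset (Fin N)) → Prop) :
    pr μ (fun A => P A ∨ Q A) ≤ pr μ P + pr μ Q := by
  rw [pr, pr, pr, ← pexp_add]
  exact hμ.pexp_mono fun A => ind_or_le _ _

lemma pr_le_one (hμ : IsLaw μ) (P : (Fin K → Finset (Fin N)) → Prop) : pr μ P ≤ 1 :=
  hμ.pexp_le_const fun _ => ind_le_one _

lemma pr_nonneg (hμ : IsLaw μ) (P : (Fin K → Finset (Fin N)) → Prop) : 0 ≤ pr μ P :=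
  hμ.pexp_nonneg fun _ => ind_nonneg _

/-- The shape of the union bound over the next slot of a path: the trivial bound one at a single
exceptional slot and `C / N` at all others. -/
lemma sum_ind_add_const (y₀ : Fin N) (hN : 0 < N) (C : ℝ) :
    ∑ y : Fin N, (ind (y = y₀) + C / N) = 1 + C := by
  have hN' : (N : ℝ) ≠ 0 := by positivity
  rw [Finset.sum_add_distrib, Finset.sum_const, Finset.card_univ, Fintype.card_fin, nsmul_eq_mul]
  have := sum_ind_eq_mul y₀ fun _ => 1
  simp only [mul_one] at this
  rw [this]
  field_simp

/-- Union bound over the first user and the second slot of a path that starts in the slot `s`. -/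
lemma Sparse.pr_branch_le (hN : 0 < N) (hK : (K : ℝ) ≤ κ * N) {C : ℝ} (hC : 0 ≤ C)
    (hμ : Sparse c μ) (Q : (Fin K → Finset (Fin N)) → Fin N → Prop) (s y₀ : Fin N)
    (hQ : ∀ w, ∀ y, y ≠ y₀ → pr (IRSA.delLaw μ {w}) (fun A => Q A y) ≤ C / N) :
    pr μ (fun A => ∃ w, s ∈ A w ∧ ∃ y ∈ A w, y ≠ s ∧ Q (del A {w}) y) ≤
      κ * c ^ 2 * (1 + C) / N := by
  have hN' : (0 : ℝ) < N := by positivity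
  have hpt : ∀ A : Fin K → Finset (Fin N),
      ind (∃ w, s ∈ A w ∧ ∃ y ∈ A w, y ≠ s ∧ Q (del A {w}) y) ≤
        ∑ w, ∑ y, (ind (y ≠ s) * ind ({s, y} ⊆ A w)) * ind (Q (del A {w}) y) := by
    intro A
    refine (ind_exists_le _).trans (Finset.sum_le_sum fun w _ => ?_)
    refine (ind_mono (Q := ∃ y, (y ≠ s ∧ {s, y} ⊆ A w) ∧ Q (del A {w}) y) ?_).trans
      ((ind_exists_le _).trans (Finset.sum_le_sum fun y _ => ?_))
    · rintro ⟨hs, y, hy, hys, h⟩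
      exact ⟨y, ⟨hys, by simp [Finset.insert_subset_iff, hs, hy]⟩, h⟩
    · rw [ind_and, ind_and]
  refine (hμ.pexp_mono hpt).trans ?_
  simp_rw [pexp_sum]
  have hterm : ∀ w y, pexp μ (fun A => (ind (y ≠ s) * ind ({s, y} ⊆ A w)) *
      ind (Q (del A {w}) y)) ≤ (c / N) ^ 2 * (ind (y = y₀) + C / N) := by
    intro w y
    rw [hμ.pexp_reveal w (fun a => ind (y ≠ s) * ind ({s, y} ⊆ a)) (fun A => ind (Q A y))]
    have hlaw := hμ.toIsLaw.delLaw {w}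
    refine mul_le_mul ?_ ?_ (pr_nonneg hlaw fun A => Q A y) (by positivity)
    · by_cases hys : y = s
      · simp only [ind_false (not_not.mpr hys), zero_mul, mul_zero, Finset.sum_const_zero]
        positivity
      · simp only [ind_true hys, one_mul]
        have := hμ.bound w {s, y} (by rw [Finset.card_pair (Ne.symm hys)]; norm_num)
        rwa [Finset.card_pair (Ne.symm hys)] at this
    · by_cases hy : y = y₀
      · rw [ind_true hy]
        refine (pr_le_one hlaw fun A => Q A y).trans ?_
        have : 0 ≤ C / N := by positivity
        linarith
      · rw [ind_false hy, zero_add]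
        exact hQ w y hy
  calc _ ≤ ∑ w : Fin K, ∑ y : Fin N, (c / N) ^ 2 * (ind (y = y₀) + C / N) :=
        Finset.sum_le_sum fun w _ => Finset.sum_le_sum fun y _ => hterm w y
    _ = K * ((c / N) ^ 2 * (1 + C)) := by
        simp_rw [← Finset.mul_sum, sum_ind_add_const y₀ hN C]
        rw [Finset.sum_const, Finset.card_univ, Fintype.card_fin, nsmul_eq_mul]
        ring
    _ ≤ (κ * N) * ((c / N) ^ 2 * (1 + C)) := by gcongr
    _ = _ := by field_simp

/-- Two given slots are unlikely to be connected by a short path. -/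
lemma exists_pr_conn_le (hc : 0 ≤ c) (hκ : 0 ≤ κ) (j : ℕ) : ∃ C : ℝ, 0 ≤ C ∧
    ∀ (K N : ℕ) (μ : Fin K → Finset (Fin N) → ℝ), Sparse c μ → 0 < N → (K : ℝ) ≤ κ * N →
      ∀ x y, x ≠ y → pr μ (fun A => Conn j A x y) ≤ C / N := by
  induction j with
  | zero =>
    refine ⟨0, le_rfl, fun K N μ hμ hN hK x y hxy => ?_⟩
    rw [zero_div]
    exact hμ.pexp_le_const fun A => (ind_false hxy).le
  | succ j ih =>
    obtain ⟨C, hC, h⟩ := ih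
    refine ⟨κ * c ^ 2 * (1 + C), by positivity, fun K N μ hμ hN hK x y hxy => ?_⟩
    refine (pr_mono hμ.toIsLaw ?_).trans (hμ.pr_branch_le hN hK hC
      (fun A z => Conn j A z y) x y fun w z hz => h K N _ (hμ.delLaw hc {w}) hN hK z y hz)
    rintro A (h | h)
    · exact absurd h hxy
    · exact h

/-- Short cycles near a given slot are unlikely. -/
lemma exists_pr_hasCycle_le (hc : 0 ≤ c) (hκ : 0 ≤ κ) (ℓ : ℕ) : ∃ C : ℝ, 0 ≤ C ∧
    ∀ (K N : ℕ) (μ : Fin K → Finset (Fin N) → ℝ), Sparse c μ → 0 < N → (K : ℝ) ≤ κ * N →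
      ∀ s, pr μ (fun A => HasCycle ℓ A s) ≤ C / N := by
  induction ℓ with
  | zero =>
    refine ⟨0, le_rfl, fun K N μ hμ hN hK s => ?_⟩
    rw [zero_div]
    exact hμ.pexp_le_const fun A => (ind_false (by simp [HasCycle])).le
  | succ ℓ ih =>
    obtain ⟨D, hD, hcyc⟩ := ih
    obtain ⟨C, hC, hconn⟩ := exists_pr_conn_le hc hκ ℓ
    -- One summand for each alternative of `HasCycle`: a cycle further out, one user holding three
    -- slots, and two users meeting at `s`. The second is why `Sparse` controls sets of three slots;
    -- the third applies the branch bound twice.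
    refine ⟨κ * c ^ 2 * (1 + D) + κ * c ^ 3 * C + κ * c ^ 2 * (1 + κ * c ^ 2 * (1 + C)),
      by positivity, fun K N μ hμ hN hK s => ?_⟩
    have hN' : (0 : ℝ) < N := by positivity
    have h1 := hμ.pr_branch_le hN hK hD (fun A y => HasCycle ℓ A y) s s
      fun w y _ => hcyc K N _ (hμ.delLaw hc {w}) hN hK y
    have h3 := hμ.pr_branch_le hN hK (C := κ * c ^ 2 * (1 + C)) (by positivity)
      (fun A y => ∃ w', s ∈ A w' ∧ ∃ y' ∈ A w', y' ≠ s ∧ Conn ℓ (del A {w'}) y y') s s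
      fun w y _ => (hμ.delLaw hc {w}).pr_branch_le hN hK hC
        (fun A y' => Conn ℓ A y y') s y
        fun w' y' hy' => hconn K N _ ((hμ.delLaw hc {w}).delLaw hc {w'}) hN hK y y' hy'.symm
    have h2 : pr μ (fun A => ∃ w, ∃ y, ∃ y', (y ≠ s ∧ y' ≠ s ∧ y' ≠ y ∧ {s, y, y'} ⊆ A w) ∧
        Conn ℓ (del A {w}) y y') ≤ κ * c ^ 3 * C / N := by
      have hpt : ∀ A : Fin K → Finset (Fin N), ind (∃ w, ∃ y, ∃ y',
          (y ≠ s ∧ y' ≠ s ∧ y' ≠ y ∧ {s, y, y'} ⊆ A w) ∧ Conn ℓ (del A {w}) y y') ≤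
          ∑ w, ∑ y, ∑ y', ind (y ≠ s ∧ y' ≠ s ∧ y' ≠ y ∧ {s, y, y'} ⊆ A w) *
            ind (Conn ℓ (del A {w}) y y') := by
        intro A
        refine (ind_exists_le _).trans (Finset.sum_le_sum fun w _ => ?_)
        refine (ind_exists_le _).trans (Finset.sum_le_sum fun y _ => ?_)
        refine (ind_exists_le _).trans (Finset.sum_le_sum fun y' _ => ?_)
        rw [ind_and]
      refine (hμ.pexp_mono hpt).trans ?_
      simp_rw [pexp_sum]
      have hterm : ∀ w y y', pexp μ (fun A => ind (y ≠ s ∧ y' ≠ s ∧ y' ≠ y ∧ {s, y, y'} ⊆ A w) *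
          ind (Conn ℓ (del A {w}) y y')) ≤ (c / N) ^ 3 * (C / N) := by
        intro w y y'
        rw [hμ.pexp_reveal w (fun a => ind (y ≠ s ∧ y' ≠ s ∧ y' ≠ y ∧ {s, y, y'} ⊆ a))
          (fun A => ind (Conn ℓ A y y'))]
        by_cases hne : y ≠ s ∧ y' ≠ s ∧ y' ≠ y
        · have hcard : ({s, y, y'} : Finset (Fin N)).card = 3 := by
            rw [Finset.card_eq_three]
            exact ⟨s, y, y', hne.1.symm, hne.2.1.symm, hne.2.2.symm, rfl⟩
          refine mul_le_mul ?_ (hconn K N _ (hμ.delLaw hc {w}) hN hK y y' hne.2.2.symm)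
            (pr_nonneg (hμ.toIsLaw.delLaw {w}) fun A => Conn ℓ A y y') (by positivity)
          have := hμ.bound w {s, y, y'} hcard.le
          rw [hcard] at this
          refine le_trans (le_of_eq (Finset.sum_congr rfl fun a _ => ?_)) this
          rw [ind_congr (Q := {s, y, y'} ⊆ a) (by tauto)]
        · rw [Finset.sum_eq_zero, zero_mul]
          · positivity
          · intro a _
            rw [ind_false (by tauto), mul_zero]
      calc _ ≤ ∑ _w : Fin K, ∑ _y : Fin N, ∑ _y' : Fin N, (c / N) ^ 3 * (C / N) :=
            Finset.sum_le_sum fun w _ => Finset.sum_le_sum fun y _ =>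
              Finset.sum_le_sum fun y' _ => hterm w y y'
        _ = K * (N * (N * ((c / N) ^ 3 * (C / N)))) := by
            simp [Finset.sum_const, Finset.card_univ]
        _ ≤ (κ * N) * (N * (N * ((c / N) ^ 3 * (C / N)))) := by gcongr
        _ = _ := by field_simp
    calc pr μ (fun A => HasCycle (ℓ + 1) A s) ≤ pr μ (fun A =>
          ((∃ w, s ∈ A w ∧ ∃ y ∈ A w, y ≠ s ∧ HasCycle ℓ (del A {w}) y) ∨
          (∃ w, ∃ y, ∃ y', (y ≠ s ∧ y' ≠ s ∧ y' ≠ y ∧ {s, y, y'} ⊆ A w) ∧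
            Conn ℓ (del A {w}) y y')) ∨
          ∃ w, s ∈ A w ∧ ∃ y ∈ A w, y ≠ s ∧ ∃ w', s ∈ del A {w} w' ∧ ∃ y' ∈ del A {w} w', y' ≠ s ∧
            Conn ℓ (del (del A {w}) {w'}) y y') := by
          refine pr_mono hμ.toIsLaw ?_
          rintro A ⟨w, hs, y, hy, hys, h | ⟨y', hy', hys', hyy', h⟩ | h⟩
          · exact Or.inl (Or.inl ⟨w, hs, y, hy, hys, h⟩)
          · exact Or.inl (Or.inr ⟨w, y, y', ⟨hys, hys', hyy', by
              simp [Finset.insert_subset_iff, hs, hy, hy']⟩, h⟩)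
          · exact Or.inr ⟨w, hs, y, hy, hys, h⟩
      _ ≤ _ := (pr_or_le hμ.toIsLaw _ _).trans
          (add_le_add (pr_or_le hμ.toIsLaw _ _) le_rfl)
      _ ≤ _ := by
          rw [add_div, add_div]
          exact add_le_add (add_le_add h1 h2) h3

end Sparse

/-! ### Exploration states: conditioned user laws and the revealing of one slot. -/

section Live

variable {K N : ℕ} {m : Finset (Fin N) → ℝ}

/-- The probability that a user only uses slots in `S`. -/
def massIn (m : Finset (Fin N) → ℝ) (S : Finset (Fin N)) : ℝ := ∑ a, m a * ind (a ⊆ S)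

/-- The weights `m` conditioned on using only slots in `S`. -/
def condIn (m : Finset (Fin N) → ℝ) (S a : Finset (Fin N)) : ℝ := m a * ind (a ⊆ S) / massIn m S

/-- The users in `L` choose their slots with the weights `m` conditioned on using only slots in `S`;
the other users are idle. -/
def live (m : Finset (Fin N) → ℝ) (L : Finset (Fin K)) (S : Finset (Fin N)) :
    Fin K → Finset (Fin N) → ℝ :=
  fun v a => if v ∈ L then condIn m S a else ind (a = ∅)

lemma sum_condIn {S : Finset (Fin N)} (hS : massIn m S ≠ 0) : ∑ a, condIn m S a = 1 := by
  simp only [condIn, ← Finset.sum_div]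
  exact div_self hS

lemma condIn_nonneg (hm : ∀ a, 0 ≤ m a) (S a : Finset (Fin N)) : 0 ≤ condIn m S a :=
  div_nonneg (mul_nonneg (hm a) (ind_nonneg _))
    (Finset.sum_nonneg fun b _ => mul_nonneg (hm b) (ind_nonneg _))

lemma subset_of_condIn_ne_zero {S a : Finset (Fin N)} (h : condIn m S a ≠ 0) : a ⊆ S := by
  by_contra hS
  exact h (by rw [condIn, ind_false hS, mul_zero, zero_div])

lemma isLaw_live (hm : ∀ a, 0 ≤ m a) (L : Finset (Fin K)) {S : Finset (Fin N)}
    (hS : massIn m S ≠ 0) : IsLaw (live m L S) where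
  nonneg v a := by
    unfold live; split_ifs
    · exact condIn_nonneg hm S a
    · exact ind_nonneg _
  sum_one v := by
    unfold live; split_ifs
    · exact sum_condIn hS
    · simpa using sum_ind_eq_mul (∅ : Finset (Fin N)) fun _ => 1

lemma subset_of_live_ne_zero {L : Finset (Fin K)} {S a : Finset (Fin N)} {v : Fin K}
    (h : live m L S v a ≠ 0) : a ⊆ S := by
  unfold live at h; split_ifs at h
  · exact subset_of_condIn_ne_zero h
  · by_contra ha
    exact h (ind_false fun h' => ha (h' ▸ Finset.empty_subset S))

lemma weight_ne_zero_of_live_ne_zero {L : Finset (Fin K)} {S a : Finset (Fin N)} {v : Fin K}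
    (h : live m L S v a ≠ 0) : m a ≠ 0 ∨ a = ∅ := by
  unfold live at h; split_ifs at h
  · exact Or.inl fun h0 => h (by rw [condIn, h0, zero_mul, zero_div])
  · right
    by_contra ha
    exact h (ind_false ha)

lemma delLaw_live (L V : Finset (Fin K)) (S : Finset (Fin N)) :
    delLaw (live m L S) V = live m (L \ V) S := by
  ext v a
  by_cases hV : v ∈ V <;> by_cases hL : v ∈ L <;> simp [delLaw, live, hV, hL]

lemma ind_subset_erase {S a : Finset (Fin N)} (s : Fin N) :
    ind (a ⊆ S.erase s) = ind (a ⊆ S) * ind (s ∉ a) := by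
  rw [← ind_and]
  exact ind_congr Finset.subset_erase

/-- A user law conditioned on `S` is obtained by mixing: reveal whether `s` is used, and if it is
not, draw the choice from the law conditioned on `S \ {s}`. -/
lemma sum_live_mix {S : Finset (Fin N)} {s : Fin N} (hS : massIn m S ≠ 0)
    (hSs : massIn m (S.erase s) ≠ 0) (L : Finset (Fin K)) (v : Fin K) (b : Finset (Fin N)) :
    ∑ a, ∑ a', live m L S v a * live m L (S.erase s) v a' *
      ind ((if s ∈ a then a else a') = b) = live m L S v b := by
  by_cases hv : v ∈ L
  · simp only [live, hv, if_true]
    have hinner : ∀ a, ∑ a', condIn m S a * condIn m (S.erase s) a' *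
        ind ((if s ∈ a then a else a') = b) =
        ind (a = b) * (condIn m S a * ind (s ∈ a)) +
          (condIn m S a * ind (s ∉ a)) * condIn m (S.erase s) b := by
      intro a
      by_cases hs : s ∈ a
      · simp only [hs, if_true, ind_true, not_true_eq_false, ind_false not_false, mul_zero,
          zero_mul, add_zero, mul_one]
        rw [← Finset.sum_mul, ← Finset.mul_sum, sum_condIn hSs]
        ring
      · simp only [hs, if_false, ind_false not_false, not_false_eq_true, ind_true, mul_zero,
          zero_add, mul_one, mul_assoc]
        rw [← Finset.mul_sum, sum_mul_ind_eq]
    simp_rw [hinner, Finset.sum_add_distrib]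
    rw [sum_ind_eq_mul, ← Finset.sum_mul]
    -- The probability of avoiding `s` cancels the normalisation of the fresh draw, so the mixture
    -- has exactly the weights conditioned on `S`.
    have hmass : ∑ a, condIn m S a * ind (s ∉ a) = massIn m (S.erase s) / massIn m S := by
      rw [massIn, Finset.sum_div]
      refine Finset.sum_congr rfl fun a _ => ?_
      rw [condIn, ind_subset_erase]
      ring
    rw [hmass]
    simp only [condIn, ind_subset_erase, ind_not]
    field_simp
    ring
  · simp only [live, hv, if_false]
    simp_rw [mul_assoc, ← Finset.mul_sum, sum_ind_eq_mul]
    simp only [Finset.notMem_empty, if_false]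
    exact ind_congr eq_comm

/-- Exploration of the slot `s`: given the choices of its users, the choices of the remaining users
are independent and conditioned on not using `s`. -/
lemma pexp_live_explore (hm : ∀ a, 0 ≤ m a) {S : Finset (Fin N)} {s : Fin N} (hS : massIn m S ≠ 0)
    (hSs : massIn m (S.erase s) ≠ 0) (L : Finset (Fin K))
    (R : (Fin K → Finset (Fin N)) → (Fin K → Finset (Fin N)) → ℝ)
    (hR : ∀ A A' B, (∀ v, s ∈ A v ∨ s ∈ A' v → A v = A' v) → R A B = R A' B) :
    pexp (live m L S) (fun A => R A (del A (slotUsers A s))) =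
      pexp (live m L S) fun A => pexp (live m (L \ slotUsers A s) (S.erase s)) (R A) := by
  have hlaw := isLaw_live hm L hSs
  -- Draw `A` conditioned on `S` and an independent `A'` conditioned on avoiding `s`, and keep `A v`
  -- only for the users of `s`. The choices of the others are then those of `A'`, independent of who
  -- uses `s`.
  rw [← pexp_resample _ _ _ (fun _ a a' => if s ∈ a then a else a') (sum_live_mix hS hSs L)]
  refine pexp_congr fun A _ => ?_
  rw [← delLaw_live, ← pexp_del _ hlaw]
  refine pexp_congr fun A' hA' => ?_
  have hs' : ∀ v, s ∉ A' v := fun v h =>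
    (Finset.mem_erase.mp (subset_of_live_ne_zero (hA' v) h)).1 rfl
  have hU : slotUsers (fun v => if s ∈ A v then A v else A' v) s = slotUsers A s := by
    ext v
    rw [mem_slotUsers, mem_slotUsers]
    by_cases h : s ∈ A v <;> simp [h, hs' v]
  have hD : del (fun v => if s ∈ A v then A v else A' v) (slotUsers A s) =
      del A' (slotUsers A s) := by
    ext v : 1
    by_cases h : s ∈ A v <;> simp [del, mem_slotUsers, h]
  rw [hU, hD]
  refine hR _ _ _ fun v hv => ?_
  by_cases h : s ∈ A v
  · simp [h]
  · simp [h, hs' v] at hv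

end Live

/-! ### Joint moments for a fixed outcome of the exploration of one slot. -/

section Step

variable {K N : ℕ} {Ω : Type*} [Fintype Ω]

/-- Joint moment of cavity messages: the slots in `X` at level `ℓ + 1`, those in `Y` at level `ℓ`.
The slot `s` is decoded according to the table `D (τ s)`, where `τ s` has weights `ν s`. -/
def cavMoment (D : Ω → ℕ → ℕ → Prop) (ν : Fin N → Ω → ℝ) (μ : Fin K → Finset (Fin N) → ℝ)
    (ℓ : ℕ) (X Y : Finset (Fin N)) : ℝ :=
  pexp μ fun A => pexp ν fun τ => (∏ x ∈ X, ind (cav (fun s => D (τ s)) (ℓ + 1) A x)) *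
    ∏ y ∈ Y, ind (cav (fun s => D (τ s)) ℓ A y)

/-- Expansion of a function of the number of true statements into multilinear monomials. -/
lemma apply_card_filter_eq_sum {α : Type*} [DecidableEq α] (V : Finset α) (P : α → Prop)
    [DecidablePred P] (f : ℕ → ℝ) :
    f (V.filter P).card = ∑ M ∈ V.powerset, ∑ M' ∈ (V \ M).powerset,
      f M.card * (-1) ^ M'.card * ∏ v ∈ M ∪ M', ind (P v) := by
  have h1 : f (V.filter P).card = ∑ M ∈ V.powerset,
      f M.card * ((∏ v ∈ M, ind (P v)) * ∏ v ∈ V \ M, (1 - ind (P v))) := by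
    rw [Finset.sum_eq_single (V.filter P)]
    · rw [Finset.prod_eq_one, Finset.prod_eq_one, mul_one, mul_one]
      · intro v hv
        rw [Finset.mem_sdiff, Finset.mem_filter] at hv
        rw [ind_false fun h => hv.2 ⟨hv.1, h⟩, sub_zero]
      · intro v hv
        exact ind_true (Finset.mem_filter.mp hv).2
    · intro M hM hne
      have hMV := Finset.mem_powerset.mp hM
      have : ∃ v ∈ V, ¬ (v ∈ M ↔ P v) := by
        by_contra! h
        apply hne
        ext v
        rw [Finset.mem_filter]
        exact ⟨fun hv => ⟨hMV hv, (h v (hMV hv)).mp hv⟩, fun hv => (h v hv.1).mpr hv.2⟩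
      obtain ⟨v, hv, hne⟩ := this
      by_cases hvM : v ∈ M
      · rw [Finset.prod_eq_zero hvM (ind_false fun h => hne ⟨fun _ => h, fun _ => hvM⟩), zero_mul,
          mul_zero]
      · have hP : P v := by tauto
        rw [Finset.prod_eq_zero (Finset.mem_sdiff.mpr ⟨hv, hvM⟩)
          (by rw [ind_true hP, sub_self]), mul_zero, mul_zero]
    · intro h
      exact absurd (Finset.mem_powerset.mpr (Finset.filter_subset _ _)) h
  rw [h1]
  refine Finset.sum_congr rfl fun M _ => ?_
  have h2 : ∏ v ∈ V \ M, (1 - ind (P v)) =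
      ∑ M' ∈ (V \ M).powerset, (-1) ^ M'.card * ∏ v ∈ M', ind (P v) := by
    have := Finset.prod_add (fun v => -ind (P v)) (fun _ => 1) (V \ M)
    simp only [Finset.prod_const_one, mul_one, Finset.prod_neg] at this
    rw [← this]
    exact Finset.prod_congr rfl fun v _ => by ring
  rw [h2, Finset.mul_sum, Finset.mul_sum]
  refine Finset.sum_congr rfl fun M' hM' => ?_
  rw [Finset.prod_union (Finset.disjoint_of_subset_right (Finset.mem_powerset.mp hM')
    Finset.disjoint_sdiff)]
  ring

/-- Averaged version of `apply_card_filter_eq_sum`, with probabilities in place of indicators. -/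
lemma sum_sum_eq_sum_prod {α : Type*} [DecidableEq α] (V : Finset α) (x : α → ℝ) (f : ℕ → ℝ) :
    ∑ M ∈ V.powerset, ∑ M' ∈ (V \ M).powerset, f M.card * (-1) ^ M'.card * ∏ v ∈ M ∪ M', x v =
      ∑ M ∈ V.powerset, f M.card * ((∏ v ∈ M, x v) * ∏ v ∈ V \ M, (1 - x v)) := by
  refine Finset.sum_congr rfl fun M _ => ?_
  have h2 : ∏ v ∈ V \ M, (1 - x v) =
      ∑ M' ∈ (V \ M).powerset, (-1) ^ M'.card * ∏ v ∈ M', x v := by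
    have := Finset.prod_add (fun v => -x v) (fun _ => 1) (V \ M)
    simp only [Finset.prod_const_one, mul_one, Finset.prod_neg] at this
    rw [← this]
    exact Finset.prod_congr rfl fun v _ => by ring
  rw [h2, Finset.mul_sum, Finset.mul_sum]
  refine Finset.sum_congr rfl fun M' hM' => ?_
  rw [Finset.prod_union (Finset.disjoint_of_subset_right (Finset.mem_powerset.mp hM')
    Finset.disjoint_sdiff)]
  ring

/-- At most `2 ^ V.card` choices for each of `M` and `M'`; only a bound depending on `V.card` alone
is needed. -/
lemma sum_sum_powerset_le {α : Type*} [DecidableEq α] (V : Finset α) {ε : ℝ} (hε : 0 ≤ ε) :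
    ∑ M ∈ V.powerset, ∑ _M' ∈ (V \ M).powerset, ε ≤ 4 ^ V.card * ε := by
  calc _ ≤ ∑ _M ∈ V.powerset, (2 : ℝ) ^ V.card * ε := by
        refine Finset.sum_le_sum fun M _ => ?_
        rw [Finset.sum_const, Finset.card_powerset, nsmul_eq_mul]
        push_cast
        gcongr
        · norm_num
        · exact Finset.sdiff_subset
    _ = _ := by
        rw [Finset.sum_const, Finset.card_powerset, nsmul_eq_mul]
        push_cast
        rw [← mul_assoc, ← mul_pow]
        norm_num

/-- The probability of decoding a slot explored in the frame `A`, when each of the slots of its users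
stays unresolved with probability `p`. -/
def decodeProb (η : ℕ → ℕ → ℝ) (p : ℝ) (A : Fin K → Finset (Fin N)) (s : Fin N) : ℝ :=
  ∑ M ∈ (slotUsers A s).powerset, η (slotUsers A s).card M.card *
    ((∏ v ∈ M, p ^ ((A v).card - 1)) * ∏ v ∈ slotUsers A s \ M, (1 - p ^ ((A v).card - 1)))

/-- The weights of the subsets `M` are those of independent coin flips, one per user of the slot,
and add up to one. -/
lemma decodeProb_mem (η : ℕ → ℕ → ℝ) (hη : ∀ k m, η k m ∈ Set.Icc (0 : ℝ) 1) {p : ℝ}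
    (hp : p ∈ Set.Icc (0 : ℝ) 1) (A : Fin K → Finset (Fin N)) (s : Fin N) :
    decodeProb η p A s ∈ Set.Icc (0 : ℝ) 1 := by
  have hx0 : ∀ v, 0 ≤ p ^ ((A v).card - 1) := fun v => pow_nonneg hp.1 _
  have hx1 : ∀ v, 0 ≤ 1 - p ^ ((A v).card - 1) := fun v => sub_nonneg.mpr (pow_le_one₀ hp.1 hp.2)
  have hnn : ∀ M : Finset (Fin K), 0 ≤ (∏ v ∈ M, p ^ ((A v).card - 1)) *
      ∏ v ∈ slotUsers A s \ M, (1 - p ^ ((A v).card - 1)) := fun M =>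
    mul_nonneg (Finset.prod_nonneg fun v _ => hx0 v) (Finset.prod_nonneg fun v _ => hx1 v)
  refine ⟨Finset.sum_nonneg fun M _ => mul_nonneg (hη _ _).1 (hnn M), ?_⟩
  calc _ ≤ ∑ M ∈ (slotUsers A s).powerset, (∏ v ∈ M, p ^ ((A v).card - 1)) *
        ∏ v ∈ slotUsers A s \ M, (1 - p ^ ((A v).card - 1)) :=
        Finset.sum_le_sum fun M _ => mul_le_of_le_one_left (hnn M) (hη _ _).2
    _ = 1 := by
        rw [← Finset.prod_add]
        exact Finset.prod_eq_one fun v _ => by ring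

/-- The cycle-free situation in which the slots found while exploring `s` are distinct from each
other and from those in `Z`. -/
lemma explored_disjoint {A : Fin K → Finset (Fin N)} {s : Fin N} {Z : Finset (Fin N)} {ℓ j : ℕ}
    (hcyc : ¬ HasCycle (ℓ + 1) A s)
    (hconn : ¬ ∃ t ∈ Z, ∃ v, s ∈ A v ∧ ∃ c ∈ A v, c ≠ s ∧ Conn j (del A {v}) t c) :
    (∀ v ∈ slotUsers A s, ∀ w ∈ slotUsers A s, v ≠ w →
      Disjoint ((A v).erase s) ((A w).erase s)) ∧
    ∀ v ∈ slotUsers A s, Disjoint Z ((A v).erase s) := by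
  constructor
  · intro v hv w hw hvw
    rw [Finset.disjoint_left]
    intro y hyv hyw
    rw [Finset.mem_erase] at hyv hyw
    rw [mem_slotUsers] at hv hw
    refine hcyc ⟨v, hv, y, hyv.2, hyv.1, Or.inr (Or.inr ⟨w, ?_, y, ?_, hyv.1, Conn.refl _ _ _⟩)⟩ <;>
    · rw [mem_del, Finset.mem_singleton]
      exact ⟨hvw.symm, by tauto⟩
  · intro v hv
    rw [Finset.disjoint_left]
    intro y hyZ hy
    rw [Finset.mem_erase] at hy
    exact hconn ⟨y, hyZ, v, mem_slotUsers.mp hv, y, hy.2, hy.1, Conn.refl _ _ _⟩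

/-- Moments of the cavity messages around the explored users, for a fixed outcome of the
exploration of the slot `s`. -/
lemma abs_explored_sub_le {D : Ω → ℕ → ℕ → Prop} {ν : Fin N → Ω → ℝ} (hν : IsLaw ν)
    {μ : Fin K → Finset (Fin N) → ℝ} {s : Fin N} {η : ℕ → ℕ → ℝ}
    (hη01 : ∀ k m, η k m ∈ Set.Icc (0 : ℝ) 1)
    (hη : ∀ k m, m ≤ k → k ≤ K → ∑ ω, ν s ω * ind (D ω (k + 1) (1 + m)) = η k m)
    {S : Finset (Fin N)} (hμS : ∀ v a, μ v a ≠ 0 → a ⊆ S.erase s)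
    {ℓ d : ℕ} {X Y : Finset (Fin N)} (hsX : s ∉ X) (hsY : s ∉ Y) (hXY : Disjoint X Y) (hYS : Y ⊆ S)
    {p p' ε : ℝ} (hε : 0 ≤ ε) (A : Fin K → Finset (Fin N)) (hAS : ∀ v, A v ⊆ S)
    (hAd : ∀ v, (A v).card ≤ d)
    (hA1 : ∀ v ∈ slotUsers A s, ∀ w ∈ slotUsers A s, v ≠ w →
      Disjoint ((A v).erase s) ((A w).erase s))
    (hA2 : ∀ v ∈ slotUsers A s, Disjoint (X ∪ Y) ((A v).erase s))
    (hmom : ∀ Z, Z ⊆ S.erase s → Disjoint X Z → Z.card ≤ Y.card + (slotUsers A s).card * d →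
      |cavMoment D ν μ ℓ X Z - p' ^ X.card * p ^ Z.card| ≤ ε) :
    |(open Classical in pexp μ fun B => pexp ν fun τ =>
        ind (D (τ s) ((slotUsers A s).card + 1) (1 + ((slotUsers A s).filter fun v =>
          ∀ y ∈ A v, y ≠ s → cav (fun s => D (τ s)) ℓ B y).card)) *
        ((∏ x ∈ X, ind (cav (fun s => D (τ s)) (ℓ + 1) B x)) *
          ∏ y ∈ Y, ind (cav (fun s => D (τ s)) ℓ B y))) -
      decodeProb η p A s * (p' ^ X.card * p ^ Y.card)| ≤ 4 ^ (slotUsers A s).card * ε := by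
  classical
  set V := slotUsers A s with hV
  set k := V.card with hk
  have hkK : k ≤ K := by simpa using Finset.card_le_univ V
  -- The further slots of the users in `M`. By `hA1` they form a disjoint union, so "all these users
  -- are undetected" is a product over distinct slots, to be merged with the product over `Y`.
  let W : Finset (Fin K) → Finset (Fin N) := fun M => M.biUnion fun v => (A v).erase s
  have hWY : ∀ M ⊆ V, Disjoint Y (W M) := fun M hM => by
    rw [Finset.disjoint_biUnion_right]
    exact fun v hv => Finset.disjoint_of_subset_left Finset.subset_union_right (hA2 v (hM hv))
  have hWX : ∀ M ⊆ V, Disjoint X (W M) := fun M hM => by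
    rw [Finset.disjoint_biUnion_right]
    exact fun v hv => Finset.disjoint_of_subset_left Finset.subset_union_left (hA2 v (hM hv))
  have hWcard : ∀ M ⊆ V, (W M).card = ∑ v ∈ M, ((A v).card - 1) := fun M hM => by
    rw [Finset.card_biUnion fun v hv w hw hvw => hA1 v (hM hv) w (hM hw) hvw]
    exact Finset.sum_congr rfl fun v hv =>
      Finset.card_erase_of_mem (mem_slotUsers.mp (hM hv))
  have hWS : ∀ M, W M ⊆ S.erase s := fun M => by
    rw [Finset.biUnion_subset]
    exact fun v _ => Finset.erase_subset_erase s (hAS v)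
  have hWprod : ∀ M ⊆ V, ∀ g : Fin N → ℝ,
      ∏ y ∈ W M, g y = ∏ v ∈ M, ∏ y ∈ (A v).erase s, g y := fun M hM g =>
    Finset.prod_biUnion fun v hv w hw hvw => hA1 v (hM hv) w (hM hw) hvw
  have hMM' : ∀ {M M' : Finset (Fin K)}, M ∈ V.powerset → M' ∈ (V \ M).powerset → M ∪ M' ⊆ V :=
    fun hM hM' => Finset.union_subset (Finset.mem_powerset.mp hM)
      ((Finset.mem_powerset.mp hM').trans Finset.sdiff_subset)
  -- the monomials as cavity moments
  have hterm : ∀ M ∈ V.powerset, ∀ M' ∈ (V \ M).powerset,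
      (pexp μ fun B => pexp ν fun τ => ind (D (τ s) (k + 1) (1 + M.card)) * (-1) ^ M'.card *
        (∏ v ∈ M ∪ M', ind (∀ y ∈ A v, y ≠ s → cav (fun s => D (τ s)) ℓ B y)) *
        ((∏ x ∈ X, ind (cav (fun s => D (τ s)) (ℓ + 1) B x)) *
          ∏ y ∈ Y, ind (cav (fun s => D (τ s)) ℓ B y))) =
      η k M.card * (-1) ^ M'.card * cavMoment D ν μ ℓ X (Y ∪ W (M ∪ M')) := by
    intro M hM M' hM'
    have hsub := hMM' hM hM'
    rw [cavMoment, ← pexp_const_mul]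
    refine pexp_congr fun B hB => ?_
    have hBs : ∀ v, ∀ x ∈ B v, x ≠ s := fun v x hx =>
      (Finset.mem_erase.mp (hμS v _ (hB v) hx)).1
    have hYW : ∀ y ∈ Y ∪ W (M ∪ M'), y ≠ s := fun y hy => by
      rcases Finset.mem_union.mp hy with h | h
      · exact fun hys => hsY (hys ▸ h)
      · exact (Finset.mem_erase.mp (hWS _ h)).1
    have hfun : ∀ τ : Fin N → Ω, ind (D (τ s) (k + 1) (1 + M.card)) * (-1) ^ M'.card *
        (∏ v ∈ M ∪ M', ind (∀ y ∈ A v, y ≠ s → cav (fun s => D (τ s)) ℓ B y)) *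
        ((∏ x ∈ X, ind (cav (fun s => D (τ s)) (ℓ + 1) B x)) *
          ∏ y ∈ Y, ind (cav (fun s => D (τ s)) ℓ B y)) =
        (-1) ^ M'.card * (ind (D (τ s) (k + 1) (1 + M.card)) *
          ((∏ x ∈ X, ind (cav (fun s => D (τ s)) (ℓ + 1) B x)) *
          ∏ y ∈ Y ∪ W (M ∪ M'), ind (cav (fun s => D (τ s)) ℓ B y))) := by
      intro τ
      rw [Finset.prod_union (hWY _ hsub), hWprod _ hsub]
      have : ∀ v, ind (∀ y ∈ A v, y ≠ s → cav (fun s => D (τ s)) ℓ B y) =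
          ∏ y ∈ (A v).erase s, ind (cav (fun s => D (τ s)) ℓ B y) := fun v => by
        rw [← ind_forall_mem]
        exact ind_congr (by simp only [Finset.mem_erase]; tauto)
      simp only [this]
      ring
    simp_rw [hfun]
    -- No remaining user uses `s`, and `s` lies outside all the slots in the moment, so the table of
    -- `s` is independent of every other factor.
    rw [pexp_const_mul, hν.pexp_indep s (fun ω => ind (D ω (k + 1) (1 + M.card)))]
    · rw [hη k M.card (Finset.card_le_card (Finset.mem_powerset.mp hM)) hkK]
      ring
    · intro τ ω
      have hcav : ∀ j x, x ≠ s → (cav (fun s' => D (Function.update τ s ω s')) j B x ↔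
          cav (fun s => D (τ s)) j B x) := fun j x hx =>
        cav_congr_dec (by simp [hx]) fun v y hy => by simp [hBs v y hy]
      congr 1
      · exact Finset.prod_congr rfl fun x hx => ind_congr
          (hcav _ _ fun h => hsX (h ▸ hx))
      · exact Finset.prod_congr rfl fun x hx => ind_congr (hcav _ _ (hYW x hx))
  have hexp : (pexp μ fun B => pexp ν fun τ =>
        ind (D (τ s) (k + 1) (1 + (V.filter fun v =>
          ∀ y ∈ A v, y ≠ s → cav (fun s => D (τ s)) ℓ B y).card)) *
        ((∏ x ∈ X, ind (cav (fun s => D (τ s)) (ℓ + 1) B x)) *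
          ∏ y ∈ Y, ind (cav (fun s => D (τ s)) ℓ B y))) =
      ∑ M ∈ V.powerset, ∑ M' ∈ (V \ M).powerset,
        η k M.card * (-1) ^ M'.card * cavMoment D ν μ ℓ X (Y ∪ W (M ∪ M')) := by
    have hpt : ∀ (B : Fin K → Finset (Fin N)) (τ : Fin N → Ω),
        ind (D (τ s) (k + 1) (1 + (V.filter fun v =>
          ∀ y ∈ A v, y ≠ s → cav (fun s => D (τ s)) ℓ B y).card)) *
        ((∏ x ∈ X, ind (cav (fun s => D (τ s)) (ℓ + 1) B x)) *
          ∏ y ∈ Y, ind (cav (fun s => D (τ s)) ℓ B y)) =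
        ∑ M ∈ V.powerset, ∑ M' ∈ (V \ M).powerset,
          ind (D (τ s) (k + 1) (1 + M.card)) * (-1) ^ M'.card *
          (∏ v ∈ M ∪ M', ind (∀ y ∈ A v, y ≠ s → cav (fun s => D (τ s)) ℓ B y)) *
          ((∏ x ∈ X, ind (cav (fun s => D (τ s)) (ℓ + 1) B x)) *
            ∏ y ∈ Y, ind (cav (fun s => D (τ s)) ℓ B y)) := by
      intro B τ
      have := apply_card_filter_eq_sum V
        (fun v => ∀ y ∈ A v, y ≠ s → cav (fun s => D (τ s)) ℓ B y)
        (fun j => ind (D (τ s) (k + 1) (1 + j)))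
      beta_reduce at this
      rw [this, Finset.sum_mul]
      exact Finset.sum_congr rfl fun M _ => by rw [Finset.sum_mul]
    simp_rw [hpt, pexp_sum]
    exact Finset.sum_congr rfl fun M hM => Finset.sum_congr rfl fun M' hM' => hterm M hM M' hM'
  have hlim : decodeProb η p A s * (p' ^ X.card * p ^ Y.card) =
      ∑ M ∈ V.powerset, ∑ M' ∈ (V \ M).powerset,
        η k M.card * (-1) ^ M'.card * (p' ^ X.card * p ^ (Y ∪ W (M ∪ M')).card) := by
    rw [decodeProb, ← hV, ← hk, ← sum_sum_eq_sum_prod, Finset.sum_mul]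
    refine Finset.sum_congr rfl fun M hM => ?_
    rw [Finset.sum_mul]
    refine Finset.sum_congr rfl fun M' hM' => ?_
    have hsub := hMM' hM hM'
    rw [Finset.card_union_of_disjoint (hWY _ hsub), hWcard _ hsub, pow_add,
      ← Finset.prod_pow_eq_pow_sum]
    ring
  rw [hlim]
  refine le_trans (le_of_eq (congrArg abs (congrArg₂ _ ?_ rfl))) (?_ : |∑ M ∈ V.powerset,
    ∑ M' ∈ (V \ M).powerset, η k M.card * (-1) ^ M'.card *
      cavMoment D ν μ ℓ X (Y ∪ W (M ∪ M')) - ∑ M ∈ V.powerset, ∑ M' ∈ (V \ M).powerset,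
        η k M.card * (-1) ^ M'.card * (p' ^ X.card * p ^ (Y ∪ W (M ∪ M')).card)| ≤ _)
  · rw [← hexp]
  · simp_rw [← Finset.sum_sub_distrib]
    refine (Finset.abs_sum_le_sum_abs _ _).trans ((Finset.sum_le_sum fun M hM => ?_).trans
      (sum_sum_powerset_le V hε))
    refine (Finset.abs_sum_le_sum_abs _ _).trans (Finset.sum_le_sum fun M' hM' => ?_)
    have hsub := hMM' hM hM'
    rw [← mul_sub, abs_mul, abs_mul, abs_pow, abs_neg, abs_one, one_pow, mul_one,
      abs_of_nonneg (hη01 _ _).1]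
    refine (mul_le_of_le_one_left (abs_nonneg _) (hη01 _ _).2).trans (hmom _ ?_ ?_ ?_)
    · refine Finset.union_subset (fun y hy => Finset.mem_erase.mpr ⟨?_, hYS hy⟩) (hWS _)
      rintro rfl; exact hsY hy
    · rw [Finset.disjoint_union_right]
      exact ⟨hXY, hWX _ hsub⟩
    · refine (Finset.card_union_le _ _).trans (Nat.add_le_add_left ?_ _)
      rw [hWcard _ hsub]
      calc ∑ v ∈ M ∪ M', ((A v).card - 1) ≤ ∑ _v ∈ M ∪ M', d :=
            Finset.sum_le_sum fun v _ => (Nat.sub_le _ _).trans (hAd v)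
        _ = (M ∪ M').card * d := by rw [Finset.sum_const, smul_eq_mul]
        _ ≤ k * d := Nat.mul_le_mul_right _ (Finset.card_le_card hsub)

end Step

/-! ### The one-slot recursion for joint moments. -/

section Recursion

variable {K N : ℕ} {Ω : Type*} [Fintype Ω]

/-- The probability of decoding a slot with `k + 1` packets, `k - j` of which are cancelled. -/
def successProb (T : ℕ) (PE : ℕ → ℝ) (γ : ℝ) (k j : ℕ) : ℝ :=
  if j < T then (1 - PE (j + 1)) * γ ^ (k - j) else 0

lemma successProb_mem {T : ℕ} {PE : ℕ → ℝ} {γ : ℝ}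
    (hPE : ∀ t ∈ Finset.Icc 1 T, PE t ∈ Set.Icc (0 : ℝ) 1) (hγ0 : 0 ≤ γ) (hγ1 : γ ≤ 1) (k j : ℕ) :
    successProb T PE γ k j ∈ Set.Icc (0 : ℝ) 1 := by
  unfold successProb
  split_ifs with h
  · have hP := hPE (j + 1) (Finset.mem_Icc.mpr ⟨by omega, by omega⟩)
    exact ⟨mul_nonneg (by linarith [hP.2]) (pow_nonneg hγ0 _),
      mul_le_one₀ (by linarith [hP.1]) (pow_nonneg hγ0 _) (pow_le_one₀ hγ0 hγ1)⟩
  · simp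

/-- The decoding probability of an explored slot as a sum of products over the users. -/
lemma decodeProb_successProb (T : ℕ) (PE : ℕ → ℝ) (γ p : ℝ) (A : Fin K → Finset (Fin N))
    (s : Fin N) :
    decodeProb (successProb T PE γ) p A s =
      ∑ M : Finset (Fin K), (if M.card < T then 1 - PE (M.card + 1) else 0) *
        ∏ v, (if v ∈ M then ind (s ∈ A v) * p ^ ((A v).card - 1)
          else ind (s ∉ A v) + ind (s ∈ A v) * (γ * (1 - p ^ ((A v).card - 1)))) := by
  set V := slotUsers A s with hV
  rw [← Finset.sum_subset (Finset.subset_univ V.powerset), decodeProb, ← hV]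
  · refine Finset.sum_congr rfl fun M hM => ?_
    have hMV := Finset.mem_powerset.mp hM
    -- The power of `γ` is distributed over the users: one factor for each cancelled user of the
    -- slot, and one for nobody else. This product form lets independence act user by user.
    have hprod : ∏ v, (if v ∈ M then ind (s ∈ A v) * p ^ ((A v).card - 1)
          else ind (s ∉ A v) + ind (s ∈ A v) * (γ * (1 - p ^ ((A v).card - 1)))) =
        (∏ v ∈ M, p ^ ((A v).card - 1)) *
          (γ ^ (V.card - M.card) * ∏ v ∈ V \ M, (1 - p ^ ((A v).card - 1))) := by
      rw [← Finset.prod_subset (Finset.subset_univ V), ← Finset.prod_sdiff hMV, mul_comm]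
      · congr 1
        · refine Finset.prod_congr rfl fun v hv => ?_
          rw [if_pos hv, ind_true (mem_slotUsers.mp (hMV hv)), one_mul]
        · rw [← Finset.card_sdiff_of_subset hMV, ← Finset.prod_const, ← Finset.prod_mul_distrib]
          refine Finset.prod_congr rfl fun v hv => ?_
          rw [Finset.mem_sdiff] at hv
          have hs := mem_slotUsers.mp hv.1
          rw [if_neg hv.2, ind_true hs, ind_false (not_not.mpr hs), zero_add, one_mul]
      · intro v _ hv
        have hs : s ∉ A v := fun h => hv (mem_slotUsers.mpr h)
        rw [if_neg fun h => hv (hMV h), ind_true hs, ind_false hs, zero_mul, add_zero]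
    rw [hprod, successProb]
    split_ifs <;> ring
  · intro M _ hM
    rw [Finset.mem_powerset, Finset.not_subset] at hM
    obtain ⟨v, hv, hvV⟩ := hM
    rw [Finset.prod_eq_zero (Finset.mem_univ v), mul_zero]
    rw [if_pos hv, ind_false fun h => hvV (mem_slotUsers.mpr h), zero_mul]

/-- The probability that a user uses the slot `s`, weighted by `p` to the number of its other
slots. -/
def edgeWeight (m : Finset (Fin N) → ℝ) (S : Finset (Fin N)) (p : ℝ) (s : Fin N) : ℝ :=
  ∑ a, condIn m S a * (ind (s ∈ a) * p ^ (a.card - 1))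

/-- The expectation of each product factorises over users. A user of `L` contributes `edgeWeight m S
p s` when it remains undetected; otherwise it contributes the probability of avoiding `s` plus `γ`
times that of using `s` and being cancelled. Idle users exclude the sets `M` not contained in `L`,
and grouping the others by size gives a binomial sum. -/
lemma pexp_decodeProb {m : Finset (Fin N) → ℝ} {S : Finset (Fin N)}
    (hS : massIn m S ≠ 0) (L : Finset (Fin K)) (T : ℕ) (PE : ℕ → ℝ) (γ p : ℝ) (s : Fin N) :
    pexp (live m L S) (fun A => decodeProb (successProb T PE γ) p A s) =
      ∑ j ∈ Finset.range T, (1 - PE (j + 1)) * (L.card.choose j * edgeWeight m S p s ^ j *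
        (1 - edgeWeight m S 1 s + γ * (edgeWeight m S 1 s - edgeWeight m S p s)) ^
          (L.card - j)) := by
  set a := edgeWeight m S p s with ha
  set θ := edgeWeight m S 1 s with hθ
  set r := 1 - θ + γ * (θ - a) with hr
  simp_rw [decodeProb_successProb, pexp_sum, pexp_const_mul]
  have hM : ∀ M : Finset (Fin K), pexp (live m L S) (fun A =>
      ∏ v, (if v ∈ M then ind (s ∈ A v) * p ^ ((A v).card - 1)
        else ind (s ∉ A v) + ind (s ∈ A v) * (γ * (1 - p ^ ((A v).card - 1))))) =
      if M ⊆ L then a ^ M.card * r ^ (L.card - M.card) else 0 := by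
    intro M
    rw [pexp_prod (live m L S) (fun v b => if v ∈ M then ind (s ∈ b) * p ^ (b.card - 1)
        else ind (s ∉ b) + ind (s ∈ b) * (γ * (1 - p ^ (b.card - 1))))]
    have hin : ∀ v ∈ L, v ∈ M → ∑ b, live m L S v b * (if v ∈ M then ind (s ∈ b) * p ^ (b.card - 1)
        else ind (s ∉ b) + ind (s ∈ b) * (γ * (1 - p ^ (b.card - 1)))) = a := by
      intro v hL hv
      simp only [live, hL, hv, if_true, ha, edgeWeight]
    have hout : ∀ v ∈ L, v ∉ M → ∑ b, live m L S v b * (if v ∈ M then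
        ind (s ∈ b) * p ^ (b.card - 1)
        else ind (s ∉ b) + ind (s ∈ b) * (γ * (1 - p ^ (b.card - 1)))) = r := by
      intro v hL hv
      simp only [live, hL, hv, if_true, if_false]
      calc _ = ∑ b, (condIn m S b - condIn m S b * (ind (s ∈ b) * 1 ^ (b.card - 1)) +
            γ * (condIn m S b * (ind (s ∈ b) * 1 ^ (b.card - 1)) -
              condIn m S b * (ind (s ∈ b) * p ^ (b.card - 1)))) := by
            refine Finset.sum_congr rfl fun b _ => ?_
            rw [ind_not, one_pow]; ring
        _ = _ := by
            rw [Finset.sum_add_distrib, ← Finset.mul_sum, Finset.sum_sub_distrib,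
              Finset.sum_sub_distrib, sum_condIn hS]
            rfl
    have hidle : ∀ v ∉ L, ∑ b, live m L S v b * (if v ∈ M then ind (s ∈ b) * p ^ (b.card - 1)
        else ind (s ∉ b) + ind (s ∈ b) * (γ * (1 - p ^ (b.card - 1)))) =
        if v ∈ M then 0 else 1 := by
      intro v hL
      simp only [live, hL, if_false]
      rw [sum_ind_eq_mul]
      simp [ind]
    split_ifs with hML
    · rw [← Finset.prod_subset (Finset.subset_univ L), ← Finset.prod_sdiff hML,
        Finset.prod_congr rfl fun v hv => hin v (hML hv) hv,
        Finset.prod_congr rfl fun v hv => hout v (Finset.mem_sdiff.mp hv).1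
          (Finset.mem_sdiff.mp hv).2, Finset.prod_const, Finset.prod_const,
        Finset.card_sdiff_of_subset hML, mul_comm]
      intro v _ hv
      rw [hidle v hv, if_neg fun h => hv (hML h)]
    · obtain ⟨v, hv, hvL⟩ := Finset.not_subset.mp hML
      exact Finset.prod_eq_zero (Finset.mem_univ v) (by rw [hidle v hvL, if_pos hv])
  simp_rw [hM, mul_ite, mul_zero, ← Finset.mem_powerset]
  rw [Finset.sum_ite_mem, Finset.univ_inter, Finset.sum_powerset_apply_card (fun j =>
    (if j < T then 1 - PE (j + 1) else 0) * (a ^ j * r ^ (L.card - j)))]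
  simp only [nsmul_eq_mul]
  -- Both sums are extended to a common range: beyond `L.card` the binomial coefficient vanishes,
  -- beyond `T` the decoder fails.
  trans ∑ j ∈ Finset.range (max T (L.card + 1)), (L.card.choose j : ℝ) *
    ((if j < T then 1 - PE (j + 1) else 0) * (a ^ j * r ^ (L.card - j)))
  · refine Finset.sum_subset (by simp) fun j _ hj => ?_
    rw [Nat.choose_eq_zero_of_lt (by simpa using hj), Nat.cast_zero, zero_mul]
  · symm
    refine Finset.sum_subset_zero_on_sdiff (by simp) (fun j hj => ?_) fun j hj => ?_
    · rw [if_neg (by simpa using (Finset.mem_sdiff.mp hj).2)]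
      ring
    · rw [if_pos (by simpa using hj)]
      ring

lemma Conn.succ {j : ℕ} : ∀ {A : Fin K → Finset (Fin N)} {x y : Fin N},
    Conn j A x y → Conn (j + 1) A x y := by
  induction j with
  | zero => exact fun h => Or.inl h
  | succ j ih =>
    rintro A x y (h | ⟨w, hx, z, hz, hzx, h⟩)
    · exact Or.inl h
    · exact Or.inr ⟨w, hx, z, hz, hzx, ih h⟩

/-- The exploration of the slot `s` closes a cycle or meets the surroundings of the slots `Z`. -/
def Entangled (ℓ : ℕ) (A : Fin K → Finset (Fin N)) (s : Fin N) (Z : Finset (Fin N)) : Prop :=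
  HasCycle (ℓ + 1) A s ∨
    ∃ t ∈ Z, ∃ v, s ∈ A v ∧ ∃ c ∈ A v, c ≠ s ∧ Conn (ℓ + 1) (del A {v}) t c

/-- A connection from `t` to a slot of a deleted user either ends at `s`, which has become isolated,
or is an entanglement. Two values of `j` are needed because `X` carries messages of level `ℓ + 1`
and `Y` of level `ℓ`. -/
lemma cav_del_slotUsers {dec : Fin N → ℕ → ℕ → Prop} {A : Fin K → Finset (Fin N)} {s t : Fin N}
    {Z : Finset (Fin N)} {ℓ j : ℕ} (h : ¬ Entangled ℓ A s Z) (ht : t ∈ Z) (hts : t ≠ s)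
    (hj : j = ℓ ∨ j = ℓ + 1) :
    cav dec j A t ↔ cav dec j (del A (slotUsers A s)) t := by
  refine cav_del fun v hv c hc hconn => ?_
  have hconn' : Conn (ℓ + 1) (del A (slotUsers A s)) t c := by
    rcases hj with rfl | rfl
    · exact hconn.succ
    · exact hconn
  by_cases hcs : c = s
  · subst hcs
    exact hts (hconn'.eq_of_isolated fun w hw =>
      (mem_del.mp hw).1 (mem_slotUsers.mpr (mem_del.mp hw).2))
  · exact h (Or.inr ⟨t, ht, v, mem_slotUsers.mp hv, c, hc, hcs, hconn'.mono
      (del_le_del _ (Finset.singleton_subset_iff.mpr hv))⟩)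

/-- One step of the density evolution recursion, with explicit error terms. -/
lemma abs_cavMoment_insert_sub_le {D : Ω → ℕ → ℕ → Prop} {ν : Fin N → Ω → ℝ} (hν : IsLaw ν)
    {m : Finset (Fin N) → ℝ} (hm : ∀ a, 0 ≤ m a) {d : ℕ} (hmd : ∀ a, m a ≠ 0 → a.card ≤ d)
    {s : Fin N} {η : ℕ → ℕ → ℝ} (hη01 : ∀ k j, η k j ∈ Set.Icc (0 : ℝ) 1)
    (hη : ∀ k j, j ≤ k → k ≤ K → ∑ ω, ν s ω * ind (D ω (k + 1) (1 + j)) = η k j)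
    {S : Finset (Fin N)} (hS : massIn m S ≠ 0) (hSs : massIn m (S.erase s) ≠ 0)
    (L : Finset (Fin K)) {ℓ : ℕ} {X Y : Finset (Fin N)} (hsX : s ∉ X) (hsY : s ∉ Y)
    (hXY : Disjoint X Y) (hYS : Y ⊆ S) {p p' ε : ℝ} (hp : p ∈ Set.Icc (0 : ℝ) 1)
    (hp' : p' ∈ Set.Icc (0 : ℝ) 1) (hε : 0 ≤ ε) (k₀ : ℕ)
    (hmom : ∀ V : Finset (Fin K), V.card ≤ k₀ → ∀ Z, Z ⊆ S.erase s → Disjoint X Z →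
      Z.card ≤ Y.card + k₀ * d →
      |cavMoment D ν (live m (L \ V) (S.erase s)) ℓ X Z - p' ^ X.card * p ^ Z.card| ≤ ε) :
    |cavMoment D ν (live m L S) ℓ (insert s X) Y -
      (1 - pexp (live m L S) fun A => decodeProb η p A s) * (p' ^ X.card * p ^ Y.card)| ≤
      |cavMoment D ν (live m L S) ℓ X Y - p' ^ X.card * p ^ Y.card| +
        (2 * pr (live m L S) (fun A => Entangled ℓ A s (X ∪ Y)) +
          pr (live m L S) (fun A => k₀ < (slotUsers A s).card) + 4 ^ k₀ * ε) := by
  classical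
  set μ := live m L S with hμdef
  have hμ : IsLaw μ := isLaw_live hm L hS
  set ψ := p' ^ X.card * p ^ Y.card with hψ
  have hψ01 : ψ ∈ Set.Icc (0 : ℝ) 1 :=
    ⟨mul_nonneg (pow_nonneg hp'.1 _) (pow_nonneg hp.1 _),
      mul_le_one₀ (pow_le_one₀ hp'.1 hp'.2) (pow_nonneg hp.1 _) (pow_le_one₀ hp.1 hp.2)⟩
  -- the product over the other slots and the decoding event
  let Ψ : (Fin N → Ω) → (Fin K → Finset (Fin N)) → ℝ := fun τ B =>
    (∏ x ∈ X, ind (cav (fun s => D (τ s)) (ℓ + 1) B x)) *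
      ∏ y ∈ Y, ind (cav (fun s => D (τ s)) ℓ B y)
  have hΨ0 : ∀ τ B, 0 ≤ Ψ τ B := fun τ B =>
    mul_nonneg (prod_ind_nonneg _ _) (prod_ind_nonneg _ _)
  have hΨ1 : ∀ τ B, Ψ τ B ≤ 1 := fun τ B =>
    mul_le_one₀ (prod_ind_le_one _ _) (prod_ind_nonneg _ _) (prod_ind_le_one _ _)
  let E : (Fin N → Ω) → (Fin K → Finset (Fin N)) → (Fin K → Finset (Fin N)) → ℝ := fun τ A B =>
    ind (D (τ s) ((slotUsers A s).card + 1) (1 + ((slotUsers A s).filter fun v =>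
      ∀ y ∈ A v, y ≠ s → cav (fun s => D (τ s)) ℓ B y).card))
  have hE0 : ∀ τ A B, 0 ≤ E τ A B := fun τ A B => ind_nonneg _
  have hE1 : ∀ τ A B, E τ A B ≤ 1 := fun τ A B => ind_le_one _
  have hEΨ : ∀ τ A B C, E τ A B * Ψ τ C ∈ Set.Icc (0 : ℝ) 1 := fun τ A B C =>
    ⟨mul_nonneg (hE0 _ _ _) (hΨ0 _ _), mul_le_one₀ (hE1 _ _ _) (hΨ0 _ _) (hΨ1 _ _)⟩
  -- The slot `s` is unresolved exactly when its decoding event `E` fails; this is the only place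
  -- where the definition of its cavity message is unfolded.
  have hins : cavMoment D ν μ ℓ (insert s X) Y = cavMoment D ν μ ℓ X Y -
      pexp μ (fun A => pexp ν fun τ => E τ A (del A (slotUsers A s)) * Ψ τ A) := by
    rw [cavMoment, cavMoment, ← pexp_sub]
    congr 1; ext A
    rw [← pexp_sub]
    congr 1; ext τ
    have hcavs : ind (cav (fun s => D (τ s)) (ℓ + 1) A s) =
        1 - E τ A (del A (slotUsers A s)) := by
      rw [cav, ind_not]
    rw [Finset.prod_insert hsX, hcavs]
    simp only [Ψ]
    ring
  -- First use of entanglement: without it, deleting the users of `s` does not alter the messages of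
  -- the other slots.
  have herr1 : |pexp μ (fun A => pexp ν fun τ => E τ A (del A (slotUsers A s)) * Ψ τ A) -
      pexp μ (fun A => pexp ν fun τ =>
        E τ A (del A (slotUsers A s)) * Ψ τ (del A (slotUsers A s)))| ≤
      pr μ (fun A => Entangled ℓ A s (X ∪ Y)) := by
    rw [← pexp_sub]
    refine (hμ.abs_pexp_le _).trans (hμ.pexp_mono fun A => ?_)
    by_cases hA : Entangled ℓ A s (X ∪ Y)
    · rw [ind_true hA, abs_sub_le_iff]
      have h1 := fun τ => hEΨ τ A (del A (slotUsers A s)) A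
      have h2 := fun τ => hEΨ τ A (del A (slotUsers A s)) (del A (slotUsers A s))
      have a1 := hν.pexp_le_const fun τ => (h1 τ).2
      have a2 := hν.pexp_le_const fun τ => (h2 τ).2
      have b1 := hν.pexp_nonneg fun τ => (h1 τ).1
      have b2 := hν.pexp_nonneg fun τ => (h2 τ).1
      constructor <;> linarith
    · rw [ind_false hA]
      refine (abs_eq_zero.mpr (sub_eq_zero.mpr ?_)).le
      congr 1; ext τ
      congr 1
      simp only [Ψ]
      congr 1
      · exact Finset.prod_congr rfl fun x hx => ind_congr
          (cav_del_slotUsers hA (Finset.mem_union_left _ hx) (fun h => hsX (h ▸ hx)) (Or.inr rfl))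
      · exact Finset.prod_congr rfl fun y hy => ind_congr
          (cav_del_slotUsers hA (Finset.mem_union_right _ hy) (fun h => hsY (h ▸ hy)) (Or.inl rfl))
  have hexplore : pexp μ (fun A => pexp ν fun τ =>
        E τ A (del A (slotUsers A s)) * Ψ τ (del A (slotUsers A s))) =
      pexp μ fun A => pexp (live m (L \ slotUsers A s) (S.erase s)) fun B =>
        pexp ν fun τ => E τ A B * Ψ τ B := by
    refine pexp_live_explore hm hS hSs L (fun A B => pexp ν fun τ => E τ A B * Ψ τ B) ?_
    intro A A' B hAA'
    have hU : slotUsers A s = slotUsers A' s := by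
      ext v
      rw [mem_slotUsers, mem_slotUsers]
      refine ⟨fun h => hAA' v (Or.inl h) ▸ h, fun h => (hAA' v (Or.inr h)).symm ▸ h⟩
    congr 1; ext τ
    congr 1
    simp only [E, hU]
    rw [card_filter_congr_iff fun v hv => by rw [hAA' v (Or.inr (mem_slotUsers.mp hv))]]
  -- Second use of entanglement: without it, the newly found slots are distinct from one another and
  -- from `X ∪ Y`. With at most `k₀` users in `s` as well, the estimate for a fixed outcome applies.
  have herr2 : |pexp μ (fun A => pexp (live m (L \ slotUsers A s) (S.erase s)) fun B =>
        pexp ν fun τ => E τ A B * Ψ τ B) - (pexp μ fun A => decodeProb η p A s) * ψ| ≤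
      pr μ (fun A => Entangled ℓ A s (X ∪ Y)) + pr μ (fun A => k₀ < (slotUsers A s).card) +
        4 ^ k₀ * ε := by
    rw [← pexp_mul_const, ← pexp_sub, pr, pr, ← pexp_add, ← hμ.pexp_const (4 ^ k₀ * ε), ← pexp_add]
    refine (hμ.abs_pexp_le _).trans (hμ.pexp_mono_support fun A hA => ?_)
    have hε' : 0 ≤ 4 ^ k₀ * ε := by positivity
    by_cases hgood : ¬ Entangled ℓ A s (X ∪ Y) ∧ (slotUsers A s).card ≤ k₀
    · rw [ind_false hgood.1, ind_false (not_lt.mpr hgood.2), zero_add, zero_add]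
      obtain ⟨hcyc, hconn⟩ := not_or.mp hgood.1
      obtain ⟨hA1, hA2⟩ := explored_disjoint hcyc hconn
      refine (le_of_eq ?_).trans ((abs_explored_sub_le hν hη01 hη
        (fun v a ha => subset_of_live_ne_zero ha) hsX hsY hXY hYS hε A
        (fun v => subset_of_live_ne_zero (hA v)) (fun v => ?_) hA1 hA2
        fun Z hZ hXZ hZc => hmom _ hgood.2 Z hZ hXZ (hZc.trans
          (Nat.add_le_add_left (Nat.mul_le_mul_right _ hgood.2) _))).trans ?_)
      · rfl
      · rcases weight_ne_zero_of_live_ne_zero (hA v) with h | h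
        · exact hmd _ h
        · simp [h]
      · gcongr
        · norm_num
        · exact hgood.2
    -- For a bad outcome both quantities lie in the unit interval, so their difference is at most
    -- the indicator of the bad event.
    · have hlaw := isLaw_live hm (L \ slotUsers A s) hSs
      have h1 := fun B => hν.pexp_le_const fun τ => (hEΨ τ A B B).2
      have h0 := fun B => hν.pexp_nonneg fun τ => (hEΨ τ A B B).1
      have h1' := hlaw.pexp_le_const h1
      have h0' := hlaw.pexp_nonneg h0
      have hd := decodeProb_mem η hη01 hp A s
      have hd0 : 0 ≤ decodeProb η p A s * ψ := mul_nonneg hd.1 hψ01.1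
      have hd1 : decodeProb η p A s * ψ ≤ 1 := mul_le_one₀ hd.2 hψ01.1 hψ01.2
      have hone : 1 ≤ ind (Entangled ℓ A s (X ∪ Y)) + ind (k₀ < (slotUsers A s).card) := by
        rw [← ind_true (P := Entangled ℓ A s (X ∪ Y) ∨ k₀ < (slotUsers A s).card)]
        · exact ind_or_le _ _
        · by_contra h
          exact hgood ⟨fun h' => h (Or.inl h'), not_lt.mp fun h' => h (Or.inr h')⟩
      rw [abs_sub_le_iff]
      constructor <;> linarith
  rw [hins]
  rw [hexplore] at herr1
  rw [abs_le] at herr1 herr2 ⊢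
  have h3 := abs_le.mp (le_refl |cavMoment D ν μ ℓ X Y - ψ|)
  constructor <;> linarith [herr1.1, herr1.2, herr2.1, herr2.2, h3.1, h3.2]

end Recursion

/-! ### Effect of conditioning on the choices of a single user. -/

section Weights

variable {N : ℕ}

/-- Sparse weights on the slot choices of a user; the expected number of edges of the user, weighted
by `p` to the number of other edges, is `w p`, uniformly distributed over the slots. -/
structure UserWeights (c : ℝ) (d : ℕ) (w : ℝ → ℝ) (m : Finset (Fin N) → ℝ) : Prop where
  nonneg : ∀ a, 0 ≤ m a
  sum_one : ∑ a, m a = 1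
  card_le : ∀ a, m a ≠ 0 → a.card ≤ d
  bound : ∀ X : Finset (Fin N), X.card ≤ 3 → ∑ a, m a * ind (X ⊆ a) ≤ (c / N) ^ X.card
  edge : ∀ s p, ∑ a, m a * (ind (s ∈ a) * p ^ (a.card - 1)) = w p / N

variable {c : ℝ} {d : ℕ} {w : ℝ → ℝ} {m : Finset (Fin N) → ℝ}

lemma ind_subset_add_sum_ge (S a : Finset (Fin N)) :
    1 - ind (a ⊆ S) ≤ ∑ t ∈ Sᶜ, ind (t ∈ a) := by
  by_cases h : a ⊆ S
  · rw [ind_true h, sub_self]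
    exact Finset.sum_nonneg fun _ _ => ind_nonneg _
  · obtain ⟨t, ht, hS⟩ := Finset.not_subset.mp h
    rw [ind_false h, sub_zero, ← ind_true ht]
    exact Finset.single_le_sum (f := fun t => ind (t ∈ a)) (fun i _ => ind_nonneg _)
      (Finset.mem_compl.mpr hS)

namespace UserWeights

lemma sum_mem_le (h : UserWeights c d w m) (t : Fin N) : ∑ a, m a * ind (t ∈ a) ≤ c / N := by
  have := h.bound {t} (by simp)
  simpa [Finset.singleton_subset_iff] using this

lemma sum_mem_mem_le (h : UserWeights c d w m) {s t : Fin N} (hst : s ≠ t) :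
    ∑ a, m a * (ind (s ∈ a) * ind (t ∈ a)) ≤ (c / N) ^ 2 := by
  have := h.bound {s, t} (by rw [Finset.card_pair hst]; norm_num)
  rw [Finset.card_pair hst] at this
  refine le_trans (le_of_eq (Finset.sum_congr rfl fun a _ => ?_)) this
  rw [← ind_and]
  simp [Finset.insert_subset_iff]

lemma one_sub_massIn_le (h : UserWeights c d w m) (S : Finset (Fin N)) :
    1 - massIn m S ≤ Sᶜ.card * (c / N) := by
  rw [massIn, ← h.sum_one, ← Finset.sum_sub_distrib]
  calc ∑ a, (m a - m a * ind (a ⊆ S)) ≤ ∑ a, ∑ t ∈ Sᶜ, m a * ind (t ∈ a) := by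
        refine Finset.sum_le_sum fun a _ => ?_
        rw [← Finset.mul_sum, ← mul_one_sub]
        exact mul_le_mul_of_nonneg_left (ind_subset_add_sum_ge S a) (h.nonneg a)
    _ ≤ ∑ t ∈ Sᶜ, c / N := by
        rw [Finset.sum_comm]
        exact Finset.sum_le_sum fun t _ => h.sum_mem_le t
    _ = _ := by rw [Finset.sum_const, nsmul_eq_mul]

lemma massIn_le_one (h : UserWeights c d w m) (S : Finset (Fin N)) : massIn m S ≤ 1 := by
  rw [massIn, ← h.sum_one]
  exact Finset.sum_le_sum fun a _ => mul_le_of_le_one_right (h.nonneg a) (ind_le_one _)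

/-- Conditioning on an event of probability at least one half at most doubles probabilities; for
nonempty `X` this factor is absorbed by doubling `c`. -/
lemma sparse_live (h : UserWeights c d w m) (hc : 0 ≤ c) {K : ℕ} (L : Finset (Fin K))
    {S : Finset (Fin N)} (hS : 1 / 2 ≤ massIn m S) : Sparse (2 * c) (live m L S) where
  toIsLaw := isLaw_live h.nonneg L (by linarith)
  bound v X hX := by
    have hpos : 0 < massIn m S := by linarith
    have hlaw := isLaw_live h.nonneg L (K := K) hpos.ne'
    by_cases hX0 : X = ∅
    · subst hX0
      simp [ind_true, hlaw.sum_one]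
    unfold live
    split_ifs
    · have hcard : X.card ≠ 0 := Finset.card_ne_zero.mpr (Finset.nonempty_iff_ne_empty.mpr hX0)
      calc ∑ a, condIn m S a * ind (X ⊆ a) ≤ ∑ a, 2 * (m a * ind (X ⊆ a)) := by
            refine Finset.sum_le_sum fun a _ => ?_
            rw [← mul_assoc]
            refine mul_le_mul_of_nonneg_right ?_ (ind_nonneg _)
            rw [condIn, div_le_iff₀ hpos]
            have h1 := mul_le_of_le_one_right (h.nonneg a) (ind_le_one (a ⊆ S))
            nlinarith [h.nonneg a]
        _ ≤ 2 * (c / N) ^ X.card := by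
            rw [← Finset.mul_sum]
            exact mul_le_mul_of_nonneg_left (h.bound X hX) (by norm_num)
        _ ≤ 2 ^ X.card * (c / N) ^ X.card := by
            gcongr
            exact le_self_pow₀ (by norm_num) hcard
        _ = _ := by rw [← mul_pow]; ring
    · rw [sum_ind_eq_mul, ind_false (by simpa using hX0)]
      positivity

/-- Conditioning on few forbidden slots changes the edge weights by a lower order term. -/
lemma abs_edgeWeight_sub_le (h : UserWeights c d w m) (hc : 0 ≤ c) (hN : 0 < N)
    {S : Finset (Fin N)} (hS : 1 / 2 ≤ massIn m S) {s : Fin N} (hs : s ∈ S) {p : ℝ}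
    (hp : p ∈ Set.Icc (0 : ℝ) 1) :
    |N * edgeWeight m S p s - w p| ≤ 3 * Sᶜ.card * c ^ 2 / N := by
  have hN' : (0 : ℝ) < N := by positivity
  have hpos : 0 < massIn m S := by linarith
  set e := edgeWeight m S p s with he
  set r : ℝ := (Sᶜ.card : ℝ) with hr
  have hr0 : 0 ≤ r := by positivity
  have hx0 : ∀ a : Finset (Fin N), 0 ≤ p ^ (a.card - 1) := fun a => pow_nonneg hp.1 _
  have hx1 : ∀ a : Finset (Fin N), p ^ (a.card - 1) ≤ 1 := fun a => pow_le_one₀ hp.1 hp.2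
  have hme : massIn m S * e = ∑ a, m a * (ind (s ∈ a) * p ^ (a.card - 1)) * ind (a ⊆ S) := by
    rw [he, edgeWeight, Finset.mul_sum]
    refine Finset.sum_congr rfl fun a _ => ?_
    rw [condIn]
    field_simp
  have he0 : 0 ≤ e := Finset.sum_nonneg fun a _ =>
    mul_nonneg (condIn_nonneg h.nonneg S a) (mul_nonneg (ind_nonneg _) (hx0 a))
  have hme_le : massIn m S * e ≤ w p / N := by
    rw [hme, ← h.edge s p]
    exact Finset.sum_le_sum fun a _ => mul_le_of_le_one_right
      (mul_nonneg (h.nonneg a) (mul_nonneg (ind_nonneg _) (hx0 a))) (ind_le_one _)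
  -- What is lost by restricting to choices inside `S` requires `s` and some forbidden slot to be
  -- used together. After multiplication by `N` this costs one of the three units `r * c ^ 2 / N`.
  have hme_ge : w p / N - massIn m S * e ≤ r * (c / N) ^ 2 := by
    rw [hme, ← h.edge s p, ← Finset.sum_sub_distrib]
    calc _ ≤ ∑ a, ∑ t ∈ Sᶜ, m a * (ind (s ∈ a) * ind (t ∈ a)) := by
          refine Finset.sum_le_sum fun a _ => ?_
          rw [← mul_one_sub, ← Finset.mul_sum, ← Finset.mul_sum, mul_assoc]
          refine mul_le_mul_of_nonneg_left ?_ (h.nonneg a)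
          rw [mul_assoc]
          refine mul_le_mul_of_nonneg_left ?_ (ind_nonneg _)
          refine le_trans ?_ (ind_subset_add_sum_ge S a)
          exact mul_le_of_le_one_left (sub_nonneg.mpr (ind_le_one _)) (hx1 a)
      _ ≤ ∑ t ∈ Sᶜ, (c / N) ^ 2 := by
          rw [Finset.sum_comm]
          refine Finset.sum_le_sum fun t ht => h.sum_mem_mem_le ?_
          rintro rfl
          exact Finset.mem_compl.mp ht hs
      _ = _ := by rw [Finset.sum_const, nsmul_eq_mul]
  have hw : w p ≤ c := by
    have : w p / N ≤ c / N := by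
      rw [← h.edge s p]
      refine le_trans (Finset.sum_le_sum fun a _ => ?_) (h.sum_mem_le s)
      exact mul_le_mul_of_nonneg_left (mul_le_of_le_one_right (ind_nonneg _) (hx1 a)) (h.nonneg a)
    exact (div_le_div_iff_of_pos_right hN').mp this
  have hNe : N * e ≤ 2 * c := by
    have h1 : massIn m S * e * N ≤ w p := by
      have := mul_le_mul_of_nonneg_right hme_le hN'.le
      rwa [div_mul_cancel₀ _ hN'.ne'] at this
    have h2 : 0 ≤ (massIn m S - 1 / 2) * (N * e) :=
      mul_nonneg (by linarith) (by positivity)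
    linarith
  have hmass := h.one_sub_massIn_le S
  rw [← hr] at hmass
  -- The normalisation by `massIn m S` costs the other two units, because `N * e` may be as large as
  -- `2 * c`.
  have h3 : (1 - massIn m S) * (N * e) ≤ r * (c / N) * (2 * c) := by
    refine mul_le_mul hmass hNe (by positivity) (by positivity)
  have h4 : 0 ≤ (1 - massIn m S) * (N * e) :=
    mul_nonneg (sub_nonneg.mpr (h.massIn_le_one S)) (by positivity)
  have h5 := mul_le_mul_of_nonneg_left hme_ge hN'.le
  have h6 := mul_le_mul_of_nonneg_left hme_le hN'.le
  have e1 : (N : ℝ) * (r * (c / N) ^ 2) = r * c ^ 2 / N := by field_simp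
  have e2 : (N : ℝ) * (w p / N) = w p := by field_simp
  have e3 : r * (c / N) * (2 * c) = 2 * (r * c ^ 2 / N) := by ring
  have e4 : 3 * r * c ^ 2 / N = 3 * (r * c ^ 2 / N) := by ring
  rw [mul_sub, e1, e2] at h5
  rw [e2] at h6
  rw [e3] at h3
  rw [e4]
  have h7 : 0 ≤ r * c ^ 2 / N := by positivity
  rw [abs_le]
  constructor <;> nlinarith

end UserWeights

end Weights

/-! ### The slot choices of an actual user. -/

section UserLaw

variable {N dmax : ℕ}

/-- The quotient is the product of `(d - j) / (N - j)` over `j < i`, and each factor is at most `d /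
N`. -/
lemma choose_div_choose_le {d N : ℕ} (hd : d ≤ N) (i : ℕ) (hi : i ≤ d) :
    ((N - i).choose (d - i) : ℝ) / N.choose d ≤ ((d : ℝ) / N) ^ i := by
  have hpos : (0 : ℝ) < N.choose d := by exact_mod_cast Nat.choose_pos hd
  rw [div_le_iff₀ hpos]
  induction i with
  | zero => simp
  | succ i ih =>
    have ih := ih (by omega)
    have hNi : N - i = (N - (i + 1)) + 1 := by omega
    have hdi : d - i = (d - (i + 1)) + 1 := by omega
    have key := Nat.add_one_mul_choose_eq (N - (i + 1)) (d - (i + 1))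
    rw [← hNi, ← hdi] at key
    have hN0 : (0 : ℝ) < N := by exact_mod_cast (show 0 < N by omega)
    have hNi0 : (0 : ℝ) < (N - i : ℕ) := by exact_mod_cast (show 0 < N - i by omega)
    have key' : ((N - i : ℕ) : ℝ) * ((N - (i + 1)).choose (d - (i + 1)) : ℝ) =
        ((N - i).choose (d - i) : ℝ) * ((d - i : ℕ) : ℝ) := by exact_mod_cast key
    have hratio : ((d - i : ℕ) : ℝ) * N ≤ d * ((N - i : ℕ) : ℝ) := by
      rw [Nat.cast_sub (by omega), Nat.cast_sub (by omega)]
      have : (d : ℝ) ≤ N := by exact_mod_cast hd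
      nlinarith [(Nat.cast_nonneg i : (0 : ℝ) ≤ i)]
    have : ((N - (i + 1)).choose (d - (i + 1)) : ℝ) ≤ (d / N : ℝ) * (N - i).choose (d - i) := by
      rw [← mul_le_mul_iff_right₀ hNi0, key', div_mul_eq_mul_div, mul_div_assoc', le_div_iff₀ hN0]
      nlinarith [(Nat.cast_nonneg ((N - i).choose (d - i)) : (0 : ℝ) ≤ _)]
    calc _ ≤ _ := this
      _ ≤ (d / N : ℝ) * ((d / N : ℝ) ^ i * N.choose d) := by gcongr
      _ = _ := by ring

/-- The probabilities of the possible slot choices of a user. -/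
def userWeight (π : ℝ≥0) (hπ : π ≤ 1) (Λ : PMF ℕ) (N : ℕ) (a : Finset (Fin N)) : ℝ :=
  (userLaw π hπ Λ N a).toReal

lemma slotChoice_apply {d : ℕ} (hd : d ≤ N) (a : Finset (Fin N)) :
    (slotChoice N d a).toReal = ind (a.card = d) / N.choose d := by
  have hne : (Finset.powersetCard d (Finset.univ : Finset (Fin N))).Nonempty := by
    rw [Finset.powersetCard_nonempty]; simpa using hd
  rw [slotChoice, dif_pos hne, PMF.uniformOfFinset_apply]
  by_cases h : a.card = d
  · rw [if_pos (by simpa [Finset.mem_powersetCard] using h), ind_true h]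
    simp
  · rw [if_neg (by simpa [Finset.mem_powersetCard] using h), ind_false h]
    simp

lemma userWeight_eq {π : ℝ≥0} (hπ : π ≤ 1) {Λ : PMF ℕ}
    (hΛ : ∀ d ∈ Λ.support, 1 ≤ d ∧ d ≤ dmax) (hN : dmax ≤ N) (a : Finset (Fin N)) :
    userWeight π hπ Λ N a = (1 - π) * ind (a = ∅) +
      π * ∑ d ∈ Finset.Icc 1 dmax, (Λ d).toReal * (ind (a.card = d) / N.choose d) := by
  have hsum : (Λ.bind fun d => slotChoice N d) a =
      ∑ d ∈ Finset.Icc 1 dmax, Λ d * slotChoice N d a := by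
    rw [PMF.bind_apply]
    refine tsum_eq_sum fun d hd => ?_
    have : Λ d = 0 := by
      by_contra h
      exact hd (Finset.mem_Icc.mpr (hΛ d ((PMF.mem_support_iff _ _).mpr h)))
    rw [this, zero_mul]
  have hfin : ∀ d, Λ d * slotChoice N d a ≠ ∞ := fun d =>
    ENNReal.mul_ne_top (PMF.apply_ne_top _ _) (PMF.apply_ne_top _ _)
  have hbind : userLaw π hπ Λ N a = π * (Λ.bind fun d => slotChoice N d) a +
      ((1 - π : ℝ≥0) : ℝ≥0∞) * (PMF.pure ∅ : PMF (Finset (Fin N))) a := by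
    rw [userLaw, PMF.bind_apply, tsum_bool]
    simp [activity, PMF.ofFintype_apply, add_comm]
  rw [userWeight, hbind, hsum, ENNReal.toReal_add, ENNReal.toReal_mul, ENNReal.toReal_mul,
    ENNReal.toReal_sum fun d _ => hfin d, add_comm]
  · congr 1
    · rw [PMF.pure_apply, ENNReal.coe_toReal, NNReal.coe_sub hπ]
      congr 1
      by_cases h : a = ∅ <;> simp [ind, h]
    · congr 1
      refine Finset.sum_congr rfl fun d hd => ?_
      rw [ENNReal.toReal_mul, slotChoice_apply ((Finset.mem_Icc.mp hd).2.trans hN)]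
  · exact ENNReal.mul_ne_top ENNReal.coe_ne_top (ENNReal.sum_ne_top.mpr fun d _ => hfin d)
  · exact ENNReal.mul_ne_top ENNReal.coe_ne_top (PMF.apply_ne_top _ _)

lemma sum_pmf_eq_one {Λ : PMF ℕ} (hΛ : ∀ d ∈ Λ.support, 1 ≤ d ∧ d ≤ dmax) :
    ∑ d ∈ Finset.Icc 1 dmax, (Λ d).toReal = 1 := by
  have h1 : ∑' d, Λ d = ∑ d ∈ Finset.Icc 1 dmax, Λ d := tsum_eq_sum fun d hd => by
    by_contra h
    exact hd (Finset.mem_Icc.mpr (hΛ d ((PMF.mem_support_iff _ _).mpr h)))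
  rw [Λ.tsum_coe] at h1
  rw [← ENNReal.toReal_sum fun d _ => PMF.apply_ne_top _ _, ← h1, ENNReal.toReal_one]

/-- Expectations of functions of the cardinality, restricted to the choices that contain `X`. -/
lemma sum_userWeight_mul {π : ℝ≥0} (hπ : π ≤ 1) {Λ : PMF ℕ}
    (hΛ : ∀ d ∈ Λ.support, 1 ≤ d ∧ d ≤ dmax) (hN : dmax ≤ N) (X : Finset (Fin N))
    (hX : X.Nonempty) (f : ℕ → ℝ) :
    ∑ a, userWeight π hπ Λ N a * (ind (X ⊆ a) * f a.card) =
      π * ∑ d ∈ Finset.Icc 1 dmax, (Λ d).toReal * (f d *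
        (if X.card ≤ d then ((N - X.card).choose (d - X.card) : ℝ) / N.choose d else 0)) := by
  have hcount : ∀ d, ∑ a : Finset (Fin N), ind (X ⊆ a) * ind (a.card = d) =
      if X.card ≤ d then ((N - X.card).choose (d - X.card) : ℝ) else 0 := by
    intro d
    have h1 : ∀ a : Finset (Fin N), ind (X ⊆ a) * ind (a.card = d) =
        if a ∈ (Finset.powersetCard d Finset.univ).filter (X ⊆ ·) then 1 else 0 := by
      intro a
      rw [← ind_and, ind]
      congr 1
      simp [Finset.mem_powersetCard, and_comm]
    simp_rw [h1]
    rw [Finset.sum_ite_mem, Finset.univ_inter, Finset.sum_const, nsmul_eq_mul, mul_one]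
    split_ifs with hd
    · rw [Finset.card_filter_powersetCard_subset _ _ _ (Finset.subset_univ X) hd, Finset.card_univ,
        Fintype.card_fin]
    · rw [Finset.filter_false_of_mem]
      · simp
      · intro a ha hXa
        rw [Finset.mem_powersetCard] at ha
        exact hd (ha.2 ▸ Finset.card_le_card hXa)
  have h0 : ∀ a : Finset (Fin N), ind (a = ∅) * ind (X ⊆ a) = 0 := by
    intro a
    rw [← ind_and]
    refine ind_false ?_
    rintro ⟨rfl, h⟩
    exact hX.ne_empty (Finset.subset_empty.mp h)
  calc _ = ∑ a : Finset (Fin N), ∑ d ∈ Finset.Icc 1 dmax, π * ((Λ d).toReal * (f d *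
        ((ind (X ⊆ a) * ind (a.card = d)) / N.choose d))) := by
        refine Finset.sum_congr rfl fun a _ => ?_
        rw [userWeight_eq hπ hΛ hN, add_mul, ← mul_assoc, mul_assoc (1 - (π : ℝ)), h0, mul_zero,
          zero_mul, zero_add, mul_assoc, Finset.sum_mul, Finset.mul_sum]
        refine Finset.sum_congr rfl fun d _ => ?_
        by_cases h : a.card = d
        · rw [h]; ring
        · rw [ind_false h]; ring
    _ = _ := by
        rw [Finset.sum_comm, Finset.mul_sum]
        refine Finset.sum_congr rfl fun d _ => ?_
        rw [← Finset.mul_sum, ← Finset.mul_sum, ← Finset.mul_sum, ← Finset.sum_div, hcount]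
        split_ifs <;> simp

/-- The mean number of edges of a user, weighted by `p` to the number of its other edges. -/
def edgeMean (π : ℝ≥0) (Λ : PMF ℕ) (dmax : ℕ) (p : ℝ) : ℝ :=
  π * ∑ d ∈ Finset.Icc 1 dmax, (Λ d).toReal * d * p ^ (d - 1)

/-- The condition `dmax ≤ N` keeps the default value of `slotChoice` out of play. Given its degree
`d`, a user hits a fixed slot with probability `d / N`; this is the identity `N * (N - 1).choose (d
- 1) = N.choose d * d`. -/
lemma userWeights_userWeight {π : ℝ≥0} (hπ : π ≤ 1) {Λ : PMF ℕ}
    (hΛ : ∀ d ∈ Λ.support, 1 ≤ d ∧ d ≤ dmax) (hN : dmax ≤ N) :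
    UserWeights (dmax : ℝ) dmax (edgeMean π Λ dmax) (userWeight π hπ Λ N) where
  nonneg a := ENNReal.toReal_nonneg
  sum_one := by
    simp only [userWeight]
    rw [← ENNReal.toReal_sum fun d _ => PMF.apply_ne_top _ _, ← tsum_fintype (L := .unconditional _),
      PMF.tsum_coe, ENNReal.toReal_one]
  card_le a ha := by
    by_contra hcard
    refine ha ?_
    rw [userWeight_eq hπ hΛ hN, Finset.sum_eq_zero, ind_false]
    · ring
    · rintro rfl; simp at hcard
    · intro d hd
      have h : a.card ≠ d := fun h => hcard (h ▸ (Finset.mem_Icc.mp hd).2)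
      rw [ind_false h]
      ring
  bound X _ := by
    rcases X.eq_empty_or_nonempty with rfl | hX
    · simp only [Finset.empty_subset, ind_true, mul_one, Finset.card_empty, pow_zero, userWeight]
      rw [← ENNReal.toReal_sum fun d _ => PMF.apply_ne_top _ _, ← tsum_fintype (L := .unconditional _),
        PMF.tsum_coe, ENNReal.toReal_one]
    · have := sum_userWeight_mul hπ hΛ hN X hX fun _ => 1
      simp only [mul_one, one_mul] at this
      rw [this]
      have hsum : ∑ d ∈ Finset.Icc 1 dmax, (Λ d).toReal *
          (if X.card ≤ d then ((N - X.card).choose (d - X.card) : ℝ) / N.choose d else 0) ≤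
          ∑ d ∈ Finset.Icc 1 dmax, (Λ d).toReal * ((dmax : ℝ) / N) ^ X.card := by
        refine Finset.sum_le_sum fun d hd => mul_le_mul_of_nonneg_left ?_ ENNReal.toReal_nonneg
        have hd' := (Finset.mem_Icc.mp hd).2
        split_ifs with h
        · refine (choose_div_choose_le (hd'.trans hN) _ h).trans ?_
          gcongr
        · positivity
      rw [← Finset.sum_mul, sum_pmf_eq_one hΛ, one_mul] at hsum
      refine (mul_le_of_le_one_left (Finset.sum_nonneg fun d _ => mul_nonneg
        ENNReal.toReal_nonneg ?_) (by exact_mod_cast hπ)).trans hsum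
      split_ifs <;> positivity
  edge s p := by
    have hN0 : (N : ℝ) ≠ 0 := by
      have := s.pos
      positivity
    have := sum_userWeight_mul hπ hΛ hN {s} (Finset.singleton_nonempty s) fun d => p ^ (d - 1)
    simp only [Finset.singleton_subset_iff, Finset.card_singleton] at this
    rw [this, edgeMean, mul_div_assoc, Finset.sum_div]
    congr 1
    refine Finset.sum_congr rfl fun d hd => ?_
    obtain ⟨h1, h2⟩ := Finset.mem_Icc.mp hd
    rw [if_pos h1]
    have hpos : (N.choose d : ℝ) ≠ 0 := by exact_mod_cast (Nat.choose_pos (h2.trans hN)).ne'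
    have key := Nat.add_one_mul_choose_eq (N - 1) (d - 1)
    rw [Nat.sub_add_cancel h1, Nat.sub_add_cancel s.pos] at key
    have key' : (N : ℝ) * (N - 1).choose (d - 1) = N.choose d * d := by exact_mod_cast key
    field_simp
    linear_combination (Λ d).toReal * p ^ (d - 1) * key'

end UserLaw

/-! ### The Poisson limit of binomial weights along an arbitrary filter. -/

section PoissonLimit

variable {α : Type*} {F : Filter α} {l : α → ℕ}

open Asymptotics in
lemma tendsto_choose_mul_pow {a : α → ℝ} {r : ℝ} (hl : Tendsto l F atTop)
    (h : Tendsto (fun x => l x * a x) F (𝓝 r)) (j : ℕ) :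
    Tendsto (fun x => ((l x).choose j : ℝ) * a x ^ j) F (𝓝 (r ^ j / j.factorial)) := by
  have : (fun x => ((l x).choose j : ℝ) * a x ^ j) ~[F]
      (fun x => ((l x * a x) ^ j) / j.factorial) :=
    calc
    _ ~[F] (fun x => ((l x : ℝ) ^ j / j.factorial) * a x ^ j) :=
      ((isEquivalent_choose j).comp_tendsto hl).mul IsEquivalent.refl
    _ ~[F] _ := EventuallyEq.isEquivalent (.of_eq (by ext; field))
  exact (IsEquivalent.tendsto_nhds_iff this).mpr ((h.pow j).div_const _)

lemma tendsto_zero_of_tendsto_natCast_mul {b : α → ℝ} {β : ℝ} (hl : Tendsto l F atTop)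
    (h : Tendsto (fun x => l x * b x) F (𝓝 β)) : Tendsto b F (𝓝 0) := by
  have hl' : Tendsto (fun x => (l x : ℝ)) F atTop := tendsto_natCast_atTop_atTop.comp hl
  have := h.mul (tendsto_inv_atTop_zero.comp hl')
  rw [mul_zero] at this
  refine this.congr' ?_
  filter_upwards [hl.eventually_gt_atTop 0] with x hx
  have : (l x : ℝ) ≠ 0 := by positivity
  simp only [Function.comp]
  field_simp

/-- The logarithm of `1 + b` is squeezed between `b / (1 + b)` and `b`, which is valid for either
sign of `b`. The shift by `j` disappears since `b` tends to zero. -/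
lemma tendsto_one_add_pow_exp {b : α → ℝ} {β : ℝ} (hl : Tendsto l F atTop)
    (h : Tendsto (fun x => l x * b x) F (𝓝 β)) (j : ℕ) :
    Tendsto (fun x => (1 + b x) ^ (l x - j)) F (𝓝 (Real.exp β)) := by
  have hb := tendsto_zero_of_tendsto_natCast_mul hl h
  have h1 : Tendsto (fun x => 1 + b x) F (𝓝 1) := by simpa using hb.const_add 1
  have hlj : Tendsto (fun x => ((l x - j : ℕ) : ℝ) * b x) F (𝓝 β) := by
    have : Tendsto (fun x => l x * b x - j * b x) F (𝓝 (β - j * 0)) := h.sub (hb.const_mul _)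
    rw [mul_zero, sub_zero] at this
    refine this.congr' ?_
    filter_upwards [hl.eventually_ge_atTop j] with x hx
    rw [Nat.cast_sub hx]; ring
  have hlow : Tendsto (fun x => ((l x - j : ℕ) : ℝ) * b x * (1 + b x)⁻¹) F (𝓝 β) := by
    simpa using hlj.mul (h1.inv₀ one_ne_zero)
  have hpos : ∀ᶠ x in F, 0 < 1 + b x := h1.eventually (lt_mem_nhds one_pos)
  have hlog : Tendsto (fun x => ((l x - j : ℕ) : ℝ) * Real.log (1 + b x)) F (𝓝 β) := by
    refine tendsto_of_tendsto_of_tendsto_of_le_of_le' hlow hlj ?_ ?_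
    · filter_upwards [hpos] with x hx
      rw [mul_assoc]
      refine mul_le_mul_of_nonneg_left ?_ (Nat.cast_nonneg _)
      have := Real.one_sub_inv_le_log_of_pos hx
      refine le_trans (le_of_eq ?_) this
      field_simp
      ring
    · filter_upwards [hpos] with x hx
      refine mul_le_mul_of_nonneg_left ?_ (Nat.cast_nonneg _)
      linarith [Real.log_le_sub_one_of_pos hx]
  refine ((Real.continuous_exp.tendsto β).comp hlog).congr' ?_
  filter_upwards [hpos] with x hx
  simp only [Function.comp]
  rw [← Real.log_pow, Real.exp_log (pow_pos hx _)]

end PoissonLimit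

/-! ### Asymptotic ensembles and the limiting decoding probability. -/

/-- A sequence of random frames of growing size, with slot decoders given by random tables. -/
structure Ensemble where
  /-- number of users -/
  K : ℕ → ℕ
  /-- number of slots -/
  N : ℕ → ℕ
  /-- weights of the slot choices -/
  m : ∀ n, Finset (Fin (N n)) → ℝ
  /-- decoder tables -/
  Ω : ℕ → Type
  fin : ∀ n, Fintype (Ω n)
  /-- decoding according to a table -/
  D : ∀ n, Ω n → ℕ → ℕ → Prop
  /-- weights of the tables -/
  ν : ∀ n, Ω n → ℝ
  /-- reception capability -/
  T : ℕ
  /-- error probabilities -/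
  PE : ℕ → ℝ
  /-- cancellation efficiency -/
  γ : ℝ
  /-- sparsity constant -/
  c : ℝ
  /-- maximal number of edges of a user -/
  d : ℕ
  /-- weighted mean number of edges of a user -/
  w : ℝ → ℝ
  /-- limiting number of users per slot -/
  κ : ℝ
  tendsto_N : Tendsto N atTop atTop
  tendsto_ratio : Tendsto (fun n => (K n : ℝ) / N n) atTop (𝓝 κ)
  κ_pos : 0 < κ
  c_nonneg : 0 ≤ c
  weights : ∀ᶠ n in atTop, UserWeights c d w (m n)
  ν_nonneg : ∀ n ω, 0 ≤ ν n ω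
  ν_sum : ∀ n, ∑ ω, ν n ω = 1
  PE_mem : ∀ t ∈ Finset.Icc 1 T, PE t ∈ Set.Icc (0 : ℝ) 1
  γ_nonneg : 0 ≤ γ
  γ_le_one : γ ≤ 1
  success : ∀ n k j, j ≤ k → k ≤ K n →
    ∑ ω, ν n ω * ind (D n ω (k + 1) (1 + j)) = successProb T PE γ k j

attribute [instance] Ensemble.fin

namespace Ensemble

variable (M : Ensemble)

/-- The density evolution map. -/
def step (p : ℝ) : ℝ :=
  1 - ∑ j ∈ Finset.range M.T, (1 - M.PE (j + 1)) * ((M.κ * M.w p) ^ j / j.factorial *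
    Real.exp (-(M.κ * M.w 1) + M.γ * (M.κ * M.w 1 - M.κ * M.w p)))

/-- The density evolution of the cavity messages. -/
def evol : ℕ → ℝ
  | 0 => 1
  | ℓ + 1 => M.step (evol ℓ)

lemma isLaw_ν (n : ℕ) : IsLaw (fun (_ : Fin (M.N n)) => M.ν n) where
  nonneg _ := M.ν_nonneg n
  sum_one _ := M.ν_sum n

lemma tendsto_natCast_N : Tendsto (fun n => (M.N n : ℝ)) atTop atTop :=
  tendsto_natCast_atTop_atTop.comp M.tendsto_N

lemma eventually_div_le (C : ℝ) {ε : ℝ} (hε : 0 < ε) : ∀ᶠ n in atTop, C / M.N n ≤ ε := by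
  have : Tendsto (fun n => C / M.N n) atTop (𝓝 0) := M.tendsto_natCast_N.const_div_atTop C
  exact (this.eventually (gt_mem_nhds hε)).mono fun n hn => le_of_lt hn

lemma eventually_K_le : ∀ᶠ n in atTop, (M.K n : ℝ) ≤ (M.κ + 1) * M.N n := by
  filter_upwards [M.tendsto_ratio.eventually (gt_mem_nhds (lt_add_one M.κ)),
    M.tendsto_N.eventually_gt_atTop 0] with n hn hN
  have : (0 : ℝ) < M.N n := by positivity
  exact (div_le_iff₀ this).mp hn.le

lemma eventually_massIn (r : ℕ) : ∀ᶠ n in atTop, ∀ S : Finset (Fin (M.N n)), Sᶜ.card ≤ r →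
    1 / 2 ≤ massIn (M.m n) S := by
  filter_upwards [M.weights, M.eventually_div_le (r * M.c) (by norm_num : (0 : ℝ) < 1 / 2)]
    with n hm hn S hS
  have h1 := hm.one_sub_massIn_le S
  have h2 : (Sᶜ.card : ℝ) * (M.c / M.N n) ≤ r * M.c / M.N n := by
    rw [← mul_div_assoc]
    have := M.c_nonneg
    gcongr
  linarith

lemma w_mem {p : ℝ} (hp : p ∈ Set.Icc (0 : ℝ) 1) : 0 ≤ M.w p ∧ M.w p ≤ M.w 1 := by
  obtain ⟨n, hm, hN⟩ := (M.weights.and (M.tendsto_N.eventually_gt_atTop 0)).exists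
  have hN' : (0 : ℝ) < M.N n := by positivity
  have h1 := hm.edge ⟨0, hN⟩
  constructor
  · have : 0 ≤ M.w p / M.N n := by
      rw [← h1 p]
      exact Finset.sum_nonneg fun a _ => mul_nonneg (hm.nonneg a)
        (mul_nonneg (ind_nonneg _) (pow_nonneg hp.1 _))
    simpa [div_mul_cancel₀ _ hN'.ne'] using mul_nonneg this hN'.le
  · rw [← div_le_div_iff_of_pos_right hN', ← h1 p, ← h1 1]
    refine Finset.sum_le_sum fun a _ => mul_le_mul_of_nonneg_left ?_ (hm.nonneg a)
    refine mul_le_mul_of_nonneg_left ?_ (ind_nonneg _)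
    rw [one_pow]
    exact pow_le_one₀ hp.1 hp.2

/-- The sum is a truncated series of `exp x`, and since `γ ≤ 1` the exponent is at most `-x`, so the
total decoding probability does not exceed one. -/
lemma step_mem {p : ℝ} (hp : p ∈ Set.Icc (0 : ℝ) 1) : M.step p ∈ Set.Icc (0 : ℝ) 1 := by
  obtain ⟨hw0, hw1⟩ := M.w_mem hp
  have hκ := M.κ_pos
  set x := M.κ * M.w p with hx
  set y := M.κ * M.w 1 with hy
  have hx0 : 0 ≤ x := by positivity
  have hxy : x ≤ y := mul_le_mul_of_nonneg_left hw1 hκ.le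
  have hPE : ∀ j ∈ Finset.range M.T, M.PE (j + 1) ∈ Set.Icc (0 : ℝ) 1 := fun j hj =>
    M.PE_mem _ (Finset.mem_Icc.mpr ⟨by omega, by simpa using hj⟩)
  have hnn : ∀ j, 0 ≤ x ^ j / j.factorial * Real.exp (-y + M.γ * (y - x)) := fun j => by positivity
  constructor
  · rw [step, sub_nonneg]
    calc _ ≤ ∑ j ∈ Finset.range M.T, x ^ j / j.factorial * Real.exp (-y + M.γ * (y - x)) :=
          Finset.sum_le_sum fun j hj => mul_le_of_le_one_left (hnn j) (by linarith [(hPE j hj).1])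
      _ ≤ Real.exp x * Real.exp (-x) := by
          rw [← Finset.sum_mul]
          refine mul_le_mul (Real.sum_le_exp_of_nonneg hx0 _) (Real.exp_le_exp.mpr ?_)
            (Real.exp_pos _).le (Real.exp_pos _).le
          nlinarith [M.γ_le_one]
      _ = 1 := by rw [← Real.exp_add, add_neg_cancel, Real.exp_zero]
  · rw [step]
    have : 0 ≤ ∑ j ∈ Finset.range M.T, (1 - M.PE (j + 1)) * (x ^ j / j.factorial *
        Real.exp (-y + M.γ * (y - x))) :=
      Finset.sum_nonneg fun j hj => mul_nonneg (by linarith [(hPE j hj).2]) (hnn j)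
    linarith

lemma evol_mem (ℓ : ℕ) : M.evol ℓ ∈ Set.Icc (0 : ℝ) 1 := by
  induction ℓ with
  | zero => simp [evol]
  | succ ℓ ih => exact M.step_mem ih

/-- Uniformly over exploration states with few removed users and slots, the edge weights converge. -/
lemma tendsto_edgeWeight {α : Type*} {F : Filter α} (f : α → ℕ) (hf : Tendsto f F atTop)
    (S : ∀ x, Finset (Fin (M.N (f x)))) (s : ∀ x, Fin (M.N (f x))) (r : ℕ)
    (hS : ∀ᶠ x in F, (S x)ᶜ.card ≤ r) (hs : ∀ᶠ x in F, s x ∈ S x) {p : ℝ}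
    (hp : p ∈ Set.Icc (0 : ℝ) 1) :
    Tendsto (fun x => (M.N (f x) : ℝ) * edgeWeight (M.m (f x)) (S x) p (s x)) F (𝓝 (M.w p)) := by
  rw [tendsto_iff_norm_sub_tendsto_zero]
  have h0 : Tendsto (fun x => 3 * r * M.c ^ 2 / (M.N (f x) : ℝ)) F (𝓝 0) :=
    (M.tendsto_natCast_N.comp hf).const_div_atTop _
  refine squeeze_zero' (Eventually.of_forall fun _ => norm_nonneg _) ?_ h0
  filter_upwards [hS, hs, hf.eventually M.weights, hf.eventually (M.eventually_massIn r),
    hf.eventually (M.tendsto_N.eventually_gt_atTop 0)] with x h1 h2 h3 h4 h5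
  rw [Real.norm_eq_abs]
  refine (h3.abs_edgeWeight_sub_le M.c_nonneg h5 (h4 _ h1) h2 hp).trans ?_
  gcongr

lemma eventually_decode (r : ℕ) {p ε : ℝ} (hp : p ∈ Set.Icc (0 : ℝ) 1) (hε : 0 < ε) :
    ∀ᶠ n in atTop, ∀ (L : Finset (Fin (M.K n))) (S : Finset (Fin (M.N n))) (s : Fin (M.N n)),
      Lᶜ.card ≤ r → Sᶜ.card ≤ r → s ∈ S →
      |(1 - pexp (live (M.m n) L S) fun A => decodeProb (successProb M.T M.PE M.γ) p A s) -
        M.step p| ≤ ε := by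
  -- Uniformity over states is encoded as convergence along one filter: the index consists of `n`
  -- together with `L`, `S` and `s`, the filter sends `n` to infinity and keeps the state
  -- admissible.
  let α := Σ n, Finset (Fin (M.K n)) × Finset (Fin (M.N n)) × Fin (M.N n)
  let F : Filter α := comap Sigma.fst atTop ⊓
    𝓟 {x | x.2.1ᶜ.card ≤ r ∧ x.2.2.1ᶜ.card ≤ r ∧ x.2.2.2 ∈ x.2.2.1}
  have hf : Tendsto (fun x : α => x.1) F atTop := tendsto_comap.mono_left inf_le_left
  have hgood : ∀ᶠ x : α in F, x.2.1ᶜ.card ≤ r ∧ x.2.2.1ᶜ.card ≤ r ∧ x.2.2.2 ∈ x.2.2.1 :=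
    mem_inf_of_right (mem_principal_self _)
  have hN : Tendsto (fun x : α => (M.N x.1 : ℝ)) F atTop := M.tendsto_natCast_N.comp hf
  have hratio : Tendsto (fun x : α => (x.2.1.card : ℝ) / M.N x.1) F (𝓝 M.κ) := by
    have h0 : Tendsto (fun x : α => (r : ℝ) / M.N x.1) F (𝓝 0) := hN.const_div_atTop _
    have h1 : Tendsto (fun x : α => (M.K x.1 : ℝ) / M.N x.1) F (𝓝 M.κ) := M.tendsto_ratio.comp hf
    have h2 := h1.sub h0
    rw [sub_zero] at h2
    refine tendsto_of_tendsto_of_tendsto_of_le_of_le' h2 h1 ?_ ?_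
    · filter_upwards [hgood] with x hx
      rw [← sub_div]
      gcongr
      have h3 := Finset.card_add_card_compl x.2.1
      rw [Fintype.card_fin] at h3
      have : (M.K x.1 : ℝ) ≤ x.2.1.card + r := by exact_mod_cast (by omega)
      linarith
    · refine Eventually.of_forall fun x => ?_
      gcongr
      simpa using Finset.card_le_univ x.2.1
  have hl : Tendsto (fun x : α => x.2.1.card) F atTop := by
    rw [← tendsto_natCast_atTop_iff (R := ℝ)]
    refine (hratio.pos_mul_atTop M.κ_pos hN).congr' ?_
    filter_upwards [hN.eventually_gt_atTop 0] with x hx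
    field_simp
  have hla : ∀ q ∈ Set.Icc (0 : ℝ) 1, Tendsto (fun x : α => (x.2.1.card : ℝ) *
      edgeWeight (M.m x.1) x.2.2.1 q x.2.2.2) F (𝓝 (M.κ * M.w q)) := by
    intro q hq
    refine (hratio.mul (M.tendsto_edgeWeight (fun x : α => x.1) hf (fun x => x.2.2.1)
      (fun x => x.2.2.2) r (hgood.mono fun x hx => hx.2.1) (hgood.mono fun x hx => hx.2.2)
        hq)).congr' ?_
    filter_upwards [hN.eventually_gt_atTop 0] with x hx
    field_simp
  have h1 := hla 1 (by simp)
  have hp' := hla p hp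
  have hlb := h1.neg.add ((h1.sub hp').const_mul M.γ)
  have hmain : Tendsto (fun x : α => 1 - pexp (live (M.m x.1) x.2.1 x.2.2.1) fun A =>
      decodeProb (successProb M.T M.PE M.γ) p A x.2.2.2) F (𝓝 (M.step p)) := by
    have hsum : Tendsto (fun x : α => 1 - ∑ j ∈ Finset.range M.T, (1 - M.PE (j + 1)) *
        ((x.2.1.card.choose j : ℝ) * edgeWeight (M.m x.1) x.2.2.1 p x.2.2.2 ^ j *
        (1 + (-edgeWeight (M.m x.1) x.2.2.1 1 x.2.2.2 +
          M.γ * (edgeWeight (M.m x.1) x.2.2.1 1 x.2.2.2 -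
            edgeWeight (M.m x.1) x.2.2.1 p x.2.2.2))) ^ (x.2.1.card - j))) F (𝓝 (M.step p)) := by
      refine (tendsto_finsetSum _ fun j _ => Tendsto.const_mul _
        ((tendsto_choose_mul_pow hl hp' j).mul (tendsto_one_add_pow_exp hl ?_ j))).const_sub 1
      refine hlb.congr fun x => ?_
      ring
    refine hsum.congr' ?_
    filter_upwards [hgood, hf.eventually (M.eventually_massIn r)] with x hx hmass
    have := hmass _ hx.2.1
    rw [pexp_decodeProb (by linarith)]
    congr 1
    refine Finset.sum_congr rfl fun j _ => ?_
    ring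
  have hev := hmain.eventually (Metric.closedBall_mem_nhds _ hε)
  rw [eventually_inf_principal, eventually_comap] at hev
  filter_upwards [hev] with n hn L S s hL hS hs
  have := hn ⟨n, L, S, s⟩ rfl ⟨hL, hS, hs⟩
  rwa [Real.dist_eq] at this

end Ensemble

/-! ### Probabilities of bad exploration outcomes. -/

lemma ind_exists_mem_le {α : Type*} (s : Finset α) (P : α → Prop) :
    ind (∃ a ∈ s, P a) ≤ ∑ a ∈ s, ind (P a) := by
  by_cases h : ∃ a ∈ s, P a
  · obtain ⟨a, ha, hP⟩ := h
    calc ind (∃ a ∈ s, P a) ≤ 1 := ind_le_one _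
      _ = ind (P a) := (ind_true hP).symm
      _ ≤ _ := Finset.single_le_sum (f := fun a => ind (P a)) (fun i _ => ind_nonneg (P i)) ha
  · rw [ind_false h]
    exact Finset.sum_nonneg fun i _ => ind_nonneg _

/-- The exploration of a slot rarely closes a cycle or meets given slots. -/
lemma exists_pr_entangled_le {c κ : ℝ} (hc : 0 ≤ c) (hκ : 0 ≤ κ) (ℓ r : ℕ) : ∃ C : ℝ, 0 ≤ C ∧
    ∀ (K N : ℕ) (μ : Fin K → Finset (Fin N) → ℝ), Sparse c μ → 0 < N → (K : ℝ) ≤ κ * N →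
      ∀ s (Z : Finset (Fin N)), Z.card ≤ r → pr μ (fun A => Entangled ℓ A s Z) ≤ C / N := by
  obtain ⟨D, hD, hcyc⟩ := exists_pr_hasCycle_le hc hκ (ℓ + 1)
  obtain ⟨C, hC, hconn⟩ := exists_pr_conn_le hc hκ (ℓ + 1)
  refine ⟨D + r * (κ * c ^ 2 * (1 + C)), by positivity, fun K N μ hμ hN hK s Z hZ => ?_⟩
  refine (pr_or_le hμ.toIsLaw _ _).trans ?_
  rw [add_div]
  refine add_le_add (hcyc K N μ hμ hN hK s) ?_
  refine (hμ.pexp_mono fun A => ind_exists_mem_le Z _).trans ?_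
  rw [pexp_sum]
  calc _ ≤ ∑ _t ∈ Z, κ * c ^ 2 * (1 + C) / N := Finset.sum_le_sum fun t _ =>
        hμ.pr_branch_le hN hK hC (fun A y => Conn (ℓ + 1) A t y) s t fun w y hy =>
          hconn K N _ (hμ.delLaw hc {w}) hN hK t y hy.symm
    _ = Z.card * (κ * c ^ 2 * (1 + C) / N) := by rw [Finset.sum_const, nsmul_eq_mul]
    _ ≤ r * (κ * c ^ 2 * (1 + C) / N) := by gcongr
    _ = _ := by ring

/-- Slots rarely have many users. -/
lemma Sparse.pr_card_slotUsers_le {K N : ℕ} {c κ : ℝ} {μ : Fin K → Finset (Fin N) → ℝ}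
    (hμ : Sparse c μ) (hc : 0 ≤ c) (hN : 0 < N) (hK : (K : ℝ) ≤ κ * N) (s : Fin N) (k₀ : ℕ) :
    pr μ (fun A => k₀ < (slotUsers A s).card) ≤ κ * c / (k₀ + 1) := by
  have hN' : (0 : ℝ) < N := by positivity
  rw [le_div_iff₀ (by positivity), pr, ← pexp_mul_const]
  calc _ ≤ pexp μ (fun A => ∑ v, ind (s ∈ A v)) := by
        refine hμ.pexp_mono fun A => ?_
        have hcard : ∑ v, ind (s ∈ A v) = (slotUsers A s).card := by
          rw [slotUsers, Finset.card_filter]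
          push_cast
          refine Finset.sum_congr rfl fun v _ => ?_
          by_cases h : s ∈ A v <;> simp [ind, h]
        rw [hcard]
        by_cases h : k₀ < (slotUsers A s).card
        · rw [ind_true h, one_mul]
          exact_mod_cast h
        · rw [ind_false h, zero_mul]
          positivity
    _ = ∑ v, ∑ a, μ v a * ind (s ∈ a) := by
        rw [pexp_sum]
        exact Finset.sum_congr rfl fun v _ => hμ.pexp_coord v fun a => ind (s ∈ a)
    _ ≤ ∑ _v : Fin K, c / N := Finset.sum_le_sum fun v _ => by
        simpa [Finset.singleton_subset_iff] using hμ.bound v {s} (by simp)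
    _ = K * (c / N) := by simp
    _ ≤ κ * N * (c / N) := by gcongr
    _ = κ * c := by field_simp

/-! ### Convergence of the joint moments by double induction. -/

namespace Ensemble

variable (M : Ensemble)

/-- The moments of order `j` at level `ℓ + 1` and of any order at level `ℓ` converge, uniformly over
exploration states with few removed users and slots. -/
def MomentsConverge (ℓ j : ℕ) : Prop :=
  ∀ r : ℕ, ∀ ε : ℝ, 0 < ε → ∀ᶠ n in atTop, ∀ (L : Finset (Fin (M.K n)))
    (S X Y : Finset (Fin (M.N n))), Lᶜ.card ≤ r → Sᶜ.card ≤ r → X ⊆ S → Y ⊆ S → Disjoint X Y →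
    X.card = j → Y.card ≤ r →
    |cavMoment (M.D n) (fun _ => M.ν n) (live (M.m n) L S) ℓ X Y -
      M.evol (ℓ + 1) ^ X.card * M.evol ℓ ^ Y.card| ≤ ε

/-- Messages of level zero are always true, and `evol 0 = 1`. -/
lemma momentsConverge_zero_zero : M.MomentsConverge 0 0 := by
  intro r ε hε
  filter_upwards [M.weights, M.eventually_massIn r] with n hm hmass L S X Y _ hS _ _ _ hX _
  rw [Finset.card_eq_zero] at hX
  subst hX
  have hlaw := isLaw_live hm.nonneg L (S := S) (by linarith [hmass S hS])
  have : cavMoment (M.D n) (fun _ => M.ν n) (live (M.m n) L S) 0 ∅ Y = 1 := by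
    simp only [cavMoment, Finset.prod_empty, one_mul, cav, ind_true, Finset.prod_const_one,
      (M.isLaw_ν n).pexp_one, hlaw.pexp_one]
  rw [this]
  simpa [evol] using hε.le

/-- Slots of level `ℓ + 1` may be read either as the lower set of the pair `(ℓ + 1, ℓ + 2)` or as
the upper set of the pair `(ℓ, ℓ + 1)`. Only the orders up to `r` occur, so finitely many hypotheses
are combined. -/
lemma momentsConverge_succ_zero {ℓ : ℕ} (h : ∀ j, M.MomentsConverge ℓ j) :
    M.MomentsConverge (ℓ + 1) 0 := by
  intro r ε hε
  have h' : ∀ᶠ n in atTop, ∀ j ∈ Finset.range (r + 1), ∀ (L : Finset (Fin (M.K n)))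
    (S X Y : Finset (Fin (M.N n))), Lᶜ.card ≤ r → Sᶜ.card ≤ r → X ⊆ S → Y ⊆ S → Disjoint X Y →
    X.card = j → Y.card ≤ r →
    |cavMoment (M.D n) (fun _ => M.ν n) (live (M.m n) L S) ℓ X Y -
      M.evol (ℓ + 1) ^ X.card * M.evol ℓ ^ Y.card| ≤ ε := by
    rw [Filter.eventually_all_finset]
    exact fun j _ => h j r ε hε
  filter_upwards [h'] with n hn L S X Y hL hS _ hYS _ hX hY
  rw [Finset.card_eq_zero] at hX
  subst hX
  have := hn Y.card (by rw [Finset.mem_range]; omega) L S Y ∅ hL hS hYS (by simp) (by simp) rfl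
    (by simp)
  simpa [cavMoment] using this

/-- One slot of the higher level is explored. It is traded for at most `k₀ * d` slots of the lower
level, at the price of removing that slot and at most `k₀` users; hence the order at the lower level
must be unrestricted in the hypothesis. -/
lemma momentsConverge_succ {ℓ j : ℕ} (h : M.MomentsConverge ℓ j) :
    M.MomentsConverge ℓ (j + 1) := by
  intro r ε hε
  have hc2 : 0 ≤ 2 * M.c := mul_nonneg (by norm_num) M.c_nonneg
  have hκ1 : 0 ≤ M.κ + 1 := by linarith [M.κ_pos]
  -- By Markov's inequality a slot then has more than `k₀` users with probability at most `ε / 5`.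
  obtain ⟨k₀, hk₀⟩ := exists_nat_gt ((M.κ + 1) * (2 * M.c) / (ε / 5))
  obtain ⟨C, hC, hent⟩ := exists_pr_entangled_le hc2 hκ1 ℓ (j + r)
  have h4 : (0 : ℝ) < 4 ^ k₀ := by positivity
  -- The enlarged radius covers the removed users, the removed slots and the new lower set at once.
  -- The five shares of `ε` pay for the conditional moments, the moment without `s`, entanglement,
  -- crowded slots and the limit of the decoding probability.
  filter_upwards [h (r + 1 + k₀ + k₀ * M.d) (ε / 5 / 4 ^ k₀) (by positivity), h r (ε / 5) (by positivity),
    M.weights, M.eventually_massIn (r + 1), M.eventually_K_le, M.tendsto_N.eventually_gt_atTop 0,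
    M.eventually_div_le (2 * C) (show 0 < ε / 5 by positivity),
    M.eventually_decode r (M.evol_mem ℓ) (show 0 < ε / 5 by positivity)]
    with n hmom1 hmom2 hm hmass hK hN hCN hdec L S X Y hL hS hXS hYS hXY hX hY
  obtain ⟨s, X', hsX', rfl, hX'⟩ := Finset.card_eq_succ.mp hX
  have hsS : s ∈ S := hXS (Finset.mem_insert_self _ _)
  have hsY : s ∉ Y := Finset.disjoint_left.mp hXY (Finset.mem_insert_self _ _)
  have hXY' : Disjoint X' Y := Finset.disjoint_of_subset_left (Finset.subset_insert _ _) hXY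
  have hXS' : X' ⊆ S := (Finset.subset_insert _ _).trans hXS
  have hcard_erase : (S.erase s)ᶜ.card ≤ r + 1 := by
    rw [Finset.compl_erase]
    exact (Finset.card_insert_le _ _).trans (by omega)
  have hm1 := hmass S (by omega)
  have hm2 := hmass (S.erase s) hcard_erase
  have hsp := hm.sparse_live M.c_nonneg L hm1
  have hstep := abs_cavMoment_insert_sub_le (M.isLaw_ν n) hm.nonneg hm.card_le (s := s)
    (successProb_mem M.PE_mem M.γ_nonneg M.γ_le_one) (M.success n) (by linarith) (by linarith) L
    (ℓ := ℓ) hsX' hsY hXY' hYS (M.evol_mem ℓ) (M.evol_mem (ℓ + 1))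
    (show 0 ≤ ε / 5 / 4 ^ k₀ by positivity) k₀ (by
      intro V hV Z hZ hXZ hZc
      refine hmom1 (L \ V) (S.erase s) X' Z ?_ ?_ ?_ hZ hXZ hX' ?_
      · have : (L \ V)ᶜ ⊆ Lᶜ ∪ V := by
          intro v hv
          simp only [Finset.mem_compl, Finset.mem_sdiff, Finset.mem_union] at hv ⊢
          tauto
        have := (Finset.card_le_card this).trans (Finset.card_union_le _ _)
        omega
      · omega
      · exact fun x hx => Finset.mem_erase.mpr ⟨fun h => hsX' (h ▸ hx), hXS' hx⟩
      · omega)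
  have hE := hent _ _ _ hsp hN hK s (X' ∪ Y) ((Finset.card_union_le _ _).trans (by omega))
  have hV := hsp.pr_card_slotUsers_le hc2 hN hK s k₀
  have hV' : (M.κ + 1) * (2 * M.c) / (k₀ + 1) ≤ ε / 5 := by
    rw [div_lt_iff₀ (by positivity)] at hk₀
    rw [div_le_iff₀ (by positivity)]
    nlinarith
  have hmom := hmom2 L S X' Y hL hS hXS' hYS hXY' hX' hY
  have hd := hdec L S s hL hS hsS
  have hψ0 : 0 ≤ M.evol (ℓ + 1) ^ X'.card * M.evol ℓ ^ Y.card :=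
    mul_nonneg (pow_nonneg (M.evol_mem _).1 _) (pow_nonneg (M.evol_mem _).1 _)
  have hψ1 : M.evol (ℓ + 1) ^ X'.card * M.evol ℓ ^ Y.card ≤ 1 :=
    mul_le_one₀ (pow_le_one₀ (M.evol_mem _).1 (M.evol_mem _).2) (pow_nonneg (M.evol_mem _).1 _)
      (pow_le_one₀ (M.evol_mem _).1 (M.evol_mem _).2)
  set ψ := M.evol (ℓ + 1) ^ X'.card * M.evol ℓ ^ Y.card with hψ
  have hlast : |(1 - pexp (live (M.m n) L S) fun A =>
      decodeProb (successProb M.T M.PE M.γ) (M.evol ℓ) A s) * ψ -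
        M.evol (ℓ + 1) ^ (insert s X').card * M.evol ℓ ^ Y.card| ≤ ε / 5 := by
    rw [Finset.card_insert_of_notMem hsX', pow_succ, mul_right_comm, ← hψ, mul_comm ψ,
      ← sub_mul, abs_mul, abs_of_nonneg hψ0]
    exact (mul_le_of_le_one_right (abs_nonneg _) hψ1).trans hd
  have h5 : (4 : ℝ) ^ k₀ * (ε / 5 / 4 ^ k₀) = ε / 5 := by field_simp
  rw [h5] at hstep
  have h2C : 2 * pr (live (M.m n) L S) (fun A => Entangled ℓ A s (X' ∪ Y)) ≤ ε / 5 := by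
    refine le_trans ?_ hCN
    rw [mul_div_assoc]
    linarith
  refine (abs_sub_le _ _ _).trans ((add_le_add hstep hlast).trans ?_)
  linarith

/-- Convergence of all joint moments of cavity messages. -/
lemma momentsConverge (ℓ j : ℕ) : M.MomentsConverge ℓ j := by
  have key : ∀ ℓ, M.MomentsConverge ℓ 0 → ∀ j, M.MomentsConverge ℓ j := by
    intro ℓ h0 j
    induction j with
    | zero => exact h0
    | succ j ih => exact M.momentsConverge_succ ih
  induction ℓ generalizing j with
  | zero => exact key 0 M.momentsConverge_zero_zero j
  | succ ℓ ih => exact key (ℓ + 1) (M.momentsConverge_succ_zero ih) j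

end Ensemble

/-! ### Edge fractions and edges with cyclic surroundings. -/

section EdgeFraction

variable {K N : ℕ}

lemma edgeFraction_eq (A : Fin K → Finset (Fin N)) (m : Fin K → Fin N → Prop) :
    edgeFraction A m =
      (∑ u, ∑ s, ind (s ∈ A u) * ind (m u s)) / ∑ u, ((A u).card : ℝ) := by
  classical
  have hnum : (((edges A).filter fun e => m e.1 e.2).card : ℝ) =
      ∑ u, ∑ s, ind (s ∈ A u) * ind (m u s) := by
    rw [Finset.card_filter, edges, Finset.sum_sigma]
    push_cast
    refine Finset.sum_congr rfl fun u _ => ?_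
    rw [← Finset.sum_subset (Finset.subset_univ (A u))]
    · refine Finset.sum_congr rfl fun s hs => ?_
      rw [ind_true hs, one_mul]
      by_cases h : m u s <;> simp [ind, h]
    · intro s _ hs
      rw [ind_false hs, zero_mul]
  have hden : ((edges A).card : ℝ) = ∑ u, ((A u).card : ℝ) := by
    rw [edges, Finset.card_sigma]
    push_cast
    rfl
  rw [edgeFraction, ← hnum, ← hden]

lemma sum_ind_mem (a : Finset (Fin N)) : ∑ s, ind (s ∈ a) = a.card := by
  rw [← Finset.sum_subset (Finset.subset_univ a), Finset.sum_congr rfl fun s hs => ind_true hs]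
  · simp
  · intro s _ hs
    exact ind_false hs

/-- Replacing the random number of edges by its mean. -/
lemma abs_edgeFraction_mul_sub_le (A : Fin K → Finset (Fin N)) (m : Fin K → Fin N → Prop) (y : ℝ) :
    |edgeFraction A m * y - ∑ u, ∑ s, ind (s ∈ A u) * ind (m u s)| ≤
      |∑ u, ((A u).card : ℝ) - y| := by
  rw [edgeFraction_eq]
  set x := ∑ u, ∑ s, ind (s ∈ A u) * ind (m u s) with hx
  set t := ∑ u, ((A u).card : ℝ) with ht
  have hx0 : 0 ≤ x := Finset.sum_nonneg fun u _ => Finset.sum_nonneg fun s _ =>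
    mul_nonneg (ind_nonneg _) (ind_nonneg _)
  have hxt : x ≤ t := by
    refine Finset.sum_le_sum fun u _ => ?_
    rw [← sum_ind_mem]
    exact Finset.sum_le_sum fun s _ => mul_le_of_le_one_right (ind_nonneg _) (ind_le_one _)
  -- In a frame without edges the fraction is `0 / 0 = 0` and the count is zero, so the bound
  -- persists.
  rcases eq_or_lt_of_le (hx0.trans hxt) with h0 | hpos
  · rw [← h0, div_zero, zero_mul]
    have : x = 0 := by linarith
    rw [this, sub_zero, abs_zero]
    exact abs_nonneg _
  · have : x / t * y - x = -(x / t * (t - y)) := by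
      rw [mul_sub, div_mul_cancel₀ _ hpos.ne']
      ring
    rw [this, abs_neg, abs_mul, abs_of_nonneg (div_nonneg hx0 hpos.le)]
    exact mul_le_of_le_one_left (abs_nonneg _) ((div_le_one hpos).mpr hxt)

/-- Conditioning on the choice of one user. -/
lemma IsLaw.pexp_user {μ : Fin K → Finset (Fin N) → ℝ} (hμ : IsLaw μ) (u : Fin K)
    (G : Finset (Fin N) → (Fin K → Finset (Fin N)) → ℝ) :
    pexp μ (fun A => G (A u) (del A {u})) = ∑ a, μ u a * pexp (IRSA.delLaw μ {u}) (G a) := by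
  have h1 : ∀ A : Fin K → Finset (Fin N), G (A u) (del A {u}) =
      ∑ a, ind (A u = a) * G a (del A {u}) := by
    intro A
    have := sum_ind_eq_mul (A u) fun a => G a (del A {u})
    rw [← this]
    exact Finset.sum_congr rfl fun a _ => by rw [ind_congr eq_comm]
  simp_rw [h1, pexp_sum]
  refine Finset.sum_congr rfl fun a _ => ?_
  rw [hμ.pexp_reveal u (fun b => ind (b = a)) (G a), sum_mul_ind_eq]

/-- The surroundings of the edge `(u, s)` contain a cycle. -/
def EdgeCyclic (ℓ : ℕ) (A : Fin K → Finset (Fin N)) (u : Fin K) (s : Fin N) : Prop :=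
  HasCycle ℓ (del A {u}) s ∨ ∃ z, z ∈ A u ∧ z ≠ s ∧ Conn ℓ (del A {u}) s z

/-- At the root only `u` is deleted, and it plays the role of the virtual user of the cavity
message. -/
lemma slotMsg_iff_cav_of_not_edgeCyclic {dec : Fin N → ℕ → ℕ → Prop} {ℓ : ℕ}
    {A : Fin K → Finset (Fin N)} {u : Fin K} {s : Fin N} (hs : s ∈ A u)
    (h : ¬ EdgeCyclic ℓ A u s) : slotMsg dec A ℓ u s ↔ cav dec (ℓ + 1) (del A {u}) s := by
  refine slotMsg_iff_cav (Finset.mem_singleton_self u) hs (fun hc => h (Or.inl hc)) ?_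
  intro f hf z hz hne hconn
  rw [Finset.mem_singleton] at hf
  subst hf
  exact h (Or.inr ⟨z, hz, fun hzs => hne (by rw [hzs]), hconn⟩)

/-- The expected number of edges of a user with cyclic surroundings is small. -/
lemma exists_sum_pr_edgeCyclic_le {c κ : ℝ} (hc : 0 ≤ c) (hκ : 0 ≤ κ) (ℓ : ℕ) : ∃ C : ℝ, 0 ≤ C ∧
    ∀ (K N : ℕ) (μ : Fin K → Finset (Fin N) → ℝ), Sparse c μ → 0 < N → (K : ℝ) ≤ κ * N →
      ∀ u, ∑ s, pr μ (fun A => s ∈ A u ∧ EdgeCyclic ℓ A u s) ≤ C / N := by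
  obtain ⟨D, hD, hcyc⟩ := exists_pr_hasCycle_le hc hκ ℓ
  obtain ⟨C, hC, hconn⟩ := exists_pr_conn_le hc hκ ℓ
  refine ⟨c * D + c ^ 2 * C, by positivity, fun K N μ hμ hN hK u => ?_⟩
  have hN' : (0 : ℝ) < N := by positivity
  have h1 : ∀ s, pr μ (fun A => s ∈ A u ∧ HasCycle ℓ (del A {u}) s) ≤ c / N * (D / N) := by
    intro s
    simp_rw [pr, ind_and]
    rw [hμ.pexp_reveal u (fun a => ind (s ∈ a)) (fun B => ind (HasCycle ℓ B s))]
    refine mul_le_mul ?_ (hcyc K N _ (hμ.delLaw hc {u}) hN hK s)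
      (pr_nonneg (hμ.toIsLaw.delLaw {u}) fun B => HasCycle ℓ B s) (by positivity)
    simpa [Finset.singleton_subset_iff] using hμ.bound u {s} (by simp)
  have h2 : ∀ s z, pr μ (fun A => (z ≠ s ∧ {s, z} ⊆ A u) ∧ Conn ℓ (del A {u}) s z) ≤
      (c / N) ^ 2 * (C / N) := by
    intro s z
    simp_rw [pr, ind_and _ (Conn ℓ _ s z)]
    rw [hμ.pexp_reveal u (fun a => ind (z ≠ s ∧ {s, z} ⊆ a)) (fun B => ind (Conn ℓ B s z))]
    by_cases hzs : z = s
    · rw [Finset.sum_eq_zero, zero_mul]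
      · positivity
      · intro a _
        rw [ind_false (by tauto), mul_zero]
    · refine mul_le_mul ?_ (hconn K N _ (hμ.delLaw hc {u}) hN hK s z (Ne.symm hzs))
        (pr_nonneg (hμ.toIsLaw.delLaw {u}) fun B => Conn ℓ B s z) (by positivity)
      have := hμ.bound u {s, z} (by rw [Finset.card_pair (Ne.symm hzs)]; norm_num)
      rw [Finset.card_pair (Ne.symm hzs)] at this
      simpa [hzs] using this
  have h3 : ∀ s, pr μ (fun A => s ∈ A u ∧ EdgeCyclic ℓ A u s) ≤
      c / N * (D / N) + N * ((c / N) ^ 2 * (C / N)) := by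
    intro s
    calc _ ≤ pr μ (fun A => (s ∈ A u ∧ HasCycle ℓ (del A {u}) s) ∨
          ∃ z, (z ≠ s ∧ {s, z} ⊆ A u) ∧ Conn ℓ (del A {u}) s z) := by
          refine pr_mono hμ.toIsLaw ?_
          rintro A ⟨hs, h | ⟨z, hz, hzs, h⟩⟩
          · exact Or.inl ⟨hs, h⟩
          · exact Or.inr ⟨z, ⟨hzs, by simp [Finset.insert_subset_iff, hs, hz]⟩, h⟩
      _ ≤ _ := (pr_or_le hμ.toIsLaw _ _).trans (add_le_add (h1 s) ?_)
    refine (hμ.pexp_mono fun A => ind_exists_le _).trans ?_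
    rw [pexp_sum]
    refine (Finset.sum_le_sum fun z _ => h2 s z).trans ?_
    simp [Finset.sum_const, Finset.card_univ]
  refine (Finset.sum_le_sum fun s _ => h3 s).trans (le_of_eq ?_)
  rw [Finset.sum_const, Finset.card_univ, Fintype.card_fin, nsmul_eq_mul]
  field_simp

end EdgeFraction

/-! ### From the edges of one user to a uniformly random edge. -/

namespace Ensemble

variable (M : Ensemble)

/-- The law of the users. -/
def userLaws (n : ℕ) : Fin (M.K n) → Finset (Fin (M.N n)) → ℝ := fun _ => M.m n

/-- Expectation over frames and decoder tables. -/
def expect (n : ℕ)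
    (F : (Fin (M.K n) → Finset (Fin (M.N n))) → (Fin (M.N n) → M.Ω n) → ℝ) : ℝ :=
  pexp (M.userLaws n) fun A => pexp (fun _ => M.ν n) fun τ => F A τ

/-- The untouched frame is the exploration state with nothing removed, where the moment estimates
start. -/
lemma userLaws_eq_live {n : ℕ} (hm : ∑ a, M.m n a = 1) :
    M.userLaws n = live (M.m n) Finset.univ Finset.univ := by
  have : massIn (M.m n) Finset.univ = 1 := by
    simpa [massIn, ind_true] using hm
  ext v a
  simp [userLaws, live, condIn, this, ind_true]

lemma tendsto_K : Tendsto (fun n => (M.K n : ℝ)) atTop atTop := by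
  refine (M.tendsto_ratio.pos_mul_atTop M.κ_pos M.tendsto_natCast_N).congr' ?_
  filter_upwards [M.tendsto_N.eventually_gt_atTop 0] with n hn
  have : (0 : ℝ) < M.N n := by positivity
  field_simp

/-- Density of edges with a given property, from the expected number of such edges of a user. -/
lemma tendsto_expect_edgeFraction
    (msg : ∀ n, (Fin (M.K n) → Finset (Fin (M.N n))) → (Fin (M.N n) → M.Ω n) →
      Fin (M.K n) → Fin (M.N n) → Prop) (hw : 0 < M.w 1) (x : ℝ)
    (h : ∀ ε > 0, ∀ᶠ n in atTop, ∀ u, |M.expect n (fun A τ =>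
      ∑ s, ind (s ∈ A u) * ind (msg n A τ u s)) - M.w 1 * x| ≤ ε) :
    Tendsto (fun n => M.expect n fun A τ => edgeFraction A (msg n A τ)) atTop (𝓝 x) := by
  rw [Metric.tendsto_atTop']
  suffices ∀ ε > 0, ∀ᶠ n in atTop, |M.expect n (fun A τ => edgeFraction A (msg n A τ)) - x| ≤ ε by
    intro ε hε
    obtain ⟨n₀, hn₀⟩ := eventually_atTop.mp (this (ε / 2) (by positivity))
    exact ⟨n₀, fun n hn => lt_of_le_of_lt (hn₀ n hn.le) (by linarith)⟩
  intro ε hε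
  have hsqrt : Tendsto (fun n => (M.d : ℝ) / M.w 1 / √(M.K n)) atTop (𝓝 0) :=
    (Real.tendsto_sqrt_atTop.comp M.tendsto_K).const_div_atTop _
  filter_upwards [h (M.w 1 * (ε / 2)) (by positivity), M.weights,
    M.tendsto_N.eventually_gt_atTop 0, M.tendsto_K.eventually_gt_atTop 0,
    hsqrt.eventually (gt_mem_nhds (show 0 < ε / 2 by positivity))] with n hn hm hN hK hs
  have hN' : (0 : ℝ) < M.N n := by positivity
  have hμ : IsLaw (M.userLaws n) := ⟨fun _ => hm.nonneg, fun _ => hm.sum_one⟩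
  have hν := M.isLaw_ν n
  have hmean : ∑ a, M.m n a * (a.card : ℝ) = M.w 1 := by
    calc _ = ∑ s, ∑ a, M.m n a * (ind (s ∈ a) * 1 ^ (a.card - 1)) := by
          rw [Finset.sum_comm]
          refine Finset.sum_congr rfl fun a _ => ?_
          simp only [one_pow, mul_one]
          rw [← Finset.mul_sum, sum_ind_mem]
      _ = ∑ _s : Fin (M.N n), M.w 1 / M.N n := Finset.sum_congr rfl fun s _ => hm.edge s 1
      _ = _ := by
          rw [Finset.sum_const, Finset.card_univ, Fintype.card_fin, nsmul_eq_mul]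
          field_simp
  have hwd : M.w 1 ≤ M.d := by
    rw [← hmean]
    calc _ ≤ ∑ a, M.m n a * (M.d : ℝ) := by
          refine Finset.sum_le_sum fun a _ => ?_
          by_cases ha : M.m n a = 0
          · simp [ha]
          · exact mul_le_mul_of_nonneg_left (by exact_mod_cast hm.card_le a ha) (hm.nonneg a)
      _ = M.d := by rw [← Finset.sum_mul, hm.sum_one, one_mul]
  have hvar := hμ.pexp_sum_sq_le (fun a => (a.card : ℝ)) (M.w 1) ((M.d : ℝ) ^ 2) (fun _ => hmean)
    (fun _ a ha => by
      have h1 : (a.card : ℝ) ≤ M.d := by exact_mod_cast hm.card_le a ha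
      have h2 : (0 : ℝ) ≤ a.card := Nat.cast_nonneg _
      exact sq_le_sq' (by linarith) (by linarith))
  rw [Fintype.card_fin] at hvar
  -- The number of edges fluctuates by order `√K` around a mean of order `K`, so replacing it by its
  -- mean is harmless.
  have hdev : pexp (M.userLaws n) (fun A => |∑ u, ((A u).card : ℝ) - M.K n * M.w 1|) ≤
      √(M.K n) * M.d := by
    refine le_of_sq_le_sq ?_ (by positivity)
    refine (hμ.sq_pexp_abs_le _).trans (hvar.trans (le_of_eq ?_))
    rw [mul_pow, Real.sq_sqrt hK.le]
  have herr : |M.expect n (fun A τ => edgeFraction A (msg n A τ)) * (M.K n * M.w 1) -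
      ∑ u, M.expect n (fun A τ => ∑ s, ind (s ∈ A u) * ind (msg n A τ u s))| ≤ √(M.K n) * M.d := by
    refine le_trans ?_ hdev
    have : M.expect n (fun A τ => edgeFraction A (msg n A τ)) * (M.K n * M.w 1) -
        ∑ u, M.expect n (fun A τ => ∑ s, ind (s ∈ A u) * ind (msg n A τ u s)) =
        pexp (M.userLaws n) fun A => pexp (fun _ => M.ν n) fun τ =>
          edgeFraction A (msg n A τ) * (M.K n * M.w 1) -
            ∑ u, ∑ s, ind (s ∈ A u) * ind (msg n A τ u s) := by
      simp only [expect, pexp_sub, pexp_mul_const]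
      congr 1
      rw [← pexp_sum]
      congr 1; ext A
      rw [← pexp_sum]
    rw [this]
    refine (hμ.abs_pexp_le _).trans (hμ.pexp_mono fun A => ?_)
    exact (hν.abs_pexp_le _).trans (hν.pexp_le_const fun τ => abs_edgeFraction_mul_sub_le _ _ _)
  have hsum : |∑ u, M.expect n (fun A τ => ∑ s, ind (s ∈ A u) * ind (msg n A τ u s)) -
      M.K n * M.w 1 * x| ≤ M.K n * (M.w 1 * (ε / 2)) := by
    have h1 : (M.K n : ℝ) * M.w 1 * x = ∑ _u : Fin (M.K n), M.w 1 * x := by simp; ring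
    rw [h1, ← Finset.sum_sub_distrib]
    refine (Finset.abs_sum_le_sum_abs _ _).trans ((Finset.sum_le_sum fun u _ => hn u).trans ?_)
    simp
  have htot := (abs_sub_le _ _ _).trans (add_le_add herr hsum)
  have hKw : 0 < M.K n * M.w 1 := by positivity
  rw [mul_comm (M.K n * M.w 1) x, ← sub_mul, abs_mul, abs_of_pos hKw] at htot
  have hs' : √(M.K n) * M.d ≤ M.K n * M.w 1 * (ε / 2) := by
    have hsq : 0 < √(M.K n : ℝ) := Real.sqrt_pos.mpr hK
    rw [div_div, div_lt_iff₀ (by positivity)] at hs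
    calc √(M.K n : ℝ) * M.d ≤ √(M.K n : ℝ) * (ε / 2 * (M.w 1 * √(M.K n))) := by gcongr
      _ = (√(M.K n : ℝ) * √(M.K n)) * M.w 1 * (ε / 2) := by ring
      _ = _ := by rw [Real.mul_self_sqrt hK.le]
  refine le_of_mul_le_mul_right ?_ hKw
  nlinarith

end Ensemble

namespace Ensemble

variable (M : Ensemble)

lemma sum_sum_mem_mul {n : ℕ} (hm : UserWeights M.c M.d M.w (M.m n)) (hN : 0 < M.N n) (p : ℝ) :
    ∑ a, M.m n a * ∑ s, ind (s ∈ a) * p ^ (a.card - 1) = M.w p := by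
  have hN' : (0 : ℝ) < M.N n := by positivity
  calc _ = ∑ s, ∑ a, M.m n a * (ind (s ∈ a) * p ^ (a.card - 1)) := by
        rw [Finset.sum_comm]
        exact Finset.sum_congr rfl fun a _ => Finset.mul_sum _ _ _
    _ = ∑ _s : Fin (M.N n), M.w p / M.N n := Finset.sum_congr rfl fun s _ => hm.edge s p
    _ = _ := by
        rw [Finset.sum_const, Finset.card_univ, Fintype.card_fin, nsmul_eq_mul]
        field_simp

/-- Expected sums over the edges of a user, given the limits of the conditional expectations. -/
lemma abs_expect_user_sub_le {n : ℕ} (hm : UserWeights M.c M.d M.w (M.m n)) (hN : 0 < M.N n)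
    (u : Fin (M.K n)) (Φ : Finset (Fin (M.N n)) → Fin (M.N n) →
      (Fin (M.K n) → Finset (Fin (M.N n))) → (Fin (M.N n) → M.Ω n) → ℝ)
    (val : Finset (Fin (M.N n)) → ℝ) {ε : ℝ}
    (hΦ : ∀ a s, M.m n a ≠ 0 → s ∈ a → |(pexp (live (M.m n) (Finset.univ \ {u}) Finset.univ) fun B =>
      pexp (fun _ => M.ν n) fun τ => Φ a s B τ) - val a| ≤ ε) :
    |M.expect n (fun A τ => ∑ s, ind (s ∈ A u) * Φ (A u) s (del A {u}) τ) -
      ∑ a, M.m n a * ∑ s, ind (s ∈ a) * val a| ≤ M.w 1 * ε := by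
  have hμ : IsLaw (M.userLaws n) := ⟨fun _ => hm.nonneg, fun _ => hm.sum_one⟩
  have h1 : M.expect n (fun A τ => ∑ s, ind (s ∈ A u) * Φ (A u) s (del A {u}) τ) =
      ∑ a, M.m n a * ∑ s, ind (s ∈ a) * pexp (live (M.m n) (Finset.univ \ {u}) Finset.univ)
        fun B => pexp (fun _ => M.ν n) fun τ => Φ a s B τ := by
    have := hμ.pexp_user u fun a B => pexp (fun _ => M.ν n) fun τ => ∑ s, ind (s ∈ a) * Φ a s B τ
    rw [expect, this, M.userLaws_eq_live hm.sum_one, delLaw_live]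
    rw [← M.userLaws_eq_live hm.sum_one]
    refine Finset.sum_congr rfl fun a _ => ?_
    simp_rw [pexp_sum, pexp_const_mul]
    rfl
  rw [h1, ← Finset.sum_sub_distrib]
  have h2 := M.sum_sum_mem_mul hm hN 1
  simp only [one_pow, mul_one] at h2
  rw [← h2, Finset.sum_mul]
  refine (Finset.abs_sum_le_sum_abs _ _).trans (Finset.sum_le_sum fun a _ => ?_)
  rw [← mul_sub, abs_mul, abs_of_nonneg (hm.nonneg a), mul_assoc]
  by_cases ha : M.m n a = 0
  · simp [ha]
  refine mul_le_mul_of_nonneg_left ?_ (hm.nonneg a)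
  rw [← Finset.sum_sub_distrib, Finset.sum_mul]
  refine (Finset.abs_sum_le_sum_abs _ _).trans (Finset.sum_le_sum fun s _ => ?_)
  rw [← mul_sub, abs_mul, abs_of_nonneg (ind_nonneg _)]
  by_cases hs : s ∈ a
  · exact mul_le_mul_of_nonneg_left (hΦ a s ha hs) (ind_nonneg _)
  · rw [ind_false hs, zero_mul, zero_mul]

lemma abs_expect_sub_expect_le {n : ℕ} (hm : UserWeights M.c M.d M.w (M.m n))
    {F G : (Fin (M.K n) → Finset (Fin (M.N n))) → (Fin (M.N n) → M.Ω n) → ℝ}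
    {H : (Fin (M.K n) → Finset (Fin (M.N n))) → ℝ}
    (h : ∀ A, (∀ v, M.m n (A v) ≠ 0) → ∀ τ, |F A τ - G A τ| ≤ H A) :
    |M.expect n F - M.expect n G| ≤ pexp (M.userLaws n) H := by
  have hμ : IsLaw (M.userLaws n) := ⟨fun _ => hm.nonneg, fun _ => hm.sum_one⟩
  have hν := M.isLaw_ν n
  rw [expect, expect, ← pexp_sub]
  refine (hμ.abs_pexp_le _).trans (hμ.pexp_mono_support fun A hA => ?_)
  rw [← pexp_sub]
  exact (hν.abs_pexp_le _).trans (hν.pexp_le_const fun τ => h A hA τ)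

lemma abs_ind_sub_ind_le {P Q R : Prop} (h : ¬ R → (P ↔ Q)) : |ind P - ind Q| ≤ ind R := by
  by_cases hR : R
  · rw [ind_true hR, abs_sub_le_iff]
    constructor <;> linarith [ind_nonneg P, ind_nonneg Q, ind_le_one P, ind_le_one Q]
  · rw [ind_congr (h hR), sub_self, abs_zero]
    exact ind_nonneg _

lemma exists_cyclic_bound (ℓ : ℕ) : ∃ C : ℝ, 0 ≤ C ∧ ∀ᶠ n in atTop, ∀ u,
    ∑ s, pr (M.userLaws n) (fun A => s ∈ A u ∧ EdgeCyclic ℓ A u s) ≤ C / M.N n := by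
  obtain ⟨C, hC, h⟩ := exists_sum_pr_edgeCyclic_le (c := 2 * M.c) (κ := M.κ + 1)
    (mul_nonneg (by norm_num) M.c_nonneg) (by linarith [M.κ_pos]) ℓ
  refine ⟨C, hC, ?_⟩
  filter_upwards [M.weights, M.eventually_massIn 0, M.eventually_K_le,
    M.tendsto_N.eventually_gt_atTop 0] with n hm hmass hK hN u
  have := hm.sparse_live M.c_nonneg (Finset.univ : Finset (Fin (M.K n))) (hmass Finset.univ (by simp))
  rw [← M.userLaws_eq_live hm.sum_one] at this
  exact h _ _ _ this hN hK u

/-- Density evolution for the slot-to-user messages. -/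
lemma tendsto_slotMsg (hw : 0 < M.w 1) (ℓ : ℕ) :
    Tendsto (fun n => M.expect n fun A τ => edgeFraction A (slotMsg (fun s => M.D n (τ s)) A ℓ))
      atTop (𝓝 (M.evol (ℓ + 1))) := by
  refine M.tendsto_expect_edgeFraction (fun n A τ => slotMsg (fun s => M.D n (τ s)) A ℓ) hw _ ?_
  intro ε hε
  obtain ⟨C, hC, hcyc⟩ := M.exists_cyclic_bound ℓ
  filter_upwards [hcyc, M.eventually_div_le C (show 0 < ε / 2 by positivity), M.weights,
    M.tendsto_N.eventually_gt_atTop 0,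
    M.momentsConverge ℓ 1 1 (ε / 2 / M.w 1) (by positivity)] with n hcyc hCN hm hN hmom u
  have h1 := M.abs_expect_user_sub_le hm hN u
    (fun _ s B τ => ind (cav (fun s => M.D n (τ s)) (ℓ + 1) B s)) (fun _ => M.evol (ℓ + 1))
    (ε := ε / 2 / M.w 1) (by
      intro a s _ _
      have := hmom (Finset.univ \ {u}) Finset.univ {s} ∅
        (by rw [← Finset.compl_eq_univ_sdiff, compl_compl, Finset.card_singleton])
        (by simp) (by simp) (by simp) (by simp) (by simp) (by simp)
      simpa [cavMoment] using this)
  have h2 : ∑ a, M.m n a * ∑ s, ind (s ∈ a) * M.evol (ℓ + 1) = M.w 1 * M.evol (ℓ + 1) := by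
    rw [← M.sum_sum_mem_mul hm hN 1, Finset.sum_mul]
    refine Finset.sum_congr rfl fun a _ => ?_
    simp only [one_pow, mul_one]
    rw [← Finset.sum_mul, mul_assoc]
  have h3 := M.abs_expect_sub_expect_le hm
    (F := fun A τ => ∑ s, ind (s ∈ A u) * ind (slotMsg (fun s => M.D n (τ s)) A ℓ u s))
    (G := fun A τ => ∑ s, ind (s ∈ A u) *
      ind (cav (fun s => M.D n (τ s)) (ℓ + 1) (del A {u}) s))
    (H := fun A => ∑ s, ind (s ∈ A u ∧ EdgeCyclic ℓ A u s)) (by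
      intro A _ τ
      rw [← Finset.sum_sub_distrib]
      refine (Finset.abs_sum_le_sum_abs _ _).trans (Finset.sum_le_sum fun s _ => ?_)
      rw [← ind_and, ← ind_and]
      refine abs_ind_sub_ind_le fun hR => and_congr_right fun hs => ?_
      exact slotMsg_iff_cav_of_not_edgeCyclic hs fun h => hR ⟨hs, h⟩)
  rw [pexp_sum] at h3
  have h4 := (abs_sub_le _ _ _).trans (add_le_add (h3.trans (hcyc u)) h1)
  rw [h2] at h4
  refine h4.trans ?_
  rw [mul_div_cancel₀ _ hw.ne']
  linarith

/-- Density evolution for the user-to-slot messages. -/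
lemma tendsto_userMsg (hw : 0 < M.w 1) (ℓ : ℕ) :
    Tendsto (fun n => M.expect n fun A τ => edgeFraction A (userMsg (fun s => M.D n (τ s)) A ℓ))
      atTop (𝓝 (M.w (M.evol ℓ) / M.w 1)) := by
  refine M.tendsto_expect_edgeFraction (fun n A τ => userMsg (fun s => M.D n (τ s)) A ℓ) hw _ ?_
  intro ε hε
  -- User messages of iteration `ℓ` are built from slot messages of iteration `ℓ - 1`. For `ℓ = 0`
  -- the truncated value plays no role, as both messages are true.
  obtain ⟨C, hC, hcyc⟩ := M.exists_cyclic_bound (ℓ - 1)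
  filter_upwards [hcyc, M.eventually_div_le (M.d * C) (show 0 < ε / 2 by positivity), M.weights,
    M.tendsto_N.eventually_gt_atTop 0,
    M.momentsConverge ℓ 0 (M.d + 1) (ε / 2 / M.w 1) (by positivity)] with n hcyc hCN hm hN hmom u
  have h1 := M.abs_expect_user_sub_le hm hN u
    (fun a s B τ => ∏ y ∈ a.erase s, ind (cav (fun s => M.D n (τ s)) ℓ B y))
    (fun a => M.evol ℓ ^ (a.card - 1)) (ε := ε / 2 / M.w 1) (by
      intro a s ha hs
      have := hmom (Finset.univ \ {u}) Finset.univ ∅ (a.erase s)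
        (by rw [← Finset.compl_eq_univ_sdiff, compl_compl, Finset.card_singleton]; omega)
        (by simp) (by simp) (by simp) (by simp) (by simp) (by
          have := hm.card_le a ha
          have := Finset.card_erase_le (s := a) (a := s)
          omega)
      simpa [cavMoment, Finset.card_erase_of_mem hs] using this)
  rw [M.sum_sum_mem_mul hm hN] at h1
  have h3 := M.abs_expect_sub_expect_le hm
    (F := fun A τ => ∑ s, ind (s ∈ A u) * ind (userMsg (fun s => M.D n (τ s)) A ℓ u s))
    (G := fun A τ => ∑ s, ind (s ∈ A u) *
      ∏ y ∈ (A u).erase s, ind (cav (fun s => M.D n (τ s)) ℓ (del A {u}) y))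
    -- A single cyclic edge of `u` can spoil the messages along all edges of `u`, of which there are
    -- at most `d`.
    (H := fun A => M.d * ∑ y, ind (y ∈ A u ∧ EdgeCyclic (ℓ - 1) A u y)) (by
      intro A hA τ
      rw [← Finset.sum_sub_distrib]
      have hterm : ∀ s, |ind (s ∈ A u) * ind (userMsg (fun s => M.D n (τ s)) A ℓ u s) -
          ind (s ∈ A u) * ∏ y ∈ (A u).erase s, ind (cav (fun s => M.D n (τ s)) ℓ (del A {u}) y)| ≤
          ind (s ∈ A u) * ∑ y, ind (y ∈ A u ∧ EdgeCyclic (ℓ - 1) A u y) := by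
        intro s
        rw [← mul_sub, abs_mul, abs_of_nonneg (ind_nonneg _)]
        refine mul_le_mul_of_nonneg_left ?_ (ind_nonneg _)
        rw [← ind_forall_mem]
        refine (abs_ind_sub_ind_le fun hR => ?_).trans (ind_exists_le _)
        cases ℓ with
        | zero => simp [userMsg, cav]
        | succ ℓ =>
          simp only [Finset.mem_erase]
          have hmsg : ∀ y ∈ A u, slotMsg (fun s => M.D n (τ s)) A ℓ u y ↔
              cav (fun s => M.D n (τ s)) (ℓ + 1) (del A {u}) y := fun y hy =>
            slotMsg_iff_cav_of_not_edgeCyclic hy fun h => hR ⟨y, hy, h⟩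
          exact ⟨fun h y hy => (hmsg y hy.2).mp (h y hy.2 hy.1),
            fun h y hy hys => (hmsg y hy).mpr (h y ⟨hys, hy⟩)⟩
      refine (Finset.abs_sum_le_sum_abs _ _).trans ((Finset.sum_le_sum fun s _ => hterm s).trans ?_)
      rw [← Finset.sum_mul, sum_ind_mem]
      refine mul_le_mul_of_nonneg_right (by exact_mod_cast hm.card_le _ (hA u)) ?_
      exact Finset.sum_nonneg fun _ _ => ind_nonneg _)
  rw [pexp_const_mul, pexp_sum] at h3
  have h3' := h3.trans (mul_le_mul_of_nonneg_left (hcyc u) (Nat.cast_nonneg M.d))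
  rw [← mul_div_assoc] at h3'
  have h4 := (abs_sub_le _ _ _).trans (add_le_add (h3'.trans hCN) h1)
  rw [mul_div_cancel₀ _ hw.ne']
  refine h4.trans ?_
  rw [mul_div_cancel₀ _ hw.ne']
  linarith

end Ensemble

/-! ### Reduction of the uniform variables to finite decoder tables. -/

section Tables

/-- Outcomes of the decoder of a slot for all relevant numbers of packets. -/
abbrev Table (K : ℕ) : Type := Fin (K + 2) → Fin (K + 2) → Bool

open Classical in
/-- The decoder outcomes determined by the random variable of a slot. -/
def tableOf (T : ℕ) (PE : ℕ → ℝ) (γ : ℝ) (K : ℕ) (x : I) : Table K :=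
  fun h t => decide (SlotDecoded T PE γ h t x)

/-- Decoding according to a table. -/
def tableDec (K : ℕ) (ω : Table K) (h t : ℕ) : Prop :=
  ω (Fin.ofNat (K + 2) h) (Fin.ofNat (K + 2) t) = true

/-- `Fin.ofNat` reduces modulo `K + 2`, so the bounds on `h` and `t` are essential. -/
lemma tableDec_tableOf {T : ℕ} {PE : ℕ → ℝ} {γ : ℝ} {K : ℕ} {x : I} {h t : ℕ} (hh : h < K + 2)
    (ht : t < K + 2) : tableDec K (tableOf T PE γ K x) h t ↔ SlotDecoded T PE γ h t x := by
  simp [tableDec, tableOf, Fin.ofNat, Nat.mod_eq_of_lt hh, Nat.mod_eq_of_lt ht]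

lemma measurableSet_slotDecoded (T : ℕ) (PE : ℕ → ℝ) (γ : ℝ) (h t : ℕ) :
    MeasurableSet {x : I | SlotDecoded T PE γ h t x} := by
  unfold SlotDecoded
  by_cases hT : t ≤ T
  · simp only [hT, true_and]
    exact measurableSet_lt measurable_subtype_coe measurable_const
  · simp [hT]

lemma measurable_tableOf (T : ℕ) (PE : ℕ → ℝ) (γ : ℝ) (K : ℕ) :
    Measurable (tableOf T PE γ K) := by
  refine measurable_pi_iff.mpr fun h => measurable_pi_iff.mpr fun t => measurable_to_bool ?_
  convert measurableSet_slotDecoded T PE γ h t using 1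
  ext x
  simp [tableOf]

/-- The law of the decoder outcomes of a slot. -/
def tableLaw (T : ℕ) (PE : ℕ → ℝ) (γ : ℝ) (K : ℕ) : Measure (Table K) :=
  (volume : Measure I).map (tableOf T PE γ K)

instance (T : ℕ) (PE : ℕ → ℝ) (γ : ℝ) (K : ℕ) : IsProbabilityMeasure (tableLaw T PE γ K) :=
  Measure.isProbabilityMeasure_map (measurable_tableOf T PE γ K).aemeasurable

lemma sum_measureReal_singleton_eq_one {Ω : Type*} [Fintype Ω] [MeasurableSpace Ω]
    [MeasurableSingletonClass Ω] (μ : Measure Ω) [IsProbabilityMeasure μ] :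
    ∑ ω, μ.real {ω} = 1 := by
  have := integral_fintype (μ := μ) (f := fun _ : Ω => (1 : ℝ)) (Integrable.of_finite)
  simpa only [smul_eq_mul, mul_one, integral_const, probReal_univ] using this.symm

lemma sum_tableLaw_mul_ind {T : ℕ} {PE : ℕ → ℝ} {γ : ℝ}
    (hPE : ∀ t ∈ Finset.Icc 1 T, PE t ∈ Set.Icc (0 : ℝ) 1) (hγ0 : 0 ≤ γ) (hγ1 : γ ≤ 1)
    {K k j : ℕ} (hjk : j ≤ k) (hk : k ≤ K) :
    ∑ ω, (tableLaw T PE γ K).real {ω} * ind (tableDec K ω (k + 1) (1 + j)) =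
      successProb T PE γ k j := by
  have h1 := integral_fintype (μ := tableLaw T PE γ K)
    (f := fun ω => ind (tableDec K ω (k + 1) (1 + j))) (Integrable.of_finite)
  simp only [smul_eq_mul] at h1
  rw [← h1, tableLaw, integral_map (measurable_tableOf T PE γ K).aemeasurable
    (measurable_of_finite _).aestronglyMeasurable]
  have h2 : ∀ x : I, ind (tableDec K (tableOf T PE γ K x) (k + 1) (1 + j)) =
      Set.indicator {x : I | SlotDecoded T PE γ (k + 1) (1 + j) x} 1 x := by
    intro x
    rw [ind_congr (tableDec_tableOf (by omega) (by omega))]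
    by_cases h : SlotDecoded T PE γ (k + 1) (1 + j) x <;> simp [ind, h, Set.indicator]
  simp_rw [h2]
  rw [integral_indicator_one (measurableSet_slotDecoded _ _ _ _ _), successProb]
  have hmem := successProb_mem hPE hγ0 hγ1 k j
  unfold successProb at hmem
  split_ifs at hmem ⊢ with hj
  -- With `k + 1` packets and `1 + j` remaining, decoding succeeds on an initial interval whose
  -- length is the success probability.
  · have hset : {x : I | SlotDecoded T PE γ (k + 1) (1 + j) x} =
        Set.Iio (⟨(1 - PE (j + 1)) * γ ^ (k - j), hmem⟩ : I) := by
      ext x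
      have hsub : k + 1 - (j + 1) = k - j := by omega
      simp only [SlotDecoded, add_comm 1 j, Nat.succ_le_of_lt hj, true_and, hsub,
        Set.mem_ofPred_eq, Set.mem_Iio]
      exact Iff.rfl
    rw [hset, measureReal_def, unitInterval.volume_Iio, ENNReal.toReal_ofReal hmem.1]
  · have hset : {x : I | SlotDecoded T PE γ (k + 1) (1 + j) x} = ∅ := by
      ext x
      simp only [SlotDecoded, Set.mem_ofPred_eq, Set.mem_empty_iff_false, iff_false, not_and]
      omega
    rw [hset, measureReal_empty]

lemma integral_pi_eq_pexp {ι Ω : Type*} [Fintype ι] [DecidableEq ι] [Fintype Ω]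
    [MeasurableSpace Ω] [MeasurableSingletonClass Ω] (μ : Measure Ω) [IsProbabilityMeasure μ]
    (F : (ι → Ω) → ℝ) :
    ∫ x, F x ∂(Measure.pi fun _ : ι => μ) = pexp (fun _ ω => μ.real {ω}) F := by
  rw [integral_fintype (Integrable.of_finite), pexp]
  refine Finset.sum_congr rfl fun x _ => ?_
  rw [smul_eq_mul, measureReal_def, Measure.pi_singleton, ENNReal.toReal_prod]
  rfl

/-- Expectations over frames reduce to finite sums over frames and decoder tables. -/
lemma integral_frameLaw {π : ℝ≥0} (hπ : π ≤ 1) (Λ : PMF ℕ) (T : ℕ) (PE : ℕ → ℝ) (γ : ℝ) (K N : ℕ)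
    (F : (Fin K → Finset (Fin N)) → (Fin N → Table K) → ℝ) :
    ∫ ω, F ω.1 (fun s => tableOf T PE γ K (ω.2 s)) ∂(frameLaw π hπ Λ K N) =
      pexp (fun _ => userWeight π hπ Λ N) fun A =>
        pexp (fun _ ω => (tableLaw T PE γ K).real {ω}) (F A) := by
  have hmeas : Measurable fun (U : Fin N → I) s => tableOf T PE γ K (U s) :=
    measurable_pi_iff.mpr fun s => (measurable_tableOf T PE γ K).comp (measurable_pi_apply s)
  have hmap : (frameLaw π hπ Λ K N).map
      (Prod.map id fun (U : Fin N → I) s => tableOf T PE γ K (U s)) =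
      (Measure.pi fun _ : Fin K => (userLaw π hπ Λ N).toMeasure).prod
        (Measure.pi fun _ : Fin N => tableLaw T PE γ K) := by
    rw [frameLaw, ← Measure.map_prod_map _ _ measurable_id hmeas, Measure.map_id,
      Measure.pi_map_pi fun _ => (measurable_tableOf T PE γ K).aemeasurable]
    rfl
  have h1 : ∫ ω, F ω.1 (fun s => tableOf T PE γ K (ω.2 s)) ∂(frameLaw π hπ Λ K N) =
      ∫ z, F z.1 z.2 ∂((frameLaw π hπ Λ K N).map
        (Prod.map id fun (U : Fin N → I) s => tableOf T PE γ K (U s))) := by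
    rw [integral_map (measurable_id.prodMap hmeas).aemeasurable
      (measurable_of_finite _).aestronglyMeasurable]
    rfl
  rw [h1, hmap, integral_prod _ (Integrable.of_finite)]
  simp_rw [integral_pi_eq_pexp]
  congr 1
  ext v a
  rw [measureReal_def, PMF.toMeasure_apply_singleton _ _ (MeasurableSet.singleton a)]
  rfl

end Tables

/-! ### Application to slotted ALOHA. -/

section Main

variable {T dmax : ℕ} {Λ : PMF ℕ} {PE : ℕ → ℝ} {γ G : ℝ} {π : ℝ≥0} {K N : ℕ → ℕ}

/-- The ensemble of frames of irregular repetition slotted ALOHA. -/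
def aloha (hΛ : ∀ d ∈ Λ.support, 1 ≤ d ∧ d ≤ dmax)
    (hPE : ∀ t ∈ Finset.Icc 1 T, PE t ∈ Set.Icc (0 : ℝ) 1) (hγ0 : 0 ≤ γ) (hγ1 : γ ≤ 1)
    (hπ0 : 0 < π) (hπ1 : π ≤ 1) (hG : 0 < G) (hN : Tendsto N atTop atTop)
    (hK : Tendsto (fun n => (π : ℝ) * (K n : ℝ) / (N n : ℝ)) atTop (𝓝 G)) : Ensemble where
  K := K
  N := N
  m n := userWeight π hπ1 Λ (N n)
  Ω n := Table (K n)
  fin _ := inferInstance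
  D n := tableDec (K n)
  ν n ω := (tableLaw T PE γ (K n)).real {ω}
  T := T
  PE := PE
  γ := γ
  c := dmax
  d := dmax
  w := edgeMean π Λ dmax
  -- `G` counts active users per slot, whereas `κ` counts all users per slot.
  κ := G / π
  tendsto_N := hN
  tendsto_ratio := by
    have hπ : (π : ℝ) ≠ 0 := by exact_mod_cast hπ0.ne'
    refine (hK.div_const (π : ℝ)).congr fun n => ?_
    field_simp
  κ_pos := div_pos hG (by exact_mod_cast hπ0)
  c_nonneg := Nat.cast_nonneg _
  weights := (hN.eventually_ge_atTop dmax).mono fun _ hn => userWeights_userWeight hπ1 hΛ hn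
  ν_nonneg _ _ := measureReal_nonneg
  ν_sum _ := sum_measureReal_singleton_eq_one _
  PE_mem := hPE
  γ_nonneg := hγ0
  γ_le_one := hγ1
  success _ _ _ hjk hk := sum_tableLaw_mul_ind hPE hγ0 hγ1 hjk hk

lemma slotUnknownProb_eq {hπ1 : π ≤ 1} (K N ℓ : ℕ) :
    slotUnknownProb T PE γ π hπ1 Λ K N ℓ =
      pexp (fun _ : Fin K => userWeight π hπ1 Λ N) fun A =>
        pexp (fun (_ : Fin N) ω => (tableLaw T PE γ K).real {ω}) fun τ =>
          edgeFraction A (slotMsg (fun s => tableDec K (τ s)) A ℓ) := by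
  rw [← integral_frameLaw hπ1 Λ T PE γ K N fun A τ =>
    edgeFraction A (slotMsg (fun s => tableDec K (τ s)) A ℓ), slotUnknownProb]
  refine integral_congr_ae (Eventually.of_forall fun ω => ?_)
  simp only
  rw [slotUnknown_eq_slotMsg, slotMsg_congr fun s a b ha hb => (tableDec_tableOf ha hb).symm]

lemma userUnknownProb_eq {hπ1 : π ≤ 1} (K N ℓ : ℕ) :
    userUnknownProb T PE γ π hπ1 Λ K N ℓ =
      pexp (fun _ : Fin K => userWeight π hπ1 Λ N) fun A =>
        pexp (fun (_ : Fin N) ω => (tableLaw T PE γ K).real {ω}) fun τ =>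
          edgeFraction A (userMsg (fun s => tableDec K (τ s)) A ℓ) := by
  rw [← integral_frameLaw hπ1 Λ T PE γ K N fun A τ =>
    edgeFraction A (userMsg (fun s => tableDec K (τ s)) A ℓ), userUnknownProb]
  refine integral_congr_ae (Eventually.of_forall fun ω => ?_)
  simp only
  rw [userUnknown_eq_userMsg, userMsg_congr fun s a b ha hb => (tableDec_tableOf ha hb).symm]

lemma edgeMean_one : edgeMean π Λ dmax 1 = π * meanDegree Λ dmax := by
  simp [edgeMean, meanDegree, mul_comm]

lemma meanDegree_pos (hΛ : ∀ d ∈ Λ.support, 1 ≤ d ∧ d ≤ dmax) : 0 < meanDegree Λ dmax := by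
  refine one_pos.trans_le ?_
  rw [← sum_pmf_eq_one hΛ]
  refine Finset.sum_le_sum fun d hd => le_mul_of_one_le_left ENNReal.toReal_nonneg ?_
  exact_mod_cast (Finset.mem_Icc.mp hd).1

lemma edgeMean_div (hπ0 : 0 < π) (hΛ : ∀ d ∈ Λ.support, 1 ≤ d ∧ d ≤ dmax) (p : ℝ) :
    edgeMean π Λ dmax p / edgeMean π Λ dmax 1 = userNodeFun Λ dmax p := by
  have h1 := (meanDegree_pos hΛ).ne'
  have h2 : (π : ℝ) ≠ 0 := by exact_mod_cast hπ0.ne'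
  rw [edgeMean_one, edgeMean, userNodeFun]
  field_simp

lemma deriv_pgf (p : ℝ) :
    deriv (pgf Λ dmax) p = ∑ d ∈ Finset.Icc 1 dmax, (Λ d).toReal * d * p ^ (d - 1) := by
  have h : HasDerivAt (pgf Λ dmax)
      (∑ d ∈ Finset.Icc 1 dmax, (Λ d).toReal * (d * p ^ (d - 1))) p :=
    HasDerivAt.fun_sum fun d _ => (hasDerivAt_pow d p).const_mul _
  rw [h.deriv]
  exact Finset.sum_congr rfl fun d _ => by ring

lemma sum_Icc_one_eq_range (T : ℕ) (f : ℕ → ℝ) :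
    ∑ t ∈ Finset.Icc 1 T, f t = ∑ j ∈ Finset.range T, f (j + 1) := by
  rw [Finset.range_eq_Ico, Finset.sum_Ico_add' f 0 T 1]
  rfl

/-- At `q = 0` only the term `t = 1` survives, through `0 ^ 0 = 1`; `1 ≤ T` ensures that it is
present. -/
lemma slotNodeFun_zero (hT : 1 ≤ T) (γ a : ℝ) :
    slotNodeFun T PE γ a 0 = 1 - Real.exp (-(a * (1 - γ))) * (1 - PE 1) := by
  rw [slotNodeFun, sum_Icc_one_eq_range, Finset.sum_eq_single 0]
  · simp
  · intro j _ hj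
    simp [hj]
  · intro h
    simp at h
    omega

end Main

end

end IRSA

theorem corollary3
    (T dmax : ℕ) (hT : 1 ≤ T)
    (Λ : PMF ℕ) (hΛ : ∀ d ∈ Λ.support, 1 ≤ d ∧ d ≤ dmax)
    (PE : ℕ → ℝ) (hPE : ∀ t ∈ Finset.Icc 1 T, PE t ∈ Set.Icc (0 : ℝ) 1)
    (γ : ℝ) (hγ0 : 0 ≤ γ) (hγ1 : γ ≤ 1)
    (π : ℝ≥0) (hπ0 : 0 < π) (hπ1 : π ≤ 1)
    (G : ℝ) (hG : 0 < G)
    (K N : ℕ → ℕ) (hN : Tendsto N atTop atTop)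
    (hK : Tendsto (fun n => (π : ℝ) * (K n : ℝ) / (N n : ℝ)) atTop (𝓝 G)) :
    (∃ p q : ℕ → ℝ,
      (∀ ℓ, Tendsto (fun n => IRSA.slotUnknownProb T PE γ π hπ1 Λ (K n) (N n) ℓ)
        atTop (𝓝 (p ℓ))) ∧
      (∀ ℓ, Tendsto (fun n => IRSA.userUnknownProb T PE γ π hπ1 Λ (K n) (N n) ℓ)
        atTop (𝓝 (q ℓ))) ∧
      p 0 = 1 - Real.exp (-(G * IRSA.meanDegree Λ dmax)) *
        ∑ t ∈ Finset.Icc 1 T, (1 - PE t) *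
          ((G * IRSA.meanDegree Λ dmax) ^ (t - 1) / ((t - 1).factorial : ℝ)) ∧
      (∀ ℓ, 1 ≤ ℓ →
        p ℓ = IRSA.slotNodeFun T PE γ (G * IRSA.meanDegree Λ dmax) (q ℓ) ∧
        q ℓ = IRSA.userNodeFun Λ dmax (p (ℓ - 1)) ∧
        q ℓ = deriv (IRSA.pgf Λ dmax) (p (ℓ - 1)) / IRSA.meanDegree Λ dmax)) ∧
    IRSA.slotNodeFun T PE 1 (G * IRSA.meanDegree Λ dmax) 0 = PE 1 ∧
    IRSA.slotNodeFun T PE γ (G * IRSA.meanDegree Λ dmax) 0 =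
      IRSA.slotNodeFun T PE 1 (G * IRSA.meanDegree Λ dmax) 0 +
        (1 - PE 1) * (1 - Real.exp (-(G * IRSA.meanDegree Λ dmax * (1 - γ)))) := by
  let M := IRSA.aloha hΛ hPE hγ0 hγ1 hπ0 hπ1 hG hN hK
  have hπ : (π : ℝ) ≠ 0 := by exact_mod_cast hπ0.ne'
  have hd := IRSA.meanDegree_pos hΛ
  have hw1 : M.w 1 = π * IRSA.meanDegree Λ dmax := IRSA.edgeMean_one
  have hw : 0 < M.w 1 := by
    rw [hw1]
    exact mul_pos (by exact_mod_cast hπ0) hd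
  have hκ : M.κ = G / π := rfl
  -- Normalising `w x` by `w 1` removes the activity probability: `κ * w 1` is the mean number of
  -- replicas per slot, `G` times the mean degree.
  have hstep : ∀ x, M.step x = IRSA.slotNodeFun T PE γ (G * IRSA.meanDegree Λ dmax)
      (M.w x / M.w 1) := by
    intro x
    have h1 : M.κ * M.w 1 = G * IRSA.meanDegree Λ dmax := by
      rw [hw1, hκ]; field_simp
    have h2 : M.κ * M.w x = G * IRSA.meanDegree Λ dmax * (M.w x / M.w 1) := by
      rw [← h1]; field_simp
    rw [IRSA.Ensemble.step, h2, h1, IRSA.slotNodeFun, IRSA.sum_Icc_one_eq_range, Finset.mul_sum]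
    congr 1
    refine Finset.sum_congr rfl fun j _ => ?_
    rw [Nat.add_sub_cancel, show -(G * IRSA.meanDegree Λ dmax) +
      M.γ * (G * IRSA.meanDegree Λ dmax - G * IRSA.meanDegree Λ dmax * (M.w x / M.w 1)) =
      -(G * IRSA.meanDegree Λ dmax * (1 - γ + γ * (M.w x / M.w 1))) by
        rw [show M.γ = γ from rfl]; ring, show M.PE = PE from rfl]
    ring
  -- A slot message of iteration `ℓ` is a cavity message of level `ℓ + 1`, while a user message of
  -- iteration `ℓ` reads level `ℓ`. As `evol 0 = 1`, the starting point is `f_s` at `q = 1`.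
  refine ⟨⟨fun ℓ => M.evol (ℓ + 1), fun ℓ => M.w (M.evol ℓ) / M.w 1, fun ℓ => ?_, fun ℓ => ?_,
    ?_, ?_⟩, ?_, ?_⟩
  · simp_rw [IRSA.slotUnknownProb_eq]
    exact M.tendsto_slotMsg hw ℓ
  · simp_rw [IRSA.userUnknownProb_eq]
    exact M.tendsto_userMsg hw ℓ
  · show M.step 1 = _
    rw [hstep, div_self hw.ne', IRSA.slotNodeFun]
    ring_nf
  · intro ℓ hℓ
    obtain ⟨ℓ, rfl⟩ := Nat.exists_eq_add_of_le' hℓ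
    have hq : M.w (M.evol (ℓ + 1)) / M.w 1 = IRSA.userNodeFun Λ dmax (M.evol (ℓ + 1)) :=
      IRSA.edgeMean_div hπ0 hΛ _
    refine ⟨hstep _, hq, ?_⟩
    show M.w (M.evol (ℓ + 1)) / M.w 1 = deriv (IRSA.pgf Λ dmax) (M.evol (ℓ + 1)) / _
    rw [hq, IRSA.deriv_pgf, IRSA.userNodeFun, one_div_mul_eq_div]
  · rw [IRSA.slotNodeFun_zero hT]
    simp
  · rw [IRSA.slotNodeFun_zero hT, IRSA.slotNodeFun_zero hT]
    simp only [sub_self, mul_zero, neg_zero, Real.exp_zero]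
    ring
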